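/- Setting. Let $M=\begin{pmatrix}a&b\\c&d\end{pmatrix}\in GL(2,\mathbb Z)$ be hyperbolic (no eigenvalue of modulus $1$) with trace $r=a+d>0$ and determinant $\sigma=\pm1$, and let $T$ be the automorphism of $\mathbb T^2=\mathbb R^2/\mathbb Z^2$ given by $M$. Put $D=r^2-4\sigma$, $\lambda=\frac{r+\sqrt D}{2}>1$ and $f_T(x,y)=bx^2-(a-d)xy-cy^2$. The matrix $M$ is called primitive if there are no $K\in GL(2,\mathbb Z)$ and $n\ge 2$ with $M=K^n$. A point $x\in\mathbb T^2$ is homoclinic if $T^nx\to 0$ as $n\to\pm\infty$. Let $\widetilde{\mathfrak X}$ be the semigroup (under coordinatewise addition) of all sequences $\varepsilon=(\varepsilon_n)_{n\in\mathbb Z}$ of nonnegative integers for which $\sum_{n\ge1}\varepsilon_n\lambda^{-n}$ and $\sum_{n\ge1}\varepsilon_{-n}\lambda^{-n}$ converge, with the weakest topology making all coordinates and these two sums continuous, and let $(\tau\varepsilon)_n=\varepsilon_{n+1}$. An arithmetic coding of $T$ is a pair $(\varphi,\mathfrak X)$, where $\varphi:\widetilde{\mathfrak X}\to\mathbb T^2$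 is a continuous semigroup homomorphism with $\varphi\tau=T\varphi$, and $\mathfrak X\subset\widetilde{\mathfrak X}$ is a closed shift-invariant set such that * $\mathfrak X$ is total: if $\varepsilon\in\mathfrak X$, $N\in\mathbb Z$, and $\varepsilon'\in\widetilde{\mathfrak X}$ satisfies $(\varepsilon'_k,\varepsilon'_{k+1},\dots)\prec_{\rm lex}(\varepsilon_N,\varepsilon_{N+1},\dots)$ for all $k\in\mathbb Z$, then $\varepsilon'\in\mathfrak X$; * $\varphi|_{\mathfrak X}$ is surjective, and it is injective on the set of sequences in $\mathfrak X$ having finitely many nonzero terms. Let $m=m(T)$ be the least $K$ such that some arithmetic coding $(\varphi,\mathfrak X)$ of $T$ is $K$-to-$1$, i.e. almost every point of $\mathbb T^2$ (Lebesgue measure) has exactly $K$ preimages in $\mathfrak X$. A minimal arithmetic coding is an arithmetic coding which is $m(T)$-to-$1$ in this sense. Let $s$ be the number of integers $n$ with $0\le n<2m$ and $n^2\equiv D\pmod{4m}$ such that the form $[m,n,l]=mx^2+nxy+ly^2$, $l=\frac{n^2-D}{4m}$, is obtained from $f_T$ by an integral change of variables of determinant $+1$ or from $-f_T$ by one of determinant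 $-1$. A system of basis solutions is a collection of integral solutions $(x^{(j)},y^{(j)})$, $1\le j\le s$, of $f_T(x,y)=\pm m$ (meaning $f_T(x,y)=m$ or $f_T(x,y)=-m$) such that every integral solution of $f_T(x,y)=\pm m$ is of the form $\pm(x^{(j)},y^{(j)})M^n$ with $1\le j\le s$, $n\in\mathbb Z$, while $(x^{(i)},y^{(i)})\ne\pm(x^{(j)},y^{(j)})M^n$ for $i\ne j$ and all $n\in\mathbb Z$. Theorem 3.5. Suppose that $M$ is primitive. Then systems of basis solutions exist. For any such system put $$\xi_j=\frac{-y^{(j)}+n^{(j)}\lambda}{\sqrt D},\qquad \eta_j=\frac{x^{(j)}+k^{(j)}\lambda}{\sqrt D},\qquad \begin{pmatrix}n^{(j)}\\k^{(j)}\end{pmatrix}=-\det M\cdot M\begin{pmatrix}-y^{(j)}\\x^{(j)}\end{pmatrix}.$$ Then all the points $\pm\lambda^k(\xi_j,\eta_j)\bmod\mathbb Z^2$ ($k\in\mathbb Z$, $1\le j\le s$) are homoclinic, and for each minimal arithmetic coding $(\varphi,\mathfrak X)$ of $T$ there are $k\in\mathbb Z$, $j\in\{1,\dots,s\}$ and a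 choice of sign such that for all $\varepsilon\in\widetilde{\mathfrak X}$ $$\varphi(\varepsilon)=\varphi^{\pm}_{k,j}(\varepsilon)=\Bigl(\sum_{n=-\infty}^{\infty}\varepsilon_n\lambda^{-n}\Bigr)\begin{pmatrix}\pm\xi_j\lambda^k\\ \pm\eta_j\lambda^k\end{pmatrix}\bmod\mathbb Z^2,$$ where the right-hand side denotes $\lim_{N\to\infty}\bigl(\sum_{n=-N}^{N}\varepsilon_n\lambda^{-n}\bigr)\begin{pmatrix}\pm\xi_j\lambda^k\\ \pm\eta_j\lambda^k\end{pmatrix}\bmod\mathbb Z^2$. -/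

import Mathlib

open Filter Topology MeasureTheory

namespace ArithCoding

noncomputable section

/-! ### Matrices and automorphisms of the torus -/

/-- The trace `r` of the matrix. -/
def tr (M : GL (Fin 2) ℤ) : ℤ := (M : Matrix (Fin 2) (Fin 2) ℤ).trace

/-- The determinant `σ = ±1` of the matrix. -/
def dt (M : GL (Fin 2) ℤ) : ℤ := (M : Matrix (Fin 2) (Fin 2) ℤ).det

/-- The discriminant `D = r ^ 2 - 4 σ` of the characteristic polynomial. -/
def disc (M : GL (Fin 2) ℤ) : ℤ := tr M ^ 2 - 4 * dt M

/-- The eigenvalue `λ = (r + √D) / 2`. -/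
def lam (M : GL (Fin 2) ℤ) : ℝ := ((tr M : ℝ) + √(disc M : ℝ)) / 2

/-- Hyperbolicity: no (complex) eigenvalue lies on the unit circle. -/
def IsHyperbolic (M : GL (Fin 2) ℤ) : Prop :=
  ∀ z ∈ spectrum ℂ ((M : Matrix (Fin 2) (Fin 2) ℤ).map (Int.cast : ℤ → ℂ)), ‖z‖ ≠ 1

/-- `M` is not a power `K ^ n`, `n ≥ 2`, of a matrix `K ∈ GL(2, ℤ)`. -/
def IsPrimitive (M : GL (Fin 2) ℤ) : Prop :=
  ¬ ∃ (K : GL (Fin 2) ℤ) (n : ℕ), 2 ≤ n ∧ M = K ^ n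

/-- The automorphism `T` of the torus `ℝ² / ℤ²` given by `M`. -/
def toralMap (M : GL (Fin 2) ℤ) (x : UnitAddTorus (Fin 2)) : UnitAddTorus (Fin 2) :=
  fun i => ∑ j, (M : Matrix (Fin 2) (Fin 2) ℤ) i j • x j

/-- Reduction modulo `ℤ²`. -/
def toTorus (t : Fin 2 → ℝ) : UnitAddTorus (Fin 2) := fun i => (t i : UnitAddCircle)

/-- `T ^ n x → 0` as `n → ±∞`. -/
def IsHomoclinic (M : GL (Fin 2) ℤ) (x : UnitAddTorus (Fin 2)) : Prop :=
  Tendsto (fun n : ℤ => toralMap (M ^ n) x) atTop (𝓝 0) ∧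
  Tendsto (fun n : ℤ => toralMap (M ^ n) x) atBot (𝓝 0)

/-! ### The symbolic space -/

/-- Two-sided sequences of nonnegative integers for which the series
`∑_{n ≥ 1} ε_n l⁻ⁿ` and `∑_{n ≥ 1} ε_{-n} l⁻ⁿ` converge. -/
@[ext]
structure SymSeq (l : ℝ) where
  digit : ℤ → ℕ
  right_summable : Summable fun n : ℕ => (digit ((n : ℤ) + 1) : ℝ) / l ^ (n + 1)
  left_summable : Summable fun n : ℕ => (digit (-((n : ℤ) + 1)) : ℝ) / l ^ (n + 1)

namespace SymSeq

variable {l : ℝ}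

/-- `∑_{n ≥ 1} ε_n l⁻ⁿ`. -/
def rightSum (e : SymSeq l) : ℝ := ∑' n : ℕ, (e.digit ((n : ℤ) + 1) : ℝ) / l ^ (n + 1)

/-- `∑_{n ≥ 1} ε_{-n} l⁻ⁿ`. -/
def leftSum (e : SymSeq l) : ℝ := ∑' n : ℕ, (e.digit (-((n : ℤ) + 1)) : ℝ) / l ^ (n + 1)

/-- Coordinatewise addition. -/
instance : Add (SymSeq l) where
  add e e' :=
    { digit := fun n => e.digit n + e'.digit n
      right_summable := by
        simpa [add_div] using e.right_summable.add e'.right_summable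
      left_summable := by
        simpa [add_div] using e.left_summable.add e'.left_summable }

/-- The weak (initial) topology: the coarsest one for which all the coordinates and the sums of
the two defining series are continuous. On a set of sequences with uniformly bounded digits it is
the topology of coordinatewise convergence. -/
instance : TopologicalSpace (SymSeq l) :=
  TopologicalSpace.induced (fun e => (e.digit, e.rightSum, e.leftSum))
    (inferInstance : TopologicalSpace ((ℤ → ℕ) × ℝ × ℝ))

/-- The two-sided shift `(τ ε)_n = ε_{n+1}`. -/
def shift (e : SymSeq l) : SymSeq l where
  digit := fun n => e.digit (n + 1)
  right_summable := by
    rcases eq_or_ne l 0 with rfl | hl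
    · simp
    · have h := ((summable_nat_add_iff 1).2 e.right_summable).mul_left l
      refine h.congr fun n => ?_
      push_cast
      rw [pow_succ' l (n + 1)]
      field_simp
  left_summable := by
    rcases eq_or_ne l 0 with rfl | hl
    · simp
    · rw [← summable_nat_add_iff 1]
      have h := e.left_summable.mul_left l⁻¹
      refine h.congr fun n => ?_
      have h1 : -(((n + 1 : ℕ) : ℤ) + 1) + 1 = -((n : ℤ) + 1) := by push_cast; ring
      rw [h1, pow_succ' l (n + 1)]
      field_simp

/-- The sequence has only finitely many nonzero coordinates. -/
def IsFinite (e : SymSeq l) : Prop := {n : ℤ | e.digit n ≠ 0}.Finite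

/-- The one-sided sequence `(ε_N, ε_{N+1}, …)`. -/
def tail (e : SymSeq l) (N : ℤ) : ℕ → ℕ := fun i => e.digit (N + i)

end SymSeq

/-- Strict lexicographic order of one-sided sequences. -/
def LexLT (a b : ℕ → ℕ) : Prop := ∃ n, (∀ i < n, a i = b i) ∧ a n < b n

/-- With a sequence `ε`, the set contains each sequence `ε'` all of whose tails are
lexicographically less than one fixed tail of `ε`. -/
def IsTotal {l : ℝ} (X : Set (SymSeq l)) : Prop :=
  ∀ e ∈ X, ∀ (N : ℤ) (e' : SymSeq l), (∀ k : ℤ, LexLT (e'.tail k) (e.tail N)) → e' ∈ X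

/-! ### Arithmetic codings -/

/-- `(φ, X)` is an arithmetic coding of the automorphism given by `M`. -/
structure IsArithmeticCoding (M : GL (Fin 2) ℤ)
    (φ : SymSeq (lam M) →ₙ+ UnitAddTorus (Fin 2)) (X : Set (SymSeq (lam M))) : Prop where
  continuous : Continuous φ
  equivariant : ∀ e, φ e.shift = toralMap M (φ e)
  closed : IsClosed X
  shift_invariant : ∀ e, e.shift ∈ X ↔ e ∈ X
  total : IsTotal X
  surjective : ∀ x, ∃ e ∈ X, φ e = x
  injective_finite : Set.InjOn φ {e | e ∈ X ∧ e.IsFinite}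

/-- The restriction of `φ` to `X` is `K`-to-1 almost everywhere with respect to the Lebesgue
(Haar) measure of the torus. -/
def IsToOneAE {l : ℝ} (φ : SymSeq l →ₙ+ UnitAddTorus (Fin 2)) (X : Set (SymSeq l)) (K : ℕ) :
    Prop :=
  ∀ᵐ x ∂(volume : Measure (UnitAddTorus (Fin 2))), {e | e ∈ X ∧ φ e = x}.encard = K

/-- `m(T)`: the minimal number of preimages of an arithmetic coding. -/
def minPreimages (M : GL (Fin 2) ℤ) : ℕ :=
  sInf {K : ℕ | ∃ φ X, IsArithmeticCoding M φ X ∧ IsToOneAE φ X K}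

/-- Minimal arithmetic coding: an arithmetic coding with the minimal number of preimages. -/
def IsMinimalCoding (M : GL (Fin 2) ℤ)
    (φ : SymSeq (lam M) →ₙ+ UnitAddTorus (Fin 2)) (X : Set (SymSeq (lam M))) : Prop :=
  IsArithmeticCoding M φ X ∧ IsToOneAE φ X (minPreimages M)

/-- `(∑_{n ∈ ℤ} ε_n λ⁻ⁿ) t mod ℤ² = x`, understood as the limit of symmetric partial sums taken
modulo `ℤ²`. -/
def HasCodingSum (l : ℝ) (t : Fin 2 → ℝ) (ε : ℤ → ℕ) (x : UnitAddTorus (Fin 2)) : Prop :=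
  Tendsto (fun N : ℕ => toTorus ((∑ n ∈ Finset.Icc (-(N : ℤ)) N, (ε n : ℝ) * l ^ (-n)) • t))
    atTop (𝓝 x)

/-! ### Quadratic forms and basis solutions -/

/-- The form `f_T(x, y) = b x² - (a - d) x y - c y²` associated with `M = (a b; c d)`. -/
def assocForm (M : GL (Fin 2) ℤ) (x y : ℤ) : ℤ :=
  M.1 0 1 * x ^ 2 - (M.1 0 0 - M.1 1 1) * x * y - M.1 1 0 * y ^ 2

/-- The form `[α, β, γ] = α x² + β x y + γ y²`. -/
def bqf (α β γ : ℤ) (x y : ℤ) : ℤ := α * x ^ 2 + β * x * y + γ * y ^ 2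

/-- `g` is obtained from `f` by an integral change of variables of determinant `δ`. -/
def EquivWithDet (δ : ℤ) (f g : ℤ → ℤ → ℤ) : Prop :=
  ∃ B : GL (Fin 2) ℤ, dt B = δ ∧
    ∀ x y, g x y = f (B.1 0 0 * x + B.1 0 1 * y) (B.1 1 0 * x + B.1 1 1 * y)

/-- The number of the forms `[m, n, l]` of discriminant `D`, where `m = m(T)` and `n` is a
minimum root, `0 ≤ n < 2 m`, of the congruence `n ^ 2 ≡ D mod 4 m`, that are equivalent to the
form `f_T` in the following sense: `[m, n, l]` is properly equivalent to `f_T`, or it is obtained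
from `-f_T` by a change of variables of determinant `-1`. -/
def numSeries (M : GL (Fin 2) ℤ) : ℕ :=
  {n : ℤ | 0 ≤ n ∧ n < 2 * (minPreimages M : ℤ) ∧ ∃ l : ℤ,
    n ^ 2 - disc M = 4 * (minPreimages M : ℤ) * l ∧
    (EquivWithDet 1 (assocForm M) (bqf (minPreimages M) n l) ∨
      EquivWithDet (-1) (fun x y => - assocForm M x y) (bqf (minPreimages M) n l))}.ncard

/-- The row vector `p` solves `f_T(x, y) = ± m(T)`. -/
def IsSolution (M : GL (Fin 2) ℤ) (p : Fin 2 → ℤ) : Prop :=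
  assocForm M (p 0) (p 1) = minPreimages M ∨ assocForm M (p 0) (p 1) = -(minPreimages M : ℤ)

/-- `p = ± q · M ^ n` for some integer `n`. -/
def SameSeries (M : GL (Fin 2) ℤ) (p q : Fin 2 → ℤ) : Prop :=
  ∃ n : ℤ, p = Matrix.vecMul q (M ^ n : GL (Fin 2) ℤ).1 ∨
    p = - Matrix.vecMul q (M ^ n : GL (Fin 2) ℤ).1

/-- A system of basis solutions of `f_T(x, y) = ± m(T)`: one solution in each series. -/
structure IsBasisSystem (M : GL (Fin 2) ℤ) {s : ℕ} (b : Fin s → Fin 2 → ℤ) : Prop where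
  solution : ∀ j, IsSolution M (b j)
  complete : ∀ p, IsSolution M p → ∃ j, SameSeries M p (b j)
  distinct : ∀ i j, i ≠ j → ¬ SameSeries M (b i) (b j)

/-- The point `(ξ, η) = ((-y + n λ) / √D, (x + k λ) / √D)` of `ℝ²`, where
`(n, k)ᵀ = - det M · M (-y, x)ᵀ`, attached to the solution `(x, y)`. -/
def solutionPoint (M : GL (Fin 2) ℤ) (p : Fin 2 → ℤ) : Fin 2 → ℝ :=
  let w : Fin 2 → ℤ := (- dt M) • Matrix.mulVec M.1 ![-(p 1), p 0]
  ![(-(p 1 : ℝ) + w 0 * lam M) / √(disc M : ℝ), ((p 0 : ℝ) + w 1 * lam M) / √(disc M : ℝ)]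

end

end ArithCoding

namespace ArithCoding

/-! ### Admissible sequences and their real values -/

/-! Write u(z) and s(z) for the expanding and contracting parts of an integer vector z (`uPart`,
`sPart`), and λ' for the conjugate of λ. A coding map φ is determined by its value at the sequence
with a single 1 at position 0. The shifts of this sequence tend to zero in both directions, so that
value is homoclinic, and the homoclinic points are exactly the u(z) mod ℤ²
(`IsHomoclinic.exists_intVec`). Hence φ(ε) = (∑ ε_n λ⁻ⁿ) u(z) (`IsArithmeticCoding.exists_vector`).
Since M^k z is integral, λ^k u(z) ≡ -λ'^k s(z) mod ℤ², and the formally divergent sum lifts to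
`planePoint`, with coordinates `future` and `past`.

The degree of a coding is then read off from z. The admissible sequences are those whose tails are
bounded by the critical expansion d of 1 in base λ. Their pairs (future, past) fill an L-shaped tile
which, up to boundary, is a fundamental domain of the lattice ℤz + ℤMz, so on them the map is
|det(z, Mz)|-to-one almost everywhere (`encard_preimages`). No other X changes this number. The
quadratic relation for λ yields distinct finite sequences of equal value, so members of X are
admissible or end in zeros (`IsArithmeticCoding.admissible_or_zero`); conversely, Baire category and
totality put every admissible sequence into X (`IsArithmeticCoding.admissibleSet_subset`). As det(z,
Mz) is a value of f_T up to sign, m(T) is the minimum of |f_T| on nonzero integer vectors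
(`codingDegrees_eq`), and minimal codings correspond to solutions of f_T = ±m.

It remains to sort the solutions. Completing a solution to a basis attaches to it a middle
coefficient n modulo 2m, and equal coefficients mean that the solutions differ by a matrix commuting
with M (`HasRoot.exists_commute`, `HasRoot.vecMul`, `HasRoot.dvd_sub`). For primitive M these
matrices are ±M^k, because the logarithms of their eigenvalues form a discrete group
(`commutant_of_isPrimitive`). So the series correspond to the s roots. Along a series u(perp p)
changes only by a sign and a power of λ (`SameSeries.uPart_perp`), and (ξ, η) is u(perp p) up to
such a factor (`solutionPoint_eq`). -/

/-- Every tail of `e` is lexicographically at most `d`. -/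
def Admissible (d : ℕ → ℕ) (e : ℤ → ℕ) : Prop :=
  ∀ (N : ℤ) (n : ℕ), (∀ i < n, e (N + i) = d i) → e (N + n) ≤ d n

/-- The two families of quadratic units `l` with conjugate `l'`, trace `r`, together with the cut
`c` and the bottom `b` of the tile, and the critical sequence `d`. -/
inductive UnitCase (l l' : ℝ) (r : ℕ) : ℝ → ℝ → (ℕ → ℕ) → Prop
  | neg : 1 < l → l ^ 2 = r * l + 1 → 1 ≤ r → l' = r - l →
      UnitCase l l' r (l - r) (-1) (fun i => if Even i then r else 0)
  | pos : 1 < l → l ^ 2 + 1 = r * l → 3 ≤ r → l' = r - l →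
      UnitCase l l' r (l - r + 1) 0 (fun i => if i = 0 then r - 1 else r - 2)

/-- The value `∑_{k ≥ 1} e_{n+k} l⁻ᵏ`. -/
noncomputable def future (l : ℝ) (e : ℤ → ℕ) (n : ℤ) : ℝ :=
  ∑' k : ℕ, (e (n + 1 + k) : ℝ) / l ^ (k + 1)

/-- The value `∑_{k ≥ 0} e_{n-k} l'ᵏ`. -/
noncomputable def past (l' : ℝ) (e : ℤ → ℕ) (n : ℤ) : ℝ :=
  ∑' k : ℕ, (e (n - k) : ℝ) * l' ^ k

/-- The closed tile containing the points `(future, past)` of admissible sequences. -/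
def InTile (l c b x y : ℝ) : Prop := 0 ≤ x ∧ x ≤ 1 ∧ b ≤ y ∧ y ≤ l ∧ (c < x → y ≤ l - 1)

/-- The tile without its right boundary. -/
def InHalfTile (l c b x y : ℝ) : Prop := 0 ≤ x ∧ x < 1 ∧ b ≤ y ∧ y ≤ l ∧ (c ≤ x → y ≤ l - 1)

/-! ### One step of the dynamics on the tile -/

namespace UnitCase

variable {l l' : ℝ} {r : ℕ} {c b : ℝ} {d : ℕ → ℕ}

lemma one_lt (h : UnitCase l l' r c b d) : 1 < l := by cases h <;> assumption

lemma conj_eq (h : UnitCase l l' r c b d) : l' = r - l := by cases h <;> assumption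

lemma norm_cases (h : UnitCase l l' r c b d) : l * l' = 1 ∨ l * l' = -1 := by
  cases h with
  | neg h1 h2 h3 h4 => right; rw [h4]; linarith
  | pos h1 h2 h3 h4 => left; rw [h4]; linarith

lemma abs_conj (h : UnitCase l l' r c b d) : |l'| = l⁻¹ := by
  have hl := h.one_lt
  have : |l * l'| = 1 := by rcases h.norm_cases with h | h <;> rw [h] <;> simp
  rw [abs_mul, abs_of_pos (by linarith)] at this
  exact eq_inv_of_mul_eq_one_right this

lemma abs_conj_lt_one (h : UnitCase l l' r c b d) : |l'| < 1 := by
  rw [h.abs_conj]; exact inv_lt_one_of_one_lt₀ h.one_lt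

lemma cut_mem (h : UnitCase l l' r c b d) : 0 < c ∧ c < 1 := by
  cases h with
  | neg h1 h2 h3 h4 => constructor <;> nlinarith
  | pos h1 h2 h3 h4 => constructor <;> nlinarith

/-- The cut is the value of the critical sequence without its first digit. A point to the right of
it cannot have `d 0` as its last digit, which explains the lower ceiling there. -/
lemma crit_zero (h : UnitCase l l' r c b d) : c = l - d 0 := by
  cases h with
  | neg h1 h2 h3 h4 => simp
  | pos h1 h2 h3 h4 =>
    simp only [if_true]; rw [Nat.cast_sub (by omega)]; push_cast; ring

lemma crit_zero_pos (h : UnitCase l l' r c b d) : 0 < d 0 := by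
  cases h with
  | neg h1 h2 h3 h4 => simpa
  | pos h1 h2 h3 h4 => simp; omega

/-- Two consecutive zeros break every match with the critical sequence; the gap in `splice` has
length two for this reason. -/
lemma crit_two (h : UnitCase l l' r c b d) (i : ℕ) : d i ≠ 0 ∨ d (i + 1) ≠ 0 := by
  cases h with
  | neg h1 h2 h3 h4 =>
    rcases Nat.even_or_odd i with hi | hi
    · left; simp [hi]; omega
    · right; simp [hi.add_one]; omega
  | pos h1 h2 h3 h4 => right; simp; omega

/-- The critical sequence is itself admissible. -/
lemma crit_admissible (h : UnitCase l l' r c b d) (N n : ℕ) (hN : ∀ i < n, d (N + i) = d i) :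
    d (N + n) ≤ d n := by
  cases h with
  | neg h1 h2 h3 h4 =>
    rcases Nat.eq_zero_or_pos n with rfl | hn
    · by_cases hi : Even N <;> simp [hi]
    · have h0 := hN 0 hn
      have : Even N := by
        by_contra hi
        simp [hi] at h0; omega
      simp [Nat.even_add, this]
  | pos h1 h2 h3 h4 =>
    by_cases hN0 : N = 0
    · simp [hN0]
    · have : N + n ≠ 0 := by omega
      by_cases hn : n = 0 <;> simp [hn, hN0]; omega

/-- The values of the tails of the critical sequence. -/
lemma exists_tail_values (h : UnitCase l l' r c b d) :
    ∃ T : ℕ → ℝ, T 0 = 1 ∧ ∀ k, (0 < T k ∧ T k ≤ 1) ∧ l * T k = d k + T (k + 1) := by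
  have hcm := h.cut_mem
  cases h with
  | neg h1 h2 h3 h4 =>
    refine ⟨fun k => if Even k then 1 else l - r, by simp, fun k => ?_⟩
    by_cases hk : Even k
    · simp [hk, Nat.even_add_one]
    · simp only [hk, Nat.even_add_one, if_false, not_false_eq_true, if_true]
      exact ⟨⟨hcm.1, hcm.2.le⟩, by push_cast; nlinarith⟩
  | pos h1 h2 h3 h4 =>
    refine ⟨fun k => if k = 0 then 1 else l - r + 1, by simp, fun k => ?_⟩
    by_cases hk : k = 0
    · simp [hk]; rw [Nat.cast_sub (by omega)]; push_cast; ring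
    · simp only [hk, if_false, Nat.succ_ne_zero]
      refine ⟨⟨hcm.1, hcm.2.le⟩, ?_⟩
      rw [Nat.cast_sub (by omega)]; push_cast; nlinarith

/-- Moving one digit across the point maps the closed tile into itself. -/
lemma inTile_step (h : UnitCase l l' r c b d) {x y : ℝ} {m : ℕ} (hxy : InTile l c b x y)
    (h0 : 0 ≤ l * x - m) (h1 : l * x - m ≤ 1) : InTile l c b (l * x - m) (m + l' * y) := by
  obtain ⟨x0, x1, y0, y1, hc⟩ := hxy
  cases h with
  | neg g1 g2 g3 g4 =>
    have hr : (1 : ℝ) ≤ r := by exact_mod_cast g3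
    have hll : l * l' = -1 := by rw [g4]; linarith
    have hl' : l' < 0 := by nlinarith
    have hmr : m ≤ r := by
      have : (m : ℝ) < r + 1 := by nlinarith
      exact Nat.lt_succ_iff.1 (by exact_mod_cast this)
    have hmr' : (m : ℝ) ≤ r := by exact_mod_cast hmr
    have k1 : l' * y ≤ -l' := by nlinarith
    have k2 : -1 ≤ l' * y := by nlinarith
    refine ⟨h0, h1, by have : (0 : ℝ) ≤ m := m.cast_nonneg
                       linarith, by linarith, fun hx => ?_⟩
    have : (m : ℝ) < r := by nlinarith
    have : m + 1 ≤ r := by exact_mod_cast this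
    have : (m : ℝ) + 1 ≤ r := by exact_mod_cast this
    linarith
  | pos g1 g2 g3 g4 =>
    have hr : (3 : ℝ) ≤ r := by exact_mod_cast g3
    have hll : l * l' = 1 := by rw [g4]; linarith
    have hl' : 0 < l' := by nlinarith
    have hlr : l < r := by linarith
    have hlr' : (r : ℝ) - 1 < l := by nlinarith
    have k1 : l' * y ≤ 1 := by nlinarith
    have k2 : 0 ≤ l' * y := by positivity
    have k3 : y ≤ l - 1 → l' * y ≤ 1 - l' := fun hy => by nlinarith
    have m0 : (0 : ℝ) ≤ m := m.cast_nonneg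
    have hmr : m < r := by
      have : (m : ℝ) < r := by nlinarith
      exact_mod_cast this
    -- The top digit `r - 1` occurs only to the right of the cut, where `y ≤ l - 1` sharpens the
    -- bound on `l' * y` from `1` to `1 - l'`. Digit `r - 2` is treated alike below when the image
    -- lies right of the cut.
    have hcx : (m : ℝ) = r - 1 → l - r + 1 < x := fun hm => by nlinarith
    refine ⟨h0, h1, by linarith, ?_, fun hx => ?_⟩
    · rcases Nat.lt_or_ge (m + 1) r with hm | hm
      · have : (m : ℝ) + 1 + 1 ≤ r := by exact_mod_cast hm
        linarith
      · have hm' : (m : ℝ) = r - 1 := by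
          have : m + 1 = r := by omega
          rw [← this]; push_cast; ring
        have := k3 (hc (hcx hm'))
        linarith
    · have hm1 : (m : ℝ) < r - 1 := by nlinarith
      have hm2 : m + 1 < r := by
        have : (m : ℝ) + 1 < r := by linarith
        exact_mod_cast this
      rcases Nat.lt_or_ge (m + 2) r with hm | hm
      · have : (m : ℝ) + 2 + 1 ≤ r := by exact_mod_cast hm
        linarith
      · have hm' : (m : ℝ) = r - 2 := by
          have : m + 2 = r := by omega
          rw [← this]; push_cast; ring
        have : l - r + 1 < x := by
          by_contra hcon
          push Not at hcon
          nlinarith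
        have := k3 (hc this)
        linarith

/-- Same case analysis as `inTile_step`. Excluding the right boundary forces the digit to be the
floor, so the step becomes a map. -/
lemma halfTile_step (h : UnitCase l l' r c b d) {x y : ℝ} (hxy : InHalfTile l c b x y) :
    InHalfTile l c b (l * x - ⌊l * x⌋₊) (⌊l * x⌋₊ + l' * y) := by
  have hl := h.one_lt
  obtain ⟨x0, x1, y0, y1, hc⟩ := hxy
  have h0 := Nat.floor_le (show 0 ≤ l * x by positivity)
  have h1 := Nat.lt_floor_add_one (l * x)
  generalize ⌊l * x⌋₊ = m at *
  cases h with
  | neg g1 g2 g3 g4 =>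
    have hr : (1 : ℝ) ≤ r := by exact_mod_cast g3
    have hll : l * l' = -1 := by rw [g4]; linarith
    have hl' : l' < 0 := by nlinarith
    have hmr : m ≤ r := by
      have : (m : ℝ) < r + 1 := by nlinarith
      exact Nat.lt_succ_iff.1 (by exact_mod_cast this)
    have hmr' : (m : ℝ) ≤ r := by exact_mod_cast hmr
    have k1 : l' * y ≤ -l' := by nlinarith
    have k2 : -1 ≤ l' * y := by nlinarith
    refine ⟨by linarith, by linarith, by have : (0 : ℝ) ≤ m := m.cast_nonneg
                                         linarith, by linarith, fun hx => ?_⟩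
    have : (m : ℝ) < r := by nlinarith
    have : m + 1 ≤ r := by exact_mod_cast this
    have : (m : ℝ) + 1 ≤ r := by exact_mod_cast this
    linarith
  | pos g1 g2 g3 g4 =>
    have hr : (3 : ℝ) ≤ r := by exact_mod_cast g3
    have hll : l * l' = 1 := by rw [g4]; linarith
    have hl' : 0 < l' := by nlinarith
    have hlr : l < r := by linarith
    have hlr' : (r : ℝ) - 1 < l := by nlinarith
    have k1 : l' * y ≤ 1 := by nlinarith
    have k2 : 0 ≤ l' * y := by positivity
    have k3 : y ≤ l - 1 → l' * y ≤ 1 - l' := fun hy => by nlinarith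
    have m0 : (0 : ℝ) ≤ m := m.cast_nonneg
    have hmr : m < r := by
      have : (m : ℝ) < r := by nlinarith
      exact_mod_cast this
    have hcx : (m : ℝ) = r - 1 → l - r + 1 ≤ x := fun hm => by nlinarith
    refine ⟨by linarith, by linarith, by linarith, ?_, fun hx => ?_⟩
    · rcases Nat.lt_or_ge (m + 1) r with hm | hm
      · have : (m : ℝ) + 1 + 1 ≤ r := by exact_mod_cast hm
        linarith
      · have hm' : (m : ℝ) = r - 1 := by
          have : m + 1 = r := by omega
          rw [← this]; push_cast; ring
        have := k3 (hc (hcx hm'))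
        linarith
    · have hm1 : (m : ℝ) < r - 1 := by nlinarith
      have hm2 : m + 1 < r := by
        have : (m : ℝ) + 1 < r := by linarith
        exact_mod_cast this
      rcases Nat.lt_or_ge (m + 2) r with hm | hm
      · have : (m : ℝ) + 2 + 1 ≤ r := by exact_mod_cast hm
        linarith
      · have hm' : (m : ℝ) = r - 2 := by
          have : m + 2 = r := by omega
          rw [← this]; push_cast; ring
        have : l - r + 1 ≤ x := by
          by_contra hcon
          push Not at hcon
          nlinarith
        have := k3 (hc this)
        linarith

/-- Every point of the tile has a predecessor. -/
lemma exists_halfTile_pred (h : UnitCase l l' r c b d) {x y : ℝ} (hxy : InHalfTile l c b x y) :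
    ∃ (m : ℕ) (x₁ y₁ : ℝ), InHalfTile l c b x₁ y₁ ∧ x = l * x₁ - m ∧ y = m + l' * y₁ := by
  have hl := h.one_lt
  have hl0 : l ≠ 0 := by positivity
  obtain ⟨x0, x1, y0, y1, hc⟩ := hxy
  suffices ∃ m : ℕ, InHalfTile l c b ((m + x) / l) ((y - m) / l') by
    obtain ⟨m, hm⟩ := this
    have hl' : l' ≠ 0 := by
      rintro rfl
      rcases h.norm_cases with h | h <;> simp at h
    exact ⟨m, _, _, hm, by field_simp; ring, by field_simp; ring⟩
  cases h with
  | neg g1 g2 g3 g4 =>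
    have hr : (1 : ℝ) ≤ r := by exact_mod_cast g3
    have hll : l * l' = -1 := by rw [g4]; linarith
    have e1 : ∀ m : ℕ, ((m : ℝ) + x) / l = (m + x) * (l - r) := fun m => by
      rw [div_eq_iff hl0]; linear_combination (-(m : ℝ) - x) * g2
    have hl' : l' ≠ 0 := by rintro rfl; simp at hll
    have e2 : ∀ m : ℕ, (y - m) / l' = l * (m - y) := fun m => by
      rw [div_eq_iff hl']; linear_combination ((y - m) * hll)
    simp only [e1, e2]
    -- Since `l * (l - r) = 1`, digit `0` keeps the old ordinate `-l * y` above `-1` exactly in the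
    -- first case. In the other case the ceiling is the digit that puts `l * (m - y)` between `-1`
    -- and `l - 1`.
    rcases le_or_gt y (l - r) with hy | hy
    · refine ⟨0, ?_, ?_, ?_, ?_, fun h => ?_⟩ <;> push_cast at * <;> nlinarith
    · have hm0 : 0 < ⌈y - (l - r)⌉₊ := Nat.ceil_pos.2 (by linarith)
      have a1 := Nat.le_ceil (y - (l - r))
      have a2 := Nat.ceil_lt_add_one (show 0 ≤ y - (l - r) by linarith)
      generalize ⌈y - (l - r)⌉₊ = m at *
      have m1 : (1 : ℝ) ≤ m := by exact_mod_cast hm0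
      have hmr : m ≤ r := by
        have : (m : ℝ) < r + 1 := by linarith
        exact Nat.lt_succ_iff.1 (by exact_mod_cast this)
      have hk : m + x < l := by
        rcases hmr.lt_or_eq with hm | rfl
        · have : (m : ℝ) + 1 ≤ r := by exact_mod_cast hm
          nlinarith
        · by_contra hcon
          have := hc (by linarith)
          linarith
      have hcp : 0 < l - r := by nlinarith
      have b1 : -(l - r) ≤ m - y := by linarith
      have b2 : m - y ≤ 1 - (l - r) := by linarith
      have b3 : l * (m - y) ≤ l - 1 := by nlinarith
      refine ⟨m, ?_, ?_, ?_, ?_, fun h => ?_⟩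
      · positivity
      · nlinarith
      · nlinarith
      · linarith
      · linarith
  | pos g1 g2 g3 g4 =>
    have hr : (3 : ℝ) ≤ r := by exact_mod_cast g3
    have hll : l * l' = 1 := by rw [g4]; linarith
    have e1 : ∀ m : ℕ, ((m : ℝ) + x) / l = (m + x) * (r - l) := fun m => by
      rw [div_eq_iff hl0]; linear_combination ((m : ℝ) + x) * g2
    have hl' : l' ≠ 0 := by rintro rfl; simp at hll
    have e2 : ∀ m : ℕ, (y - m) / l' = l * (y - m) := fun m => by
      rw [div_eq_iff hl']; linear_combination (-(y - m) * hll)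
    have hlp : 0 < r - l := by nlinarith
    have hlr' : (r : ℝ) - 1 < l := by nlinarith
    simp only [e1, e2]
    -- The digit is the integer part of the ordinate, so that `l * (y - m)` lies between `0` and
    -- `l`.
    have a1 := Nat.floor_le y0
    have a2 := Nat.lt_floor_add_one y
    generalize ⌊y⌋₊ = m at *
    have m0 : (0 : ℝ) ≤ m := m.cast_nonneg
    have hmr : m < r := by
      have : (m : ℝ) < r := by linarith
      exact_mod_cast this
    have c1 : 0 ≤ (m + x) * (r - l) := by positivity
    have c3 : 0 ≤ l * (y - m) := mul_nonneg (by linarith) (by linarith)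
    have c4 : l * (y - m) ≤ l := by nlinarith
    rcases Nat.lt_or_ge (m + 1) r with hm | hm
    · have hm' : (m : ℝ) + 1 + 1 ≤ r := by exact_mod_cast hm
      refine ⟨m, c1, ?_, c3, c4, fun h => ?_⟩
      · nlinarith
      · have hmx : l - 1 ≤ m + x := by
          by_contra hcon
          push Not at hcon
          nlinarith
        rcases Nat.lt_or_ge (m + 2) r with hm | hm
        · have : (m : ℝ) + 2 + 1 ≤ r := by exact_mod_cast hm
          linarith
        · have hm' : (m : ℝ) = r - 2 := by
            have : m + 2 = r := by omega
            rw [← this]; push_cast; ring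
          have := hc (by linarith)
          nlinarith
    · have hm' : (m : ℝ) = r - 1 := by
        have : m + 1 = r := by omega
        rw [← this]; push_cast; ring
      have hx : x < l - r + 1 := by
        by_contra hcon
        push Not at hcon
        have := hc hcon
        linarith
      refine ⟨m, c1, ?_, c3, c4, fun h => ?_⟩
      · nlinarith
      · nlinarith

/-- Two different predecessors of a point of the tile occur on a line with ordinate in `ℤ[l]`
only. -/
lemma pred_digit_unique (h : UnitCase l l' r c b d) {m m' : ℕ} {x₁ y₁ x₁' y₁' : ℝ}
    (t : InTile l c b x₁ y₁) (t' : InTile l c b x₁' y₁')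
    (hx : l * x₁ - m = l * x₁' - m') (hx0 : 0 < l * x₁ - m)
    (hy : m + l' * y₁ = m' + l' * y₁') (hgen : ∀ p q : ℤ, (m : ℝ) + l' * y₁ ≠ p + q * l) :
    m = m' := by
  by_contra hne
  wlog hlt : m < m' generalizing m m' x₁ y₁ x₁' y₁'
  · exact this t' t hx.symm (by linarith) hy.symm (by simpa [← hy] using hgen) (Ne.symm hne)
      (by omega)
  have hlt' : (m : ℝ) + 1 ≤ m' := by exact_mod_cast hlt
  have m0 : (0 : ℝ) ≤ m := m.cast_nonneg
  have hl := h.one_lt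
  obtain ⟨x0, x1, y0, y1, hc⟩ := t
  obtain ⟨x0', x1', y0', y1', hc'⟩ := t'
  cases h with
  | neg g1 g2 g3 g4 =>
    have hll : l * l' = -1 := by rw [g4]; linarith
    have hl' : l' < 0 := by nlinarith
    have hx1 : l - r < x₁' := by
      by_contra hcon
      push Not at hcon
      nlinarith
    have := hc' hx1
    have e1 : l' * y₁ ≤ -l' := by nlinarith
    have e2 : l' * (l - 1) ≤ l' * y₁' := by nlinarith
    -- The bounds `e1`, `e2` leave only the ordinate `m - l' = (m - r) + l`, the edge shared by the
    -- images of neighbouring digits. For norm `1` this edge is `m + 1`.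
    apply hgen (m - r) 1
    push_cast
    nlinarith
  | pos g1 g2 g3 g4 =>
    have hll : l * l' = 1 := by rw [g4]; linarith
    have hl' : 0 < l' := by nlinarith
    have e1 : l' * y₁ ≤ 1 := by nlinarith
    have e2 : 0 ≤ l' * y₁' := by positivity
    apply hgen (m + 1) 0
    push_cast
    nlinarith

end UnitCase
lemma Admissible.le {d : ℕ → ℕ} {e : ℤ → ℕ} (he : Admissible d e) (n : ℤ) : e n ≤ d 0 := by
  simpa using he n 0 (by simp)

lemma Admissible.translate {d : ℕ → ℕ} {e : ℤ → ℕ} (he : Admissible d e) (a : ℤ) :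
    Admissible d (fun n => e (n + a)) := by
  intro N n hN
  have := he (N + a) n (fun i hi => by rw [← hN i hi]; congr 1; ring)
  convert this using 2
  ring

/-! ### Convergence and recursion of `future` and `past` -/

section Series

variable {l l' : ℝ} {e : ℤ → ℕ} {C : ℕ}

lemma summable_future (hl : 1 < l) (he : ∀ n, e n ≤ C) (n : ℤ) :
    Summable fun k : ℕ => (e (n + 1 + k) : ℝ) / l ^ (k + 1) := by
  have hg : Summable fun k : ℕ => (C : ℝ) * (l⁻¹) ^ (k + 1) :=
    ((summable_nat_add_iff 1).2 (summable_geometric_of_lt_one (by positivity)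
      (inv_lt_one_of_one_lt₀ hl))).mul_left _
  refine Summable.of_nonneg_of_le (fun k => by positivity) (fun k => ?_) hg
  rw [inv_pow, div_eq_mul_inv]
  gcongr
  exact he _

lemma summable_past (hl : |l'| < 1) (he : ∀ n, e n ≤ C) (n : ℤ) :
    Summable fun k : ℕ => (e (n - k) : ℝ) * l' ^ k := by
  have hg : Summable fun k : ℕ => (C : ℝ) * |l'| ^ k :=
    (summable_geometric_of_lt_one (abs_nonneg _) hl).mul_left _
  refine Summable.of_norm_bounded hg (fun k => ?_)
  rw [norm_mul, norm_pow, Real.norm_eq_abs, Real.norm_eq_abs, Nat.abs_cast]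
  gcongr
  exact he _

lemma future_nonneg (hl : 1 < l) (e : ℤ → ℕ) (n : ℤ) : 0 ≤ future l e n :=
  tsum_nonneg fun k => by positivity

lemma future_succ (hl : 1 < l) {n : ℤ}
    (hs : Summable fun k : ℕ => (e (n + 1 + k) : ℝ) / l ^ (k + 1)) :
    future l e (n + 1) = l * future l e n - e (n + 1) := by
  have hl0 : l ≠ 0 := by positivity
  unfold future
  rw [hs.tsum_eq_zero_add, mul_add, ← tsum_mul_left]
  have : ∀ k : ℕ, l * ((e (n + 1 + (k + 1 : ℕ)) : ℝ) / l ^ (k + 1 + 1))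
      = (e (n + 1 + 1 + k) : ℝ) / l ^ (k + 1) := fun k => by
    rw [pow_succ' l (k + 1)]
    have : n + 1 + ((k + 1 : ℕ) : ℤ) = n + 1 + 1 + k := by push_cast; ring
    rw [this]
    field_simp
  rw [tsum_congr this]
  simp
  field_simp
  ring

lemma past_succ {n : ℤ} (hs : Summable fun k : ℕ => (e (n - k) : ℝ) * l' ^ k) :
    past l' e (n + 1) = e (n + 1) + l' * past l' e n := by
  unfold past
  have key : ∀ k : ℕ, (e (n + 1 - (k + 1 : ℕ)) : ℝ) * l' ^ (k + 1)
      = l' * ((e (n - k) : ℝ) * l' ^ k) := fun k => by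
    have : n + 1 - ((k + 1 : ℕ) : ℤ) = n - k := by push_cast; ring
    rw [this, pow_succ]; ring
  have hs' : Summable fun k : ℕ => (e (n + 1 - k) : ℝ) * l' ^ k := by
    rw [← summable_nat_add_iff 1]
    exact (hs.mul_left l').congr fun k => (key k).symm
  rw [hs'.tsum_eq_zero_add, tsum_congr key, tsum_mul_left]
  simp

end Series

/-! ### Admissible sequences as points of the tile -/

namespace UnitCase

variable {l l' : ℝ} {r : ℕ} {c b : ℝ} {d : ℕ → ℕ} {e : ℤ → ℕ}

/-- Parry's argument. While the digits follow `d`, the bound passes from `T k` to `T (k + 1)`; the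
first smaller digit gains `1`, enough to restart from the bound `T 0 = 1`. Positivity of the tail
values keeps the inequality strict. -/
lemma partial_sum_lt_one (h : UnitCase l l' r c b d) (he : Admissible d e) (n : ℤ) (N : ℕ) :
    ∑ k ∈ Finset.range N, (e (n + 1 + k) : ℝ) / l ^ (k + 1) < 1 := by
  obtain ⟨T, hT0, hT⟩ := h.exists_tail_values
  have hl := h.one_lt
  have hl0 : 0 < l := by linarith
  -- Here `k` counts the digits immediately before the sum that already agree with the beginning of
  -- `d`.
  suffices H : ∀ (N : ℕ) (n : ℤ) (k : ℕ), (∀ i < k, e (n + 1 - k + i) = d i) →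
      ∑ k ∈ Finset.range N, (e (n + 1 + k) : ℝ) / l ^ (k + 1) < T k by
    rw [← hT0]; exact H N n 0 (by simp)
  clear n N
  intro N
  induction N with
  | zero => intro n k _; simpa using (hT k).1.1
  | succ N ih =>
    intro n k hk
    have hrec : l * ∑ k ∈ Finset.range (N + 1), (e (n + 1 + k) : ℝ) / l ^ (k + 1)
        = e (n + 1) + ∑ k ∈ Finset.range N, (e (n + 1 + 1 + k) : ℝ) / l ^ (k + 1) := by
      rw [Finset.sum_range_succ', mul_add, Finset.mul_sum, add_comm]
      congr 1
      · simp; field_simp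
      · refine Finset.sum_congr rfl fun k _ => ?_
        have : n + 1 + ((k + 1 : ℕ) : ℤ) = n + 1 + 1 + k := by push_cast; ring
        rw [this, pow_succ' l (k + 1)]
        field_simp
    have hle : e (n + 1) ≤ d k := by
      have := he (n + 1 - k) k hk
      simpa using this
    rw [← mul_lt_mul_iff_right₀ hl0, hrec, (hT k).2]
    rcases hle.lt_or_eq with hlt | heq
    · have h1 := ih (n + 1) 0 (by simp)
      rw [hT0] at h1
      have h2 := (hT (k + 1)).1.1
      have : (e (n + 1) : ℝ) + 1 ≤ d k := by exact_mod_cast hlt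
      linarith
    · have h1 := ih (n + 1) (k + 1) (fun i hi => by
        rcases Nat.lt_succ_iff_lt_or_eq.1 hi with hi | rfl
        · rw [← hk i hi]; congr 1; push_cast; ring
        · rw [← heq]; congr 1; push_cast; ring)
      rw [heq]
      linarith

lemma future_mem (h : UnitCase l l' r c b d) (he : Admissible d e) (n : ℤ) :
    0 ≤ future l e n ∧ future l e n ≤ 1 :=
  ⟨future_nonneg h.one_lt e n,
    (summable_future h.one_lt he.le n).tsum_le_of_sum_range_le
      fun N => (h.partial_sum_lt_one he n N).le⟩

/-- A terminating expansion is one of its own partial sums, so the strict inequality is not lost in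
the limit. -/
lemma future_lt_one (h : UnitCase l l' r c b d) (he : Admissible d e) {K : ℤ}
    (hK : ∀ n, K < n → e n = 0) (n : ℤ) : future l e n < 1 := by
  have : future l e n = ∑ k ∈ Finset.range (K - n).toNat, (e (n + 1 + k) : ℝ) / l ^ (k + 1) := by
    refine tsum_eq_sum fun k hk => ?_
    rw [hK _ (by simp at hk; omega)]; simp
  rw [this]
  exact h.partial_sum_lt_one he n _

lemma future_step (h : UnitCase l l' r c b d) (he : Admissible d e) (n : ℤ) :
    future l e (n + 1) = l * future l e n - e (n + 1) :=
  future_succ h.one_lt (summable_future h.one_lt he.le n)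

lemma past_step (h : UnitCase l l' r c b d) (he : Admissible d e) (n : ℤ) :
    past l' e (n + 1) = e (n + 1) + l' * past l' e n :=
  past_succ (summable_past h.abs_conj_lt_one he.le n)

lemma zero_inTile (h : UnitCase l l' r c b d) {x : ℝ} (h0 : 0 ≤ x) (h1 : x ≤ 1) :
    InTile l c b x 0 := by
  have hl := h.one_lt
  refine ⟨h0, h1, ?_, by linarith, fun _ => by linarith⟩
  cases h <;> norm_num

lemma isClosed_tile : IsClosed {y : ℝ | InTile l c b x y} := by
  unfold InTile
  by_cases hc : c < x
  · simp only [hc, forall_const]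
    refine (isClosed_const.and (isClosed_const.and (isClosed_Ici.and (isClosed_Iic.and isClosed_Iic))))
  · simp only [hc, false_imp_iff]
    refine (isClosed_const.and (isClosed_const.and (isClosed_Ici.and (isClosed_Iic.and isClosed_const))))

/-- If the past is cut off after finitely many digits, the orbit starts on the segment `y = 0` and
is carried along by `inTile_step`. The full past follows because the fibres of the tile are closed.
-/
lemma inTile_future_past (h : UnitCase l l' r c b d) (he : Admissible d e) (n : ℤ) :
    InTile l c b (future l e n) (past l' e n) := by
  have key : ∀ (N : ℕ) (n : ℤ), InTile l c b (future l e n)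
      (∑ k ∈ Finset.range N, (e (n - k) : ℝ) * l' ^ k) := by
    intro N
    induction N with
    | zero =>
      intro n
      simpa using h.zero_inTile (h.future_mem he n).1 (h.future_mem he n).2
    | succ N ih =>
      intro n
      have hf := h.future_step he (n - 1)
      rw [sub_add_cancel] at hf
      have hm := h.future_mem he n
      rw [hf] at hm
      have := h.inTile_step (ih (n - 1)) hm.1 hm.2
      rw [← hf] at this
      rw [Finset.sum_range_succ']
      convert this using 1
      rw [Finset.mul_sum, add_comm]
      congr 1
      · simp
      · refine Finset.sum_congr rfl fun k _ => ?_
        have : n - ((k + 1 : ℕ) : ℤ) = n - 1 - k := by push_cast; ring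
        rw [this, pow_succ]; ring
  exact isClosed_tile.mem_of_tendsto (summable_past h.abs_conj_lt_one he.le n).hasSum.tendsto_sum_nat
    (Eventually.of_forall fun N => key N n)

/-- The digits of an admissible sequence to the right are determined by its `future`. -/
lemma digit_eq_of_future_eq (h : UnitCase l l' r c b d) {e' : ℤ → ℕ} (he : Admissible d e)
    (he' : Admissible d e') {n : ℤ} (heq : future l e n = future l e' n)
    (h1 : ∀ k, n < k → future l e k < 1) (h1' : ∀ k, n < k → future l e' k < 1) (k : ℕ) :
    future l e (n + k) = future l e' (n + k) ∧ e (n + 1 + k) = e' (n + 1 + k) := by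
  have step : ∀ k : ℤ, n ≤ k → future l e k = future l e' k → e (k + 1) = e' (k + 1) := by
    intro k hk hkk
    have a1 := h.future_step he k
    have a2 := h.future_step he' k
    have b1 := (h.future_mem he (k + 1)).1
    have b2 := (h.future_mem he' (k + 1)).1
    have c1 := h1 (k + 1) (by omega)
    have c2 := h1' (k + 1) (by omega)
    have d1 : (e (k + 1) : ℝ) < e' (k + 1) + 1 := by rw [hkk] at a1; linarith
    have d2 : (e' (k + 1) : ℝ) < e (k + 1) + 1 := by rw [hkk] at a1; linarith
    have d1' : e (k + 1) < e' (k + 1) + 1 := by exact_mod_cast d1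
    have d2' : e' (k + 1) < e (k + 1) + 1 := by exact_mod_cast d2
    omega
  have hfut : ∀ k : ℕ, future l e (n + k) = future l e' (n + k) := by
    intro k
    induction k with
    | zero => simpa using heq
    | succ k ih =>
      have : n + ((k + 1 : ℕ) : ℤ) = n + k + 1 := by push_cast; ring
      rw [this, h.future_step he, h.future_step he', ih, step _ (by omega) ih]
  refine ⟨hfut k, ?_⟩
  have := step (n + k) (by omega) (hfut k)
  convert this using 2 <;> ring

/-- A point with an admissible expansion, whose coordinates avoid the subfield generated by `l`,
has only one such expansion. -/
lemma admissible_unique (h : UnitCase l l' r c b d) {e' : ℤ → ℕ} (he : Admissible d e)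
    (he' : Admissible d e') {F : Subfield ℝ} (hF : l ∈ F)
    (hx : future l e 0 = future l e' 0) (hy : past l' e 0 = past l' e' 0)
    (gx : future l e 0 ∉ F) (gy : past l' e 0 ∉ F) : e = e' := by
  have hl := h.one_lt
  have hl0 : l ≠ 0 := by positivity
  have hF' : l' ∈ F := by rw [h.conj_eq]; exact F.sub_mem (natCast_mem F r) hF
  have hl' : l' ≠ 0 := by
    rintro rfl
    rcases h.norm_cases with h | h <;> simp at h
  -- Both recursions are invertible affine maps with coefficients in `F`, so lying outside `F`
  -- spreads from position `0` to all positions.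
  have gen : ∀ {e : ℤ → ℕ}, Admissible d e → future l e 0 ∉ F → past l' e 0 ∉ F →
      ∀ n, future l e n ∉ F ∧ past l' e n ∉ F := by
    intro e he gx gy n
    have up : ∀ n, (future l e n ∈ F ↔ future l e (n + 1) ∈ F) ∧
        (past l' e n ∈ F ↔ past l' e (n + 1) ∈ F) := by
      intro n
      rw [h.future_step he, h.past_step he]
      refine ⟨⟨fun hh => F.sub_mem (F.mul_mem hF hh) (natCast_mem F _), fun hh => ?_⟩,
        ⟨fun hh => F.add_mem (natCast_mem F _) (F.mul_mem hF' hh), fun hh => ?_⟩⟩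
      · have := F.mul_mem (F.inv_mem hF) (F.add_mem hh (natCast_mem F (e (n + 1))))
        rwa [sub_add_cancel, inv_mul_cancel_left₀ hl0] at this
      · have := F.mul_mem (F.inv_mem hF') (F.sub_mem hh (natCast_mem F (e (n + 1))))
        rwa [add_sub_cancel_left, inv_mul_cancel_left₀ hl'] at this
    induction n using Int.induction_on with
    | zero => exact ⟨gx, gy⟩
    | succ n ih => rw [← (up n).1, ← (up n).2]; exact ih
    | pred n ih =>
      have := up (-n - 1)
      rw [sub_add_cancel] at this
      rw [this.1, this.2]; exact ih
  have G := gen he gx gy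
  have G' := gen he' (hx ▸ gx) (hy ▸ gy)
  have lt1 : ∀ {e : ℤ → ℕ}, Admissible d e → (∀ n, future l e n ∉ F ∧ past l' e n ∉ F) →
      ∀ n, 0 < future l e n ∧ future l e n < 1 := fun he G n =>
    ⟨(h.future_mem he n).1.lt_of_ne fun hh => (G n).1 (hh ▸ F.zero_mem),
      (h.future_mem he n).2.lt_of_ne fun hh => (G n).1 (hh ▸ F.one_mem)⟩
  have right := h.digit_eq_of_future_eq he he' hx (fun k _ => (lt1 he G k).2)
    (fun k _ => (lt1 he' G' k).2)
  -- Going left, the digit comes from `pred_digit_unique`, whose exceptional ordinates lie in `F`.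
  have left : ∀ k : ℕ, future l e (-k) = future l e' (-k) ∧ past l' e (-k) = past l' e' (-k) ∧
      e (-k) = e' (-k) := by
    have step : ∀ n : ℤ, future l e n = future l e' n → past l' e n = past l' e' n →
        e n = e' n := by
      intro n fx fy
      have a1 := h.future_step he (n - 1)
      have a2 := h.future_step he' (n - 1)
      have b1 := h.past_step he (n - 1)
      have b2 := h.past_step he' (n - 1)
      rw [sub_add_cancel] at a1 a2 b1 b2
      refine h.pred_digit_unique (h.inTile_future_past he (n - 1))
        (h.inTile_future_past he' (n - 1)) (by rw [← a1, ← a2, fx]) (by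
          rw [← a1]; exact (lt1 he G n).1) (by rw [← b1, ← b2, fy]) (fun p q hpq => ?_)
      rw [← b1] at hpq
      apply (G n).2
      rw [hpq]
      exact F.add_mem (intCast_mem F p) (F.mul_mem (intCast_mem F q) hF)
    intro k
    induction k with
    | zero => exact ⟨by simpa using hx, by simpa using hy, by simpa using step 0 hx hy⟩
    | succ k ih =>
      have hk : -((k + 1 : ℕ) : ℤ) = -k - 1 := by push_cast; ring
      have a1 := h.future_step he (-k - 1)
      have a2 := h.future_step he' (-k - 1)
      have b1 := h.past_step he (-k - 1)
      have b2 := h.past_step he' (-k - 1)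
      rw [sub_add_cancel] at a1 a2 b1 b2
      rw [hk]
      have fx : future l e (-k - 1) = future l e' (-k - 1) := by
        rw [ih.1, ih.2.2, a2] at a1
        exact mul_left_cancel₀ hl0 (by linarith)
      have fy : past l' e (-k - 1) = past l' e' (-k - 1) := by
        rw [ih.2.1, ih.2.2, b2] at b1
        exact mul_left_cancel₀ hl' (by linarith)
      exact ⟨fx, fy, step _ fx fy⟩
  funext n
  rcases lt_or_ge 0 n with hn | hn
  · have := (right (n - 1).toNat).2
    rwa [Int.toNat_of_nonneg (by omega), show (0 : ℤ) + 1 + (n - 1) = n by ring] at this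
  · have := (left (-n).toNat).2.2
    rwa [Int.toNat_of_nonneg (by omega), neg_neg] at this

end UnitCase
-- Existence of admissible expansions
namespace UnitCase

variable {l l' : ℝ} {r : ℕ} {c b : ℝ} {d : ℕ → ℕ} {e : ℤ → ℕ}

/-- The digit sequence of an orbit in `[0, 1)` is admissible. -/
lemma admissible_of_orbit (h : UnitCase l l' r c b d) {x : ℤ → ℝ}
    (hx : ∀ n, 0 ≤ x n ∧ x n < 1) (hrec : ∀ n, x (n + 1) = l * x n - e (n + 1)) :
    Admissible d e := by
  obtain ⟨T, hT0, hT⟩ := h.exists_tail_values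
  have hl := h.one_lt
  have hl0 : 0 < l := by linarith
  intro N n hN
  -- While the digits follow `d`, the orbit stays strictly below the tail values; a digit larger
  -- than `d n` would then make the next point negative.
  have key : ∀ k ≤ n, x (N - 1 + k) < T k := by
    intro k
    induction k with
    | zero => intro _; rw [hT0]; simpa using (hx (N - 1)).2
    | succ k ih =>
      intro hk
      have h1 := ih (by omega)
      have h2 := hrec (N - 1 + k)
      rw [show N - 1 + (k : ℤ) + 1 = N + k by ring, hN k (by omega)] at h2
      rw [show N - 1 + ((k + 1 : ℕ) : ℤ) = N + k by push_cast; ring, h2]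
      have h3 := (hT k).2
      nlinarith
  have h1 := key n le_rfl
  have h2 := hrec (N - 1 + n)
  rw [show N - 1 + (n : ℤ) + 1 = N + n by ring] at h2
  have h3 := (hx (N + n)).1
  have h4 := hT n
  have h5 := (hT (n + 1)).1.2
  have : (e (N + n) : ℝ) < d n + 1 := by nlinarith
  exact Nat.lt_succ_iff.1 (by exact_mod_cast this)

/-- An error in the first coordinate grows by the factor `l` at each step to the right yet stays
bounded. An error in the second is bounded far to the left and contracted by `l'` on the way to `0`.
-/
lemma future_past_eq_of_orbit (h : UnitCase l l' r c b d) (he : Admissible d e) {x y : ℤ → ℝ}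
    (hx : ∀ n, 0 ≤ x n ∧ x n < 1) (hrec : ∀ n, x (n + 1) = l * x n - e (n + 1))
    (hy : ∀ n, b ≤ y n ∧ y n ≤ l) (hrec' : ∀ n, y (n + 1) = e (n + 1) + l' * y n) :
    future l e 0 = x 0 ∧ past l' e 0 = y 0 := by
  have hl := h.one_lt
  constructor
  · have key : ∀ k : ℕ, |future l e 0 - x 0| * l ^ k ≤ 1 := by
      intro k
      have : future l e k - x k = (future l e 0 - x 0) * l ^ k := by
        induction k with
        | zero => simp
        | succ k ih =>
          push_cast
          rw [h.future_step he, hrec, pow_succ]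
          linear_combination l * ih
      rw [← abs_of_pos (show 0 < l ^ k by positivity), ← abs_mul, ← this, abs_le]
      have := h.future_mem he k
      have := hx k
      constructor <;> linarith
    by_contra hne
    have hpos : 0 < |future l e 0 - x 0| := abs_pos.2 (sub_ne_zero.2 hne)
    obtain ⟨k, hk⟩ := pow_unbounded_of_one_lt (1 / |future l e 0 - x 0|) hl
    have := key k
    rw [div_lt_iff₀ hpos] at hk
    linarith
  · have key : ∀ k : ℕ, |past l' e 0 - y 0| ≤ (l - b) * |l'| ^ k := by
      intro k
      have : past l' e 0 - y 0 = (past l' e (-k) - y (-k)) * l' ^ k := by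
        induction k with
        | zero => simp
        | succ k ih =>
          have h1 := h.past_step he (-k - 1)
          have h2 := hrec' (-k - 1)
          rw [sub_add_cancel] at h1 h2
          push_cast
          rw [show -((k : ℤ) + 1) = -k - 1 by ring, pow_succ]
          rw [h1, h2] at ih
          linear_combination ih
      rw [this, abs_mul, abs_pow]
      gcongr
      obtain ⟨-, -, h1, h2, -⟩ := h.inTile_future_past he (-k)
      have := hy (-k)
      rw [abs_le]
      constructor <;> linarith
    have lim : Tendsto (fun k : ℕ => (l - b) * |l'| ^ k) atTop (𝓝 0) := by
      simpa using (tendsto_pow_atTop_nhds_zero_of_lt_one (abs_nonneg l')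
        h.abs_conj_lt_one).const_mul (l - b)
    have := ge_of_tendsto' lim key
    exact sub_eq_zero.1 (abs_nonpos_iff.1 this)

/-- Every point of the tile has an admissible expansion. -/
lemma exists_admissible (h : UnitCase l l' r c b d) {x y : ℝ} (hxy : InHalfTile l c b x y) :
    ∃ e : ℤ → ℕ, Admissible d e ∧ future l e 0 = x ∧ past l' e 0 = y := by
  let P := {p : ℝ × ℝ // InHalfTile l c b p.1 p.2}
  let f : P → P := fun p => ⟨(l * p.1.1 - ⌊l * p.1.1⌋₊, ⌊l * p.1.1⌋₊ + l' * p.1.2),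
    h.halfTile_step p.2⟩
  have hg : ∀ p : P, ∃ q : P, f q = p := by
    intro p
    obtain ⟨m, x₁, y₁, ht, hx, hy⟩ := h.exists_halfTile_pred p.2
    refine ⟨⟨(x₁, y₁), ht⟩, ?_⟩
    have : ⌊l * x₁⌋₊ = m := by
      rw [Nat.floor_eq_iff (mul_nonneg (by linarith [h.one_lt]) ht.1)]
      have := p.2.1
      have := p.2.2.1
      constructor <;> linarith
    ext1
    simp [f, this, ← hx, ← hy]
  choose g hg using hg
  -- A two-sided orbit through the point: `f` moves right, the chosen right inverse `g` moves left,
  -- and truncation by `toNat` makes one of the two iterates trivial.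
  let q : ℤ → P := fun n => f^[n.toNat] (g^[(-n).toNat] ⟨(x, y), hxy⟩)
  have hq : ∀ n, q (n + 1) = f (q n) := by
    intro n
    simp only [q]
    rcases lt_or_ge n 0 with hn | hn
    · have h1 : (n + 1).toNat = 0 := by omega
      have h2 : n.toNat = 0 := by omega
      have h3 : (-n).toNat = (-(n + 1)).toNat + 1 := by omega
      rw [h1, h2, h3, Function.iterate_succ_apply']
      simp [hg]
    · have h1 : (n + 1).toNat = n.toNat + 1 := by omega
      have h2 : (-n).toNat = 0 := by omega
      have h3 : (-(n + 1)).toNat = 0 := by omega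
      rw [h1, h2, h3, Function.iterate_succ_apply']
  let e : ℤ → ℕ := fun n => ⌊l * (q (n - 1)).1.1⌋₊
  have r1 : ∀ n, (q (n + 1)).1.1 = l * (q n).1.1 - e (n + 1) := fun n => by
    rw [hq]; simp [f, e]
  have r2 : ∀ n, (q (n + 1)).1.2 = e (n + 1) + l' * (q n).1.2 := fun n => by
    rw [hq]; simp [f, e]
  have he : Admissible d e := h.admissible_of_orbit (fun n => ⟨(q n).2.1, (q n).2.2.1⟩) r1
  obtain ⟨h1, h2⟩ := h.future_past_eq_of_orbit he (fun n => ⟨(q n).2.1, (q n).2.2.1⟩) r1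
    (fun n => ⟨(q n).2.2.2.1, (q n).2.2.2.2.1⟩) r2
  exact ⟨e, he, by rw [h1]; simp [q], by rw [h2]; simp [q]⟩

/-! ### The tile is a fundamental domain -/

/-- Translates by the lattice spanned by `(1, -1)` and `(c, l - b - 1)` cover the plane. Inside the
strip `0 ≤ x < 1`, a point above the tile is lowered by `(c, l - b - 1)` if it is right of the cut
and by `(c - 1, l - b)` otherwise, and it stays in the strip. -/
lemma halfTile_reduce (h : UnitCase l l' r c b d) (x y : ℝ) :
    ∃ j k : ℤ, InHalfTile l c b (x + (j + k * c)) (y + (-j + k * (l - b - 1))) := by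
  obtain ⟨hc0, hc1⟩ := h.cut_mem
  have hl := h.one_lt
  have hb : 0 < l - b - 1 := by
    cases h with
    | neg => linarith
    | pos g1 g2 g3 g4 =>
      have : (3 : ℝ) ≤ r := by exact_mod_cast g3
      nlinarith
  have down : ∀ (N : ℕ) (x y : ℝ), 0 ≤ x → x < 1 → b ≤ y → y ≤ b + N * (l - b - 1) →
      ∃ j k : ℤ, InHalfTile l c b (x + (j + k * c)) (y + (-j + k * (l - b - 1))) := by
    intro N
    induction N with
    | zero =>
      intro x y x0 x1 y0 y1
      refine ⟨0, 0, ?_⟩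
      norm_num at y1 ⊢
      exact ⟨x0, x1, y0, by linarith, fun _ => by linarith⟩
    | succ N ih =>
      intro x y x0 x1 y0 y1
      push_cast at y1
      rcases le_or_gt c x with hx | hx
      · rcases le_or_gt y (l - 1) with hy | hy
        · exact ⟨0, 0, by norm_num; exact ⟨x0, x1, y0, by linarith, fun _ => hy⟩⟩
        · obtain ⟨j, k, hjk⟩ := ih (x - c) (y - (l - b - 1)) (by linarith) (by linarith)
            (by linarith) (by linarith)
          refine ⟨j, k - 1, ?_⟩
          convert hjk using 1 <;> push_cast <;> ring
      · rcases le_or_gt y l with hy | hy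
        · exact ⟨0, 0, by norm_num; exact ⟨x0, x1, y0, hy, fun _ => by linarith⟩⟩
        · obtain ⟨j, k, hjk⟩ := ih (x + 1 - c) (y - (l - b)) (by linarith) (by linarith)
            (by linarith) (by linarith)
          refine ⟨j + 1, k - 1, ?_⟩
          convert hjk using 1 <;> push_cast <;> ring
  -- `K` is large enough that, after adding `K` copies of the second generator and reducing the
  -- abscissa modulo `1`, the ordinate is at least `b`; from there one only descends.
  obtain ⟨K, hK⟩ := exists_nat_gt ((b + 1 - x - y) / (l - b - 1 + c))
  rw [div_lt_iff₀ (by linarith)] at hK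
  have f1 := Int.floor_le (x + K * c)
  have f2 := Int.lt_floor_add_one (x + K * c)
  obtain ⟨N, hN⟩ := exists_nat_gt ((y + K * (l - b - 1) + ⌊x + K * c⌋ - b) / (l - b - 1))
  rw [div_lt_iff₀ hb] at hN
  obtain ⟨j, k, hjk⟩ := down N (x + K * c - ⌊x + K * c⌋) (y + K * (l - b - 1) + ⌊x + K * c⌋)
    (by linarith) (by linarith) (by nlinarith) (by linarith)
  refine ⟨j - ⌊x + K * c⌋, k + K, ?_⟩
  convert hjk using 1 <;> push_cast <;> ring

/-- By symmetry `k ≥ 0`. The width of the tile excludes `k = 0` with `j ≠ 0`, its height excludes `k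
≥ 2`, and for `k = 1` an overlap can occur only on the bottom edge `y = b`, whose ordinate lies in
`F`. -/
lemma tile_translate_unique (h : UnitCase l l' r c b d) {x y : ℝ} {j k : ℤ}
    (t : InTile l c b x y) (t' : InTile l c b (x + (j + k * c)) (y + (-j + k * (l - b - 1))))
    {F : Subfield ℝ} (hF : l ∈ F) (gx : x ∉ F) (gy : y ∉ F) : j = 0 ∧ k = 0 := by
  obtain ⟨hc0, hc1⟩ := h.cut_mem
  have hl := h.one_lt
  have hcF : c ∈ F := by rw [h.crit_zero]; exact F.sub_mem hF (natCast_mem F _)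
  have hhF : l - b - 1 ∈ F := by
    refine F.sub_mem (F.sub_mem hF ?_) F.one_mem
    cases h with
    | neg => exact F.neg_mem F.one_mem
    | pos => exact F.zero_mem
  -- This is the inequality needed for the vertical shift with `k ≥ 2` to exceed the height `l - b`.
  have hb : 3 - 2 * c ≤ l - b := by
    cases h with
    | neg => nlinarith
    | pos g1 g2 g3 g4 =>
      have : (3 : ℝ) ≤ r := by exact_mod_cast g3
      nlinarith
  wlog hk : 0 ≤ k generalizing x y j k
  · have := this (x := x + (j + k * c)) (y := y + (-j + k * (l - b - 1))) (j := -j) (k := -k)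
      t' (by convert t using 1 <;> push_cast <;> ring) (fun hh => gx (by
        have := F.sub_mem hh (F.add_mem (intCast_mem F j) (F.mul_mem (intCast_mem F k) hcF))
        rwa [add_sub_cancel_right] at this)) (fun hh => gy (by
        have := F.sub_mem hh (F.add_mem (F.neg_mem (intCast_mem F j))
          (F.mul_mem (intCast_mem F k) hhF))
        rwa [add_sub_cancel_right] at this)) (by omega)
    omega
  obtain ⟨x0, x1, y0, y1, hy⟩ := t
  obtain ⟨x0', x1', y0', y1', hy'⟩ := t'
  have ne : ∀ {w : ℝ}, w ∈ F → x ≠ w := fun hw hh => gx (hh ▸ hw)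
  have x0 := x0.lt_of_ne (ne F.zero_mem).symm
  have x1 := x1.lt_of_ne (ne F.one_mem)
  have g2 : x + (j + k * c) ≠ 0 := fun hh => ne (w := -(j + k * c))
    (F.neg_mem (F.add_mem (intCast_mem F j) (F.mul_mem (intCast_mem F k) hcF))) (by linarith)
  have g3 : x + (j + k * c) ≠ 1 := fun hh => ne (w := 1 - (j + k * c))
    (F.sub_mem F.one_mem (F.add_mem (intCast_mem F j) (F.mul_mem (intCast_mem F k) hcF)))
      (by linarith)
  have x0' := x0'.lt_of_ne g2.symm
  have x1' := x1'.lt_of_ne g3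
  rcases (by omega : k = 0 ∨ k = 1 ∨ 2 ≤ k) with rfl | rfl | hk2
  · norm_num at *
    have j1 : (j : ℝ) < 1 := by linarith
    have j2 : (-1 : ℝ) < j := by linarith
    have j1' : j < 1 := by exact_mod_cast j1
    have j2' : -1 < j := by exact_mod_cast j2
    omega
  · exfalso
    norm_num at *
    have j1 : (j : ℝ) < 1 := by linarith
    have j2 : (-2 : ℝ) < j := by linarith
    have j1' : j < 1 := by exact_mod_cast j1
    have j2' : -2 < j := by exact_mod_cast j2
    have hyb : y = b := by
      rcases (by omega : j = 0 ∨ j = -1) with rfl | rfl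
      · norm_num at *
        have := hy' (by linarith)
        linarith
      · norm_num at *
        linarith
    rw [hyb] at gy
    cases h with
    | neg => exact gy (F.neg_mem F.one_mem)
    | pos => exact gy F.zero_mem
  · exfalso
    have k2 : (2 : ℝ) ≤ k := by exact_mod_cast hk2
    nlinarith

end UnitCase
/-! ### The matrix, its eigenvalues and its eigenspaces -/

variable (M : GL (Fin 2) ℤ)

/-- The eigenvalue conjugate to `lam M`. -/
noncomputable def conjLam : ℝ := tr M - lam M

lemma dt_cases : dt M = 1 ∨ dt M = -1 := by
  have : IsUnit (dt M) := (Matrix.isUnit_iff_isUnit_det _).1 M.isUnit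
  exact Int.isUnit_iff.1 this

lemma tr_eq : tr M = M.1 0 0 + M.1 1 1 := Matrix.trace_fin_two _

lemma dt_eq : dt M = M.1 0 0 * M.1 1 1 - M.1 0 1 * M.1 1 0 := Matrix.det_fin_two _

variable {M}

lemma mem_spectrum_of_root {z : ℂ} (hz : z ^ 2 - tr M * z + dt M = 0) :
    z ∈ spectrum ℂ ((M : Matrix (Fin 2) (Fin 2) ℤ).map (Int.cast : ℤ → ℂ)) := by
  rw [Matrix.mem_spectrum_iff_isRoot_charpoly, Matrix.charpoly_fin_two]
  rw [tr_eq, dt_eq] at hz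
  push_cast at hz
  simp [Polynomial.IsRoot, Matrix.trace_fin_two, Matrix.det_fin_two]
  linear_combination hz

/-- With determinant `1`, trace `1` gives the primitive sixth roots of unity as eigenvalues and
trace `2` gives `1`. -/
lemma tr_ge_three (hyp : IsHyperbolic M) (htr : 0 < tr M) (h1 : dt M = 1) : 3 ≤ tr M := by
  by_contra hcon
  rcases (by omega : tr M = 1 ∨ tr M = 2) with h | h
  · obtain ⟨z, hz⟩ := IsAlgClosed.exists_root
      (Polynomial.X ^ 2 - Polynomial.X + 1 : Polynomial ℂ) (by
        have : (Polynomial.X ^ 2 - Polynomial.X + 1 : Polynomial ℂ).degree = 2 := by compute_degree!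
        rw [this]; norm_num)
    simp [Polynomial.IsRoot] at hz
    refine hyp z (mem_spectrum_of_root (by rw [h, h1]; push_cast; linear_combination hz)) ?_
    have h3 : z ^ 3 = -1 := by linear_combination (z + 1) * hz
    have := congrArg norm h3
    rw [norm_pow, norm_neg, norm_one] at this
    exact (pow_eq_one_iff_of_nonneg (norm_nonneg z) (by norm_num)).1 this
  · exact hyp 1 (mem_spectrum_of_root (by rw [h, h1]; push_cast; ring)) (by simp)

lemma disc_pos (hyp : IsHyperbolic M) (htr : 0 < tr M) : 0 < disc M := by
  unfold disc
  rcases dt_cases M with h | h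
  · have := tr_ge_three hyp htr h
    rw [h]; nlinarith
  · rw [h]; nlinarith

/-- A square root of r² ∓ 4 would have the parity of r. The nearest such squares other than r² are
(r ∓ 2)², which overshoot. -/
lemma disc_not_square (hyp : IsHyperbolic M) (htr : 0 < tr M) : ¬ IsSquare (disc M) := by
  rintro ⟨k, hk⟩
  wlog hk0 : 0 ≤ k generalizing k
  · exact this (-k) (by rw [hk]; ring) (by omega)
  unfold disc at hk
  have par : k % 2 = tr M % 2 := by
    have h1 : (tr M * tr M) % 2 = (k * k) % 2 := by
      have : tr M * tr M = k * k + 4 * dt M := by linarith [sq (tr M)]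
      omega
    rcases Int.emod_two_eq_zero_or_one k with a | a <;>
    rcases Int.emod_two_eq_zero_or_one (tr M) with b | b <;>
    simp [Int.mul_emod, a, b] at h1 ⊢
  rcases dt_cases M with h | h
  · have h3 := tr_ge_three hyp htr h
    rw [h] at hk
    have : k < tr M := by nlinarith
    have : k ≤ tr M - 2 := by omega
    nlinarith
  · rw [h] at hk
    have : tr M < k := by nlinarith
    have : tr M + 2 ≤ k := by omega
    nlinarith

lemma lam_add_conjLam : lam M + conjLam M = tr M := by unfold conjLam; ring

lemma sq_sqrt_disc (hD : 0 < disc M) : √(disc M : ℝ) ^ 2 = disc M :=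
  Real.sq_sqrt (by exact_mod_cast hD.le)

lemma lam_sub_conjLam : lam M - conjLam M = √(disc M : ℝ) := by unfold conjLam lam; ring

lemma lam_mul_conjLam (hD : 0 < disc M) : lam M * conjLam M = dt M := by
  have := sq_sqrt_disc hD
  have h2 : (disc M : ℝ) = tr M ^ 2 - 4 * dt M := by unfold disc; push_cast; ring
  unfold conjLam lam
  linear_combination (-1 / 4 : ℝ) * this - (1 / 4) * h2

lemma lam_sq (hD : 0 < disc M) : lam M ^ 2 = tr M * lam M - dt M := by
  linear_combination -lam_mul_conjLam hD + lam M * lam_add_conjLam (M := M)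

lemma exists_unitCase (hyp : IsHyperbolic M) (htr : 0 < tr M) :
    ∃ r c b d, UnitCase (lam M) (conjLam M) r c b d ∧ (r : ℤ) = tr M ∧
      (dt M = 1 ∧ d = (fun i => if i = 0 then r - 1 else r - 2) ∨
        dt M = -1 ∧ d = (fun i => if Even i then r else 0)) := by
  have hD := disc_pos hyp htr
  have hs := lam_sq hD
  obtain ⟨r, hr⟩ := Int.eq_ofNat_of_zero_le htr.le
  have hr' : (tr M : ℝ) = r := by rw [hr]; simp
  have hc : conjLam M = r - lam M := by unfold conjLam; rw [hr']
  have hr1 : 1 ≤ r := by omega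
  have hrr : (1 : ℝ) ≤ r := by exact_mod_cast hr1
  have hsp : 0 < √(disc M : ℝ) := Real.sqrt_pos.2 (by exact_mod_cast hD)
  have hlr : lam M = (r + √(disc M : ℝ)) / 2 := by unfold lam; rw [hr']
  have hss := sq_sqrt_disc hD
  have h2 : (disc M : ℝ) = r ^ 2 - 4 * dt M := by rw [← hr']; unfold disc; push_cast; ring
  rcases dt_cases M with h | h
  · have h3 := tr_ge_three hyp htr h
    have hr3 : 3 ≤ r := by omega
    have hrr : (3 : ℝ) ≤ r := by exact_mod_cast hr3
    have hl : 1 < lam M := by rw [hlr]; linarith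
    rw [h, hr'] at hs
    push_cast at hs
    exact ⟨r, _, _, _, UnitCase.pos hl (by linarith) hr3 hc, hr.symm, Or.inl ⟨h, rfl⟩⟩
  · have hl : 1 < lam M := by
      rw [h] at h2
      push_cast at h2
      rw [hlr]; nlinarith
    rw [h, hr'] at hs
    push_cast at hs
    exact ⟨r, _, _, _, UnitCase.neg hl (by linarith) hr1 hc, hr.symm, Or.inr ⟨h, rfl⟩⟩

/-- The matrix with real entries. -/
def realMat (K : GL (Fin 2) ℤ) : Matrix (Fin 2) (Fin 2) ℝ := K.1.map (Int.cast : ℤ → ℝ)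

lemma realMat_mul (K L : GL (Fin 2) ℤ) : realMat (K * L) = realMat K * realMat L := by
  simp only [realMat, Units.val_mul]
  exact Matrix.map_mul_intCast K.1 L.1

lemma realMat_one : realMat 1 = 1 := by simp [realMat]

variable (M) in
/-- The component of a vector along the expanding eigenline. -/
noncomputable def uPart (v : Fin 2 → ℝ) : Fin 2 → ℝ :=
  (√(disc M : ℝ))⁻¹ • ((realMat M).mulVec v - conjLam M • v)

variable (M) in
/-- The component of a vector along the contracting eigenline. -/
noncomputable def sPart (v : Fin 2 → ℝ) : Fin 2 → ℝ :=
  (√(disc M : ℝ))⁻¹ • (lam M • v - (realMat M).mulVec v)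

lemma sqrt_disc_ne (hD : 0 < disc M) : √(disc M : ℝ) ≠ 0 :=
  (Real.sqrt_pos.2 (by exact_mod_cast hD)).ne'

lemma uPart_add_sPart (hD : 0 < disc M) (v : Fin 2 → ℝ) : uPart M v + sPart M v = v := by
  unfold uPart sPart
  rw [← smul_add, show (realMat M).mulVec v - conjLam M • v + (lam M • v - (realMat M).mulVec v)
    = (lam M - conjLam M) • v by rw [sub_smul]; abel, lam_sub_conjLam,
    inv_smul_smul₀ (sqrt_disc_ne hD)]

/-- Cayley–Hamilton for a matrix of order two. -/
lemma mulVec_mulVec_self (v : Fin 2 → ℝ) :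
    (realMat M).mulVec ((realMat M).mulVec v) = (tr M : ℝ) • (realMat M).mulVec v
      - (dt M : ℝ) • v := by
  rw [tr_eq, dt_eq]
  ext i
  fin_cases i <;> simp [Matrix.mulVec, dotProduct, Fin.sum_univ_two, realMat] <;> ring

lemma mulVec_uPart (hD : 0 < disc M) (v : Fin 2 → ℝ) :
    (realMat M).mulVec (uPart M v) = lam M • uPart M v := by
  unfold uPart
  rw [Matrix.mulVec_smul, Matrix.mulVec_sub, mulVec_mulVec_self, Matrix.mulVec_smul, smul_comm]
  congr 1
  rw [smul_sub, smul_smul, lam_mul_conjLam hD, ← lam_add_conjLam, add_smul]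
  abel

lemma mulVec_sPart (hD : 0 < disc M) (v : Fin 2 → ℝ) :
    (realMat M).mulVec (sPart M v) = conjLam M • sPart M v := by
  unfold sPart
  rw [Matrix.mulVec_smul, Matrix.mulVec_sub, mulVec_mulVec_self, Matrix.mulVec_smul, smul_comm]
  congr 1
  rw [smul_sub, smul_smul, mul_comm (conjLam M), lam_mul_conjLam hD, ← lam_add_conjLam, add_smul]
  abel

lemma uPart_add (v w : Fin 2 → ℝ) : uPart M (v + w) = uPart M v + uPart M w := by
  unfold uPart; rw [Matrix.mulVec_add]; module

lemma uPart_smul (a : ℝ) (v : Fin 2 → ℝ) : uPart M (a • v) = a • uPart M v := by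
  unfold uPart; rw [Matrix.mulVec_smul, smul_comm (conjLam M) a, ← smul_sub, smul_comm]

lemma uPart_mulVec (hD : 0 < disc M) (v : Fin 2 → ℝ) :
    uPart M ((realMat M).mulVec v) = lam M • uPart M v := by
  rw [← mulVec_uPart hD]; unfold uPart
  rw [Matrix.mulVec_smul, Matrix.mulVec_sub, Matrix.mulVec_smul]

/-- The integer vector seen as a real vector. -/
def intVec (w : Fin 2 → ℤ) : Fin 2 → ℝ := fun i => w i

lemma intVec_add (w w' : Fin 2 → ℤ) : intVec (w + w') = intVec w + intVec w' := by
  ext i; simp [intVec]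

lemma intVec_sub (w w' : Fin 2 → ℤ) : intVec (w - w') = intVec w - intVec w' := by
  ext i; simp [intVec]

lemma intVec_neg (w : Fin 2 → ℤ) : intVec (-w) = -intVec w := by
  ext i; simp [intVec]

lemma intVec_smul (a : ℤ) (w : Fin 2 → ℤ) : intVec (a • w) = (a : ℝ) • intVec w := by
  ext i; simp [intVec]

lemma intVec_injective : Function.Injective intVec := by
  intro w w' h
  ext i
  have := congrFun h i
  simp only [intVec] at this
  exact_mod_cast this

lemma intVec_zero : intVec 0 = 0 := by ext i; simp [intVec]

lemma mulVec_intVec (K : GL (Fin 2) ℤ) (w : Fin 2 → ℤ) :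
    (realMat K).mulVec (intVec w) = intVec (K.1.mulVec w) := by
  ext i
  simp [realMat, intVec, Matrix.mulVec, dotProduct]

/-! ### The torus -/

lemma toTorus_add (v w : Fin 2 → ℝ) : toTorus (v + w) = toTorus v + toTorus w := by
  ext i; simp [toTorus]

lemma toTorus_zero : toTorus 0 = 0 := by ext i; simp [toTorus]

lemma toTorus_intVec (w : Fin 2 → ℤ) : toTorus (intVec w) = 0 := by
  ext i
  simp only [toTorus, intVec, Pi.zero_apply]
  exact (AddCircle.coe_eq_zero_iff 1).2 ⟨w i, by simp⟩

lemma toTorus_eq_iff {v w : Fin 2 → ℝ} : toTorus v = toTorus w ↔ ∃ k, v = w + intVec k := by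
  constructor
  · intro h
    have h' : ∀ i, ∃ k : ℤ, v i = w i + k := by
      intro i
      have := congrFun h i
      simp only [toTorus] at this
      rw [← sub_eq_zero, ← AddCircle.coe_sub, AddCircle.coe_eq_zero_iff] at this
      obtain ⟨k, hk⟩ := this
      exact ⟨k, by simp at hk; linarith⟩
    choose k hk using h'
    exact ⟨k, funext hk⟩
  · rintro ⟨k, rfl⟩
    rw [toTorus_add, toTorus_intVec, add_zero]

lemma toTorus_surjective : Function.Surjective toTorus := by
  intro x
  choose v hv using fun i => QuotientAddGroup.mk_surjective (x i)
  exact ⟨v, funext hv⟩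

lemma continuous_toTorus : Continuous toTorus :=
  continuous_pi fun i => (AddCircle.continuous_mk' 1).comp (continuous_apply i)

lemma toralMap_toTorus (K : GL (Fin 2) ℤ) (v : Fin 2 → ℝ) :
    toralMap K (toTorus v) = toTorus ((realMat K).mulVec v) := by
  ext i
  simp [toralMap, toTorus, Matrix.mulVec, dotProduct, Fin.sum_univ_two, realMat]

lemma toralMap_mul (K L : GL (Fin 2) ℤ) (x : UnitAddTorus (Fin 2)) :
    toralMap (K * L) x = toralMap K (toralMap L x) := by
  obtain ⟨v, rfl⟩ := toTorus_surjective x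
  simp only [toralMap_toTorus, realMat_mul, Matrix.mulVec_mulVec]

lemma toralMap_one (x : UnitAddTorus (Fin 2)) : toralMap 1 x = x := by
  obtain ⟨v, rfl⟩ := toTorus_surjective x
  simp only [toralMap_toTorus, realMat_one, Matrix.one_mulVec]

lemma zpow_mulVec_of_eigen {v : Fin 2 → ℝ} {a : ℝ} (ha : a ≠ 0)
    (hv : (realMat M).mulVec v = a • v) (n : ℤ) : (realMat (M ^ n)).mulVec v = a ^ n • v := by
  have inv : (realMat M⁻¹).mulVec v = a⁻¹ • v := by
    have : (realMat M⁻¹).mulVec ((realMat M).mulVec v) = v := by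
      rw [Matrix.mulVec_mulVec, ← realMat_mul, inv_mul_cancel, realMat_one, Matrix.one_mulVec]
    rw [hv, Matrix.mulVec_smul] at this
    rw [eq_inv_smul_iff₀ ha]; exact this
  induction n using Int.induction_on with
  | zero => simp [realMat_one]
  | succ n ih =>
    rw [zpow_add_one, realMat_mul, ← Matrix.mulVec_mulVec, hv, Matrix.mulVec_smul, ih, smul_smul,
      zpow_add_one₀ ha, mul_comm]
  | pred n ih =>
    rw [zpow_sub_one, realMat_mul, ← Matrix.mulVec_mulVec, inv, Matrix.mulVec_smul, ih, smul_smul,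
      zpow_sub_one₀ ha, mul_comm]

/-! ### The coding maps attached to integer vectors -/

namespace SymSeq

variable {l l' : ℝ}

lemma add_digit (e e' : SymSeq l) (n : ℤ) : (e + e').digit n = e.digit n + e'.digit n := rfl

lemma shift_digit (e : SymSeq l) (n : ℤ) : e.shift.digit n = e.digit (n + 1) := rfl

lemma summable_right (e : SymSeq l) :
    Summable fun k : ℕ => (e.digit (0 + 1 + k) : ℝ) / l ^ (k + 1) :=
  e.right_summable.congr fun k => by rw [show (0 : ℤ) + 1 + k = k + 1 by ring]

lemma rightSum_eq (e : SymSeq l) : e.rightSum = future l e.digit 0 :=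
  tsum_congr fun k => by rw [show (0 : ℤ) + 1 + k = k + 1 by ring]

lemma left_term (hl : l ≠ 0) (e : SymSeq l) (k : ℕ) :
    (e.digit (0 - (k + 1 : ℕ)) : ℝ) * l' ^ (k + 1)
      = (e.digit (-((k : ℤ) + 1)) : ℝ) / l ^ (k + 1) * (l * l') ^ (k + 1) := by
  rw [show (0 : ℤ) - (k + 1 : ℕ) = -((k : ℤ) + 1) by push_cast; ring, mul_pow]
  field_simp

/-- As `|l * l'| = 1`, the terms agree in absolute value with those of the left series of `e`. -/
lemma summable_left (hl : l ≠ 0) (hl' : |l * l'| = 1) (e : SymSeq l) :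
    Summable fun k : ℕ => (e.digit (0 - k) : ℝ) * l' ^ k := by
  rw [← summable_nat_add_iff 1]
  refine Summable.of_norm_bounded (g := fun k : ℕ =>
    ‖(e.digit (-((k : ℤ) + 1)) : ℝ) / l ^ (k + 1)‖) e.left_summable.norm fun k => ?_
  rw [left_term hl, norm_mul, norm_pow, Real.norm_eq_abs (l * l'), hl', one_pow, mul_one]

lemma past_eq (hl : l ≠ 0) (hl' : |l * l'| = 1) (e : SymSeq l) :
    past l' e.digit 0 = e.digit 0
      + ∑' k : ℕ, (e.digit (-((k : ℤ) + 1)) : ℝ) / l ^ (k + 1) * (l * l') ^ (k + 1) := by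
  unfold past
  rw [(summable_left hl hl' e).tsum_eq_zero_add, tsum_congr (left_term hl e)]
  simp

lemma continuous_data :
    Continuous fun e : SymSeq l => (e.digit, e.rightSum, e.leftSum) := continuous_induced_dom

lemma continuous_digit (n : ℤ) : Continuous fun e : SymSeq l => e.digit n :=
  (continuous_apply n).comp (continuous_fst.comp continuous_data)

lemma continuous_rightSum : Continuous (rightSum : SymSeq l → ℝ) :=
  continuous_fst.comp (continuous_snd.comp continuous_data)

lemma continuous_leftSum : Continuous (leftSum : SymSeq l → ℝ) :=
  continuous_snd.comp (continuous_snd.comp continuous_data)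

lemma tendsto_iff {ι : Type*} {F : Filter ι} {u : ι → SymSeq l} {e : SymSeq l} :
    Tendsto u F (𝓝 e) ↔ (∀ n, ∀ᶠ i in F, (u i).digit n = e.digit n) ∧
      Tendsto (fun i => (u i).rightSum) F (𝓝 e.rightSum) ∧
      Tendsto (fun i => (u i).leftSum) F (𝓝 e.leftSum) := by
  rw [nhds_induced, tendsto_comap_iff, Prod.tendsto_iff, Prod.tendsto_iff, tendsto_pi_nhds]
  simp

end SymSeq

/-- Weighted sums of nonnegative series that agree on an initial segment. -/
lemma abs_tsum_sub_tsum_le {a b s : ℕ → ℝ} (ha : Summable a) (hb : Summable b)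
    (ha0 : ∀ k, 0 ≤ a k) (hb0 : ∀ k, 0 ≤ b k) (hs : ∀ k, |s k| = 1) {N : ℕ}
    (hN : ∀ k < N, a k = b k) :
    |∑' k, a k * s k - ∑' k, b k * s k| ≤ |∑' k, a k - ∑' k, b k| + 2 * ∑' k, b (k + N) := by
  have has : Summable fun k => a k * s k := Summable.of_norm_bounded ha fun k => by
    rw [norm_mul, Real.norm_eq_abs (s k), hs, mul_one, Real.norm_of_nonneg (ha0 k)]
  have hbs : Summable fun k => b k * s k := Summable.of_norm_bounded hb fun k => by
    rw [norm_mul, Real.norm_eq_abs (s k), hs, mul_one, Real.norm_of_nonneg (hb0 k)]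
  have hab : Summable fun k => a (k + N) - b (k + N) :=
    ((summable_nat_add_iff N).2 ha).sub ((summable_nat_add_iff N).2 hb)
  have hbN := (summable_nat_add_iff N).2 hb
  have e1 : ∑' k, a k * s k - ∑' k, b k * s k
      = ∑' k, (a (k + N) - b (k + N)) * s (k + N) := by
    rw [← has.tsum_sub hbs, ← (has.sub hbs).sum_add_tsum_nat_add N, Finset.sum_eq_zero, zero_add]
    · exact tsum_congr fun k => by ring
    · intro k hk; rw [hN k (Finset.mem_range.1 hk), sub_self]
  have e2 : ∑' k, a k - ∑' k, b k = ∑' k, (a (k + N) - b (k + N)) := by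
    rw [← ha.tsum_sub hb, ← (ha.sub hb).sum_add_tsum_nat_add N, Finset.sum_eq_zero, zero_add]
    intro k hk; rw [hN k (Finset.mem_range.1 hk), sub_self]
  -- For nonnegative numbers |a - b| ≤ (a - b) + 2b. The signed tail is thereby controlled by the
  -- unsigned difference and the tail of `b` alone.
  have hnorm : ∀ k, ‖(a (k + N) - b (k + N)) * s (k + N)‖
      ≤ (a (k + N) - b (k + N)) + 2 * b (k + N) := fun k => by
    rw [norm_mul, Real.norm_eq_abs (s _), hs, mul_one, Real.norm_eq_abs, abs_le]
    have := ha0 (k + N)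
    have := hb0 (k + N)
    constructor <;> linarith
  have := tsum_of_norm_bounded (hab.add (hbN.mul_left 2)).hasSum hnorm
  rw [hab.tsum_add (hbN.mul_left 2), tsum_mul_left] at this
  rw [e1, e2]
  rw [Real.norm_eq_abs] at this
  exact this.trans (by gcongr; exact le_abs_self _)

namespace SymSeq

variable {l l' : ℝ}

/-- The topology controls the coordinates and the unsigned left sum, while the terms of `past` may
alternate in sign. Agreement on a long initial block together with nearby unsigned sums suffices, by
`abs_tsum_sub_tsum_le`. -/
lemma continuous_past (hl : 0 < l) (hl' : |l * l'| = 1) :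
    Continuous fun e : SymSeq l => past l' e.digit 0 := by
  simp only [past_eq hl.ne' hl']
  refine (continuous_of_discreteTopology.comp (continuous_digit 0)).add ?_
  rw [continuous_iff_continuousAt]
  intro e₀
  rw [ContinuousAt, Metric.tendsto_nhds]
  intro ε hε
  have htail := tendsto_sum_nat_add fun k : ℕ => (e₀.digit (-((k : ℤ) + 1)) : ℝ) / l ^ (k + 1)
  obtain ⟨N, hN⟩ := (htail.eventually (gt_mem_nhds (show (0 : ℝ) < ε / 4 by positivity))).exists
  have h1 : ∀ᶠ e : SymSeq l in 𝓝 e₀, ∀ k ∈ Finset.range N,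
      e.digit (-((k : ℤ) + 1)) = e₀.digit (-((k : ℤ) + 1)) := by
    rw [Filter.eventually_all_finset]
    exact fun k _ => (tendsto_iff.1 tendsto_id).1 _
  have h2 := Metric.tendsto_nhds.1 ((continuous_leftSum (l := l)).tendsto e₀) (ε / 4)
    (by positivity)
  filter_upwards [h1, h2] with e h1 h2
  have := abs_tsum_sub_tsum_le (s := fun k => (l * l') ^ (k + 1)) e.left_summable e₀.left_summable
    (fun k => by positivity) (fun k => by positivity) (fun k => by rw [abs_pow, hl', one_pow])
    (N := N) (fun k hk => by rw [h1 k (Finset.mem_range.2 hk)])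
  rw [Real.dist_eq] at h2 ⊢
  unfold leftSum at h2
  refine this.trans_lt ?_
  push_cast at hN this ⊢
  linarith

end SymSeq

section CodingMap

variable {M : GL (Fin 2) ℤ}

variable (M) in
/-- The lift to the plane of the coding map attached to the vector `z`. -/
noncomputable def planePoint (z : Fin 2 → ℤ) (e : ℤ → ℕ) : Fin 2 → ℝ :=
  future (lam M) e 0 • uPart M (intVec z) - past (conjLam M) e 0 • sPart M (intVec z)

lemma norm_lam_mul_conjLam (hD : 0 < disc M) : |lam M * conjLam M| = 1 := by
  rw [lam_mul_conjLam hD]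
  rcases dt_cases M with h | h <;> rw [h] <;> norm_num

lemma conjLam_ne_zero (hD : 0 < disc M) : conjLam M ≠ 0 := by
  intro h
  have := norm_lam_mul_conjLam hD
  rw [h] at this; simp at this

/-- The two sides differ by the integer vector a·M^k z, whose expanding and contracting parts they
are. This turns divergent powers of λ into convergent powers of its conjugate. -/
lemma toTorus_pow_smul (hD : 0 < disc M) (z : Fin 2 → ℤ) (a k : ℕ) :
    toTorus (((a : ℝ) * lam M ^ k) • uPart M (intVec z))
      = toTorus (-(((a : ℝ) * conjLam M ^ k) • sPart M (intVec z))) := by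
  rw [toTorus_eq_iff]
  refine ⟨(a : ℤ) • (M ^ k : GL (Fin 2) ℤ).1.mulVec z, ?_⟩
  have hl : lam M ≠ 0 := fun h => by
    have := norm_lam_mul_conjLam hD
    rw [h] at this; simp at this
  have h1 := zpow_mulVec_of_eigen hl (mulVec_uPart hD (intVec z)) k
  have h2 := zpow_mulVec_of_eigen (conjLam_ne_zero hD) (mulVec_sPart hD (intVec z)) k
  have h3 := mulVec_intVec (M ^ k) z
  rw [← uPart_add_sPart hD (intVec z), Matrix.mulVec_add] at h3
  simp only [zpow_natCast] at h1 h2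
  rw [h1, h2] at h3
  have h4 : intVec ((a : ℤ) • (M ^ k : GL (Fin 2) ℤ).1.mulVec z)
      = (a : ℝ) • intVec ((M ^ k : GL (Fin 2) ℤ).1.mulVec z) := by
    ext i; simp [intVec]
  rw [h4, ← h3, smul_add, smul_smul, smul_smul]
  abel

lemma sum_Icc_neg (f : ℤ → ℝ) (N : ℕ) : ∑ n ∈ Finset.Icc (-(N : ℤ)) N, f n
    = ∑ k ∈ Finset.range N, f (0 + 1 + k) + ∑ k ∈ Finset.range (N + 1), f (0 - k) := by
  induction N with
  | zero => simp
  | succ N ih =>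
    rw [Finset.sum_range_succ, Finset.sum_range_succ _ (N + 1)]
    simp only [Nat.cast_add, Nat.cast_one]
    rw [Finset.sum_Icc_succ_eq_add_endpoints, ih]
    rw [show (0 : ℤ) + 1 + (N : ℤ) = N + 1 by ring, show (0 : ℤ) - (N + 1) = -(N + 1) by ring]
    ring

lemma toTorus_sum {ι : Type*} (s : Finset ι) (f : ι → Fin 2 → ℝ) :
    toTorus (∑ i ∈ s, f i) = ∑ i ∈ s, toTorus (f i) :=
  map_sum (⟨⟨toTorus, toTorus_zero⟩, toTorus_add⟩ : (Fin 2 → ℝ) →+ UnitAddTorus (Fin 2)) f s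

lemma toTorus_partial_sum (hD : 0 < disc M) (z : Fin 2 → ℤ) (e : ℤ → ℕ) (N : ℕ) :
    toTorus ((∑ n ∈ Finset.Icc (-(N : ℤ)) N, (e n : ℝ) * lam M ^ (-n)) • uPart M (intVec z))
      = toTorus ((∑ k ∈ Finset.range N, (e (0 + 1 + k) : ℝ) / lam M ^ (k + 1))
          • uPart M (intVec z)
        - (∑ k ∈ Finset.range (N + 1), (e (0 - k) : ℝ) * conjLam M ^ k)
          • sPart M (intVec z)) := by
  rw [sum_Icc_neg, add_smul, toTorus_add, sub_eq_add_neg, toTorus_add]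
  congr 1
  · congr 2
    refine Finset.sum_congr rfl fun k _ => ?_
    rw [zpow_neg, div_eq_mul_inv, show (0 : ℤ) + 1 + k = ((k + 1 : ℕ) : ℤ) by push_cast; ring,
      zpow_natCast]
  · rw [Finset.sum_smul, Finset.sum_smul, ← Finset.sum_neg_distrib, toTorus_sum, toTorus_sum]
    refine Finset.sum_congr rfl fun k _ => ?_
    rw [zero_sub, neg_neg, zpow_natCast, toTorus_pow_smul hD]

/-- After `toTorus_pow_smul` is applied to the nonpositive positions, the symmetric partial sums
have lifts that converge in the plane. -/
lemma hasCodingSum_planePoint (hD : 0 < disc M) (hl : 0 < lam M) (z : Fin 2 → ℤ)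
    (e : SymSeq (lam M)) :
    HasCodingSum (lam M) (uPart M (intVec z)) e.digit (toTorus (planePoint M z e.digit)) := by
  unfold HasCodingSum
  simp only [toTorus_partial_sum hD]
  refine (continuous_toTorus.tendsto _).comp ?_
  refine Tendsto.sub (Tendsto.smul_const ?_ _) (Tendsto.smul_const ?_ _)
  · exact e.summable_right.hasSum.tendsto_sum_nat
  · exact (SymSeq.summable_left hl.ne' (norm_lam_mul_conjLam hD) e).hasSum.tendsto_sum_nat.comp
      (tendsto_add_atTop_nat 1)

/-- The coding map attached to the integer vector `z`. -/
noncomputable def codingMap (hD : 0 < disc M) (hl : 0 < lam M) (z : Fin 2 → ℤ) :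
    SymSeq (lam M) →ₙ+ UnitAddTorus (Fin 2) where
  toFun e := toTorus (planePoint M z e.digit)
  map_add' e e' := by
    have h1 : future (lam M) (e + e').digit 0
        = future (lam M) e.digit 0 + future (lam M) e'.digit 0 := by
      unfold future
      rw [← e.summable_right.tsum_add e'.summable_right]
      exact tsum_congr fun k => by rw [SymSeq.add_digit]; push_cast; ring
    have h2 : past (conjLam M) (e + e').digit 0
        = past (conjLam M) e.digit 0 + past (conjLam M) e'.digit 0 := by
      unfold past
      rw [← (SymSeq.summable_left hl.ne' (norm_lam_mul_conjLam hD) e).tsum_add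
        (SymSeq.summable_left hl.ne' (norm_lam_mul_conjLam hD) e')]
      exact tsum_congr fun k => by rw [SymSeq.add_digit]; push_cast; ring
    rw [← toTorus_add]
    congr 1
    unfold planePoint
    rw [h1, h2, add_smul, add_smul]
    abel

lemma codingMap_apply (hD : 0 < disc M) (hl : 0 < lam M) (z : Fin 2 → ℤ) (e : SymSeq (lam M)) :
    codingMap hD hl z e = toTorus (planePoint M z e.digit) := rfl

lemma continuous_codingMap (hD : 0 < disc M) (hl : 0 < lam M) (z : Fin 2 → ℤ) :
    Continuous (codingMap hD hl z) := by
  refine continuous_toTorus.comp ?_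
  have h1 := SymSeq.continuous_past hl (norm_lam_mul_conjLam hD)
  have h2 := SymSeq.continuous_rightSum (l := lam M)
  unfold planePoint
  simp only [← SymSeq.rightSum_eq]
  fun_prop

lemma codingMap_shift (hD : 0 < disc M) (hl : 1 < lam M) (z : Fin 2 → ℤ) (e : SymSeq (lam M)) :
    codingMap hD (by linarith) z e.shift = toralMap M (codingMap hD (by linarith) z e) := by
  simp only [codingMap_apply, toralMap_toTorus]
  have h1 : future (lam M) e.shift.digit 0 = lam M * future (lam M) e.digit 0 - e.digit 1 := by
    have := future_succ hl e.summable_right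
    rw [zero_add] at this
    rw [← this]
    exact tsum_congr fun k => by
      rw [SymSeq.shift_digit, show (0 : ℤ) + 1 + k + 1 = 1 + 1 + k by ring]
  have h2 : past (conjLam M) e.shift.digit 0
      = e.digit 1 + conjLam M * past (conjLam M) e.digit 0 := by
    have := past_succ (SymSeq.summable_left (by linarith) (norm_lam_mul_conjLam hD) e)
    rw [zero_add] at this
    rw [← this]
    exact tsum_congr fun k => by
      rw [SymSeq.shift_digit, show (0 : ℤ) - k + 1 = 1 - k by ring]
  rw [toTorus_eq_iff]
  -- The digit at position `1` leaves the future and enters the past; the discrepancy is that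
  -- multiple of u(z) + s(z) = z.
  refine ⟨-(e.digit 1 : ℤ) • z, ?_⟩
  have h3 : intVec (-(e.digit 1 : ℤ) • z)
      = -((e.digit 1 : ℝ) • (uPart M (intVec z) + sPart M (intVec z))) := by
    rw [uPart_add_sPart hD]; ext i; simp [intVec]
  unfold planePoint
  rw [h1, h2, h3, Matrix.mulVec_sub, Matrix.mulVec_smul, Matrix.mulVec_smul, mulVec_uPart hD,
    mulVec_sPart hD]
  module

end CodingMap

/-! ### Coordinates along the eigenlines -/

section Coordinates

variable {M : GL (Fin 2) ℤ}

variable (M) in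
/-- The determinant of `(z, M z)`. -/
def orbitDet (z : Fin 2 → ℤ) : ℤ := z 0 * M.1.mulVec z 1 - z 1 * M.1.mulVec z 0

lemma orbitDet_eq_assocForm (z : Fin 2 → ℤ) : orbitDet M z = -assocForm M (z 1) (-z 0) := by
  simp [orbitDet, assocForm, Matrix.mulVec, dotProduct, Fin.sum_univ_two]
  ring

/-- If `z` and `M z` were parallel, completing the square would make `disc M` times an integer
square a square; the degenerate case `z 1 = 0` makes `disc M` itself a square. -/
lemma orbitDet_ne_zero (hyp : IsHyperbolic M) (htr : 0 < tr M) {z : Fin 2 → ℤ} (hz : z ≠ 0) :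
    orbitDet M z ≠ 0 := by
  intro h
  have hns := disc_not_square hyp htr
  have hdisc : disc M = (M.1 0 0 - M.1 1 1) ^ 2 + 4 * M.1 0 1 * M.1 1 0 := by
    unfold disc; rw [tr_eq, dt_eq]; ring
  simp [orbitDet, Matrix.mulVec, dotProduct, Fin.sum_univ_two] at h
  have key : disc M * z 1 ^ 2 = (2 * M.1 1 0 * z 0 - (M.1 0 0 - M.1 1 1) * z 1) ^ 2 := by
    rw [hdisc]; linear_combination -4 * M.1 1 0 * h
  by_cases h1 : z 1 = 0
  · rw [h1] at h
    have h0 : z 0 ≠ 0 := fun h0 => hz (by ext i; fin_cases i <;> simp [h0, h1])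
    have : M.1 1 0 = 0 := by
      have : z 0 * (M.1 1 0 * z 0) = 0 := by linarith
      simpa [h0] using this
    exact hns ⟨M.1 0 0 - M.1 1 1, by rw [hdisc, this]; ring⟩
  · have hdvd : z 1 ∣ 2 * M.1 1 0 * z 0 - (M.1 0 0 - M.1 1 1) * z 1 := by
      rw [← Int.pow_dvd_pow_iff (n := 2) (by norm_num), ← key]
      exact dvd_mul_left _ _
    obtain ⟨k, hk⟩ := hdvd
    refine hns ⟨k, ?_⟩
    rw [hk] at key
    have : z 1 ^ 2 * (disc M - k * k) = 0 := by linear_combination key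
    rcases mul_eq_zero.1 this with h2 | h2
    · exact absurd (pow_eq_zero_iff (by norm_num) |>.1 h2) h1
    · linarith

variable (M) in
/-- The first coordinate of a vector in the basis `z, M z`. -/
noncomputable def coeffZ (z : Fin 2 → ℤ) : (Fin 2 → ℝ) →ₗ[ℝ] ℝ :=
  (orbitDet M z : ℝ)⁻¹ • ((M.1.mulVec z 1 : ℝ) • LinearMap.proj 0
    - (M.1.mulVec z 0 : ℝ) • LinearMap.proj 1)

variable (M) in
/-- The second coordinate of a vector in the basis `z, M z`. -/
noncomputable def coeffMZ (z : Fin 2 → ℤ) : (Fin 2 → ℝ) →ₗ[ℝ] ℝ :=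
  (orbitDet M z : ℝ)⁻¹ • ((z 0 : ℝ) • LinearMap.proj 1 - (z 1 : ℝ) • LinearMap.proj 0)

variable (M) in
/-- The coordinate along `uPart M z`. -/
noncomputable def xCoord (z : Fin 2 → ℤ) : (Fin 2 → ℝ) →ₗ[ℝ] ℝ :=
  coeffZ M z + lam M • coeffMZ M z

variable (M) in
/-- The coordinate along `-sPart M z`. -/
noncomputable def yCoord (z : Fin 2 → ℤ) : (Fin 2 → ℝ) →ₗ[ℝ] ℝ :=
  -(coeffZ M z + conjLam M • coeffMZ M z)

lemma coeffZ_apply (z : Fin 2 → ℤ) (v : Fin 2 → ℝ) : coeffZ M z v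
    = (orbitDet M z : ℝ)⁻¹ * (M.1.mulVec z 1 * v 0 - M.1.mulVec z 0 * v 1) := by
  simp [coeffZ]

lemma coeffMZ_apply (z : Fin 2 → ℤ) (v : Fin 2 → ℝ) : coeffMZ M z v
    = (orbitDet M z : ℝ)⁻¹ * (z 0 * v 1 - z 1 * v 0) := by
  simp [coeffMZ]

lemma xCoord_apply (z : Fin 2 → ℤ) (v : Fin 2 → ℝ) :
    xCoord M z v = coeffZ M z v + lam M * coeffMZ M z v := rfl

lemma yCoord_apply (z : Fin 2 → ℤ) (v : Fin 2 → ℝ) :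
    yCoord M z v = -(coeffZ M z v + conjLam M * coeffMZ M z v) := rfl

lemma coeff_expansion {z : Fin 2 → ℤ} (hz : orbitDet M z ≠ 0) (v : Fin 2 → ℝ) :
    v = coeffZ M z v • intVec z + coeffMZ M z v • (realMat M).mulVec (intVec z) := by
  have hz' : (orbitDet M z : ℝ) ≠ 0 := by exact_mod_cast hz
  have hd : (orbitDet M z : ℝ) = z 0 * M.1.mulVec z 1 - z 1 * M.1.mulVec z 0 := by
    unfold orbitDet; push_cast; rfl
  rw [mulVec_intVec]
  ext i
  simp only [coeffZ_apply, coeffMZ_apply, Pi.add_apply, Pi.smul_apply, smul_eq_mul, intVec]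
  rw [mul_assoc, mul_assoc, ← mul_add, eq_inv_mul_iff_mul_eq₀ hz', hd]
  fin_cases i <;> simp <;> ring

lemma coord_expansion (hD : 0 < disc M) {z : Fin 2 → ℤ} (hz : orbitDet M z ≠ 0) (v : Fin 2 → ℝ) :
    v = xCoord M z v • uPart M (intVec z) - yCoord M z v • sPart M (intVec z) := by
  conv_lhs => rw [coeff_expansion hz v, ← uPart_add_sPart hD (intVec z), Matrix.mulVec_add,
    mulVec_uPart hD, mulVec_sPart hD]
  rw [xCoord_apply, yCoord_apply]
  module

lemma coeff_unique {z : Fin 2 → ℤ} (hz : orbitDet M z ≠ 0) (p q : ℝ) :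
    coeffZ M z (p • intVec z + q • (realMat M).mulVec (intVec z)) = p ∧
    coeffMZ M z (p • intVec z + q • (realMat M).mulVec (intVec z)) = q := by
  have hz' : (orbitDet M z : ℝ) ≠ 0 := by exact_mod_cast hz
  have hd : (orbitDet M z : ℝ) = z 0 * M.1.mulVec z 1 - z 1 * M.1.mulVec z 0 := by
    unfold orbitDet; push_cast; rfl
  rw [mulVec_intVec, coeffZ_apply, coeffMZ_apply, inv_mul_eq_iff_eq_mul₀ hz',
    inv_mul_eq_iff_eq_mul₀ hz', hd]
  simp only [Pi.add_apply, Pi.smul_apply, smul_eq_mul, intVec]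
  constructor <;> ring

lemma coord_unique (hD : 0 < disc M) {z : Fin 2 → ℤ} (hz : orbitDet M z ≠ 0) (x y : ℝ) :
    xCoord M z (x • uPart M (intVec z) - y • sPart M (intVec z)) = x ∧
    yCoord M z (x • uPart M (intVec z) - y • sPart M (intVec z)) = y := by
  have hs := sqrt_disc_ne hD
  have e : x • uPart M (intVec z) - y • sPart M (intVec z)
      = ((√(disc M : ℝ))⁻¹ * (-(x * conjLam M) - y * lam M)) • intVec z
        + ((√(disc M : ℝ))⁻¹ * (x + y)) • (realMat M).mulVec (intVec z) := by
    unfold uPart sPart; module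
  obtain ⟨h1, h2⟩ := coeff_unique hz ((√(disc M : ℝ))⁻¹ * (-(x * conjLam M) - y * lam M))
    ((√(disc M : ℝ))⁻¹ * (x + y))
  rw [e, xCoord_apply, yCoord_apply, h1, h2]
  have hsub := lam_sub_conjLam (M := M)
  constructor
  · field_simp; linear_combination x * hsub
  · field_simp; linear_combination y * hsub

variable (M) in
/-- The field generated by the eigenvalue. -/
noncomputable def eigenField : Subfield ℝ := Subfield.closure {lam M}

lemma lam_mem : lam M ∈ eigenField M := Subfield.subset_closure rfl

lemma conjLam_mem : conjLam M ∈ eigenField M :=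
  (eigenField M).sub_mem (intCast_mem _ _) lam_mem

lemma countable_eigenField : (eigenField M : Set ℝ).Countable := by
  have := Subfield.cardinalMk_closure_le_max {lam M}
  rw [Cardinal.mk_singleton, max_eq_right Cardinal.one_le_aleph0] at this
  exact Cardinal.le_aleph0_iff_set_countable.1 this

lemma coord_intVec_mem (z w : Fin 2 → ℤ) :
    xCoord M z (intVec w) ∈ eigenField M ∧ yCoord M z (intVec w) ∈ eigenField M := by
  have i := fun n : ℤ => intCast_mem (eigenField M) n
  have h1 : coeffZ M z (intVec w) ∈ eigenField M := by
    rw [coeffZ_apply]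
    exact mul_mem (inv_mem (i _)) (sub_mem (mul_mem (i _) (i _)) (mul_mem (i _) (i _)))
  have h2 : coeffMZ M z (intVec w) ∈ eigenField M := by
    rw [coeffMZ_apply]
    exact mul_mem (inv_mem (i _)) (sub_mem (mul_mem (i _) (i _)) (mul_mem (i _) (i _)))
  exact ⟨add_mem h1 (mul_mem lam_mem h2), neg_mem (add_mem h1 (mul_mem conjLam_mem h2))⟩

variable (M) in
/-- Both eigen-coordinates lie outside the field generated by the eigenvalue. -/
def IsGeneric (z : Fin 2 → ℤ) (v : Fin 2 → ℝ) : Prop :=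
  xCoord M z v ∉ eigenField M ∧ yCoord M z v ∉ eigenField M

/-- Integer vectors have eigen-coordinates in the field, so genericity depends only on the point of
the torus. -/
lemma IsGeneric.add_intVec {z : Fin 2 → ℤ} {v : Fin 2 → ℝ} (h : IsGeneric M z v)
    (w : Fin 2 → ℤ) : IsGeneric M z (v + intVec w) := by
  obtain ⟨h1, h2⟩ := coord_intVec_mem (M := M) z w
  unfold IsGeneric
  rw [map_add, map_add]
  exact ⟨fun hh => h.1 ((add_mem_cancel_right h1).1 hh),
    fun hh => h.2 ((add_mem_cancel_right h2).1 hh)⟩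

/-- The field is countable and each eigen-coordinate is a nonzero linear functional, so the bad set
in the plane is null. The representatives in (0, 1]² carry this to the torus. -/
lemma ae_isGeneric (hD : 0 < disc M) {z : Fin 2 → ℤ} (hz : orbitDet M z ≠ 0) :
    ∀ᵐ x ∂(volume : Measure (UnitAddTorus (Fin 2))), ∃ v, toTorus v = x ∧ IsGeneric M z v := by
  have hm : MeasurableSet ((eigenField M : Set ℝ)ᶜ) :=
    countable_eigenField.measurableSet.compl
  have h0 : ∀ᵐ y : ℝ, y ∈ (eigenField M : Set ℝ)ᶜ := countable_eigenField.ae_notMem volume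
  have hx : Function.Surjective (xCoord M z) := fun x => ⟨_, (coord_unique hD hz x 0).1⟩
  have hy : Function.Surjective (yCoord M z) := fun y => ⟨_, (coord_unique hD hz 0 y).2⟩
  have h1 : ∀ᵐ v : Fin 2 → ℝ, IsGeneric M z v :=
    ((ae_comp_linearMap_mem_iff _ volume volume hx hm).2 h0).and
      ((ae_comp_linearMap_mem_iff _ volume volume hy hm).2 h0)
  have hmp : MeasurePreserving (fun (x : UnitAddTorus (Fin 2)) (i : Fin 2) =>
      ((AddCircle.equivIoc 1 0 (x i) : Set.Ioc (0 : ℝ) (0 + 1)) : ℝ)) volume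
      (Measure.pi fun _ => volume.restrict (Set.Ioc (0 : ℝ) (0 + 1))) :=
    measurePreserving_pi (fun _ => volume) _ fun _ =>
      (measurePreserving_subtype_coe measurableSet_Ioc).comp
        (AddCircle.measurePreserving_equivIoc 1)
  have hac : (Measure.pi fun _ : Fin 2 => (volume : Measure ℝ).restrict (Set.Ioc (0 : ℝ) (0 + 1)))
      ≪ (volume : Measure (Fin 2 → ℝ)) := by
    rw [volume_pi, ← Measure.restrict_pi_pi]
    exact Measure.restrict_le_self.absolutelyContinuous
  have h2 := hmp.quasiMeasurePreserving.ae (hac.ae_le h1)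
  filter_upwards [h2] with x hx
  refine ⟨_, ?_, hx⟩
  ext i
  exact (AddCircle.equivIoc 1 0).symm_apply_apply (x i)

end Coordinates

/-! ### The lattice generated by an orbit -/

section Lattice

variable {M : GL (Fin 2) ℤ}

variable (M) in
/-- The sublattice generated by `z` and `M z`. -/
def orbitLattice (z : Fin 2 → ℤ) : AddSubgroup (Fin 2 → ℤ) where
  carrier := {w | ∃ p q : ℤ, w = p • z + q • M.1.mulVec z}
  zero_mem' := ⟨0, 0, by simp⟩
  add_mem' := by
    rintro _ _ ⟨p, q, rfl⟩ ⟨p', q', rfl⟩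
    exact ⟨p + p', q + q', by module⟩
  neg_mem' := by
    rintro _ ⟨p, q, rfl⟩
    exact ⟨-p, -q, by module⟩

lemma index_orbitLattice {z : Fin 2 → ℤ} (hz : orbitDet M z ≠ 0) :
    (orbitLattice M z).index = (orbitDet M z).natAbs := by
  have hmem : ∀ i, (![z, M.1.mulVec z] : Fin 2 → Fin 2 → ℤ) i ∈ orbitLattice M z := by
    intro i
    fin_cases i
    · exact ⟨1, 0, by simp⟩
    · exact ⟨0, 1, by simp⟩
  have hdet : Matrix.det (Matrix.of ![z, M.1.mulVec z]) = orbitDet M z := by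
    rw [Matrix.det_fin_two]; simp [orbitDet]
  have hli : LinearIndependent ℤ (![z, M.1.mulVec z] : Fin 2 → Fin 2 → ℤ) :=
    Matrix.linearIndependent_rows_of_det_ne_zero (A := Matrix.of ![z, M.1.mulVec z])
      (by rw [hdet]; exact hz)
  let B : Module.Basis (Fin 2) ℤ (orbitLattice M z) := Module.Basis.mk
    (v := fun i => (⟨_, hmem i⟩ : orbitLattice M z))
    (by
      rw [← LinearMap.linearIndependent_iff_of_injOn (orbitLattice M z).subtype.toIntLinearMap
        (Subtype.val_injective.injOn)]
      exact hli)
    (by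
      rintro ⟨_, p, q, rfl⟩ -
      have : (⟨_, p, q, rfl⟩ : orbitLattice M z) = p • ⟨_, hmem 0⟩ + q • ⟨_, hmem 1⟩ := by
        ext1; simp
      rw [this]
      exact add_mem (Submodule.smul_mem _ _ (Submodule.subset_span ⟨0, rfl⟩))
        (Submodule.smul_mem _ _ (Submodule.subset_span ⟨1, rfl⟩)))
  rw [AddSubgroup.index_eq_natAbs_det (Pi.basisFun ℤ (Fin 2)) _ B, ← hdet]
  congr 1
  rw [Pi.basisFun_det_apply]
  congr 1
  ext i j
  simp [B]

end Lattice
/-! ### The standard arithmetic codings -/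

lemma LexLT.trans {a b c : ℕ → ℕ} (h : LexLT a b) (h' : LexLT b c) : LexLT a c := by
  obtain ⟨n, h1, h2⟩ := h
  obtain ⟨m, h3, h4⟩ := h'
  rcases lt_trichotomy n m with hnm | rfl | hnm
  · exact ⟨n, fun i hi => (h1 i hi).trans (h3 i (by omega)), by rw [← h3 n hnm]; exact h2⟩
  · exact ⟨n, fun i hi => (h1 i hi).trans (h3 i hi), h2.trans h4⟩
  · exact ⟨m, fun i hi => (h1 i (by omega)).trans (h3 i hi), by rw [h1 m hnm]; exact h4⟩

/-- A sequence with bounded digits as an element of `SymSeq`. -/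
def SymSeq.ofBounded {l : ℝ} (hl : 1 < l) {C : ℕ} (e : ℤ → ℕ) (he : ∀ n, e n ≤ C) : SymSeq l where
  digit := e
  right_summable := (summable_future hl he 0).congr fun k => by
    rw [show (0 : ℤ) + 1 + k = k + 1 by ring]
  left_summable := (summable_future hl (e := fun n => e (-n)) (fun n => he _) 0).congr fun k => by
    rw [show (0 : ℤ) + 1 + k = k + 1 by ring]

/-- The sequences all of whose tails are at most `d`. -/
def admissibleSet (l : ℝ) (d : ℕ → ℕ) : Set (SymSeq l) := {e | Admissible d e.digit}

lemma isClosed_admissibleSet (l : ℝ) (d : ℕ → ℕ) : IsClosed (admissibleSet l d) := by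
  have : admissibleSet l d = SymSeq.digit ⁻¹' {e | Admissible d e} := rfl
  rw [this]
  refine IsClosed.preimage (continuous_fst.comp SymSeq.continuous_data) ?_
  have hev : ∀ {P : ℕ → Prop} (n : ℤ), IsOpen {e : ℤ → ℕ | P (e n)} := fun {P} n =>
    (isOpen_discrete {k | P k}).preimage (continuous_apply n)
  have hev' : ∀ {P : ℕ → Prop} (n : ℤ), IsClosed {e : ℤ → ℕ | P (e n)} := fun {P} n =>
    (isClosed_discrete {k | P k}).preimage (continuous_apply n)
  have heq : {e | Admissible d e} = ⋂ (N : ℤ) (n : ℕ),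
      ((⋂ i ∈ {i | i < n}, {e : ℤ → ℕ | e (N + i) = d i})ᶜ ∪ {e | e (N + n) ≤ d n}) := by
    ext e
    simp only [Admissible, imp_iff_not_or, Set.mem_iInter, Set.mem_union, Set.mem_compl_iff,
      Set.mem_ofPred_eq]
  rw [heq]
  refine isClosed_iInter fun N => isClosed_iInter fun n =>
    (isClosed_compl_iff.2 ?_).union (hev' (P := (· ≤ d n)) _)
  exact (Set.finite_lt_nat n).isOpen_biInter fun i _ => hev (P := (· = d i)) _

lemma isTotal_admissibleSet (l : ℝ) (d : ℕ → ℕ) : IsTotal (admissibleSet l d) := by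
  intro e he N e' h k n hk
  obtain ⟨p, h1, h2⟩ := h k
  simp only [SymSeq.tail] at h1 h2
  rcases lt_trichotomy p n with hp | rfl | hp
  · have := he N p fun i hi => by rw [← h1 i hi, hk i (by omega)]
    rw [hk p hp] at h2
    omega
  · have := he N p fun i hi => by rw [← h1 i hi, hk i (by omega)]
    omega
  · rw [h1 n hp]
    exact he N n fun i hi => by rw [← h1 i (by omega), hk i hi]

lemma shift_mem_admissibleSet {l : ℝ} {d : ℕ → ℕ} (e : SymSeq l) :
    e.shift ∈ admissibleSet l d ↔ e ∈ admissibleSet l d := by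
  constructor
  · intro h
    have := h.translate (-1)
    simpa [SymSeq.shift_digit, admissibleSet] using this
  · intro h
    exact h.translate 1

section Standard

variable {M : GL (Fin 2) ℤ} {r : ℕ} {c b : ℝ} {d : ℕ → ℕ}

lemma conj_cut (h : UnitCase (lam M) (conjLam M) r c b d) :
    c = lam M - d 0 ∧ lam M - b - 1 = d 0 - conjLam M := by
  refine ⟨h.crit_zero, ?_⟩
  have h4 := h.conj_eq
  rw [h4]
  cases h with
  | neg h1 h2 h3 h4 => simp
  | pos h1 h2 h3 h4 => simp; rw [Nat.cast_sub (by omega)]; push_cast; ring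

/-- The translations of the tiling come from the vectors of the orbit lattice. -/
lemma translate_eq_intVec (h : UnitCase (lam M) (conjLam M) r c b d) (hD : 0 < disc M)
    (z : Fin 2 → ℤ) (j k : ℤ) :
    ((j : ℝ) + k * c) • uPart M (intVec z)
      - (-(j : ℝ) + k * (lam M - b - 1)) • sPart M (intVec z)
      = intVec ((j - k * d 0) • z + k • M.1.mulVec z) := by
  have e : intVec ((j - k * d 0) • z + k • M.1.mulVec z)
      = ((j : ℝ) - k * d 0) • intVec z + (k : ℝ) • (realMat M).mulVec (intVec z) := by
    rw [mulVec_intVec, intVec_add, intVec_smul, intVec_smul]; push_cast; rfl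
  rw [e]
  conv_rhs => rw [← uPart_add_sPart hD (intVec z), Matrix.mulVec_add, mulVec_uPart hD,
    mulVec_sPart hD]
  rw [(conj_cut h).2, (conj_cut h).1]
  module

/-- Every point of the plane is, up to the orbit lattice, the value of an admissible sequence. -/
lemma exists_planePoint (h : UnitCase (lam M) (conjLam M) r c b d) (hD : 0 < disc M)
    {z : Fin 2 → ℤ} (hz : orbitDet M z ≠ 0) (v : Fin 2 → ℝ) :
    ∃ e : ℤ → ℕ, Admissible d e ∧ ∃ w ∈ orbitLattice M z, planePoint M z e = v + intVec w := by
  obtain ⟨j, k, ht⟩ := h.halfTile_reduce (xCoord M z v) (yCoord M z v)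
  obtain ⟨e, he, hx, hy⟩ := h.exists_admissible ht
  refine ⟨e, he, (j - k * d 0) • z + k • M.1.mulVec z, ⟨_, _, rfl⟩, ?_⟩
  rw [← translate_eq_intVec h hD z j k]
  unfold planePoint
  rw [hx, hy]
  nth_rewrite 3 [coord_expansion hD hz v]
  module

/-- Two admissible sequences whose values are generic and differ by the orbit lattice coincide. -/
lemma planePoint_injective (h : UnitCase (lam M) (conjLam M) r c b d) (hD : 0 < disc M)
    {z : Fin 2 → ℤ} (hz : orbitDet M z ≠ 0) {e e' : ℤ → ℕ} (he : Admissible d e)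
    (he' : Admissible d e') (hg : IsGeneric M z (planePoint M z e))
    (hw : ∃ w ∈ orbitLattice M z, planePoint M z e' = planePoint M z e + intVec w) : e = e' := by
  obtain ⟨_, ⟨p, q, rfl⟩, hw⟩ := hw
  obtain ⟨c1, c2⟩ := coord_unique hD hz (future (lam M) e 0) (past (conjLam M) e 0)
  obtain ⟨c1', c2'⟩ := coord_unique hD hz (future (lam M) e' 0) (past (conjLam M) e' 0)
  have key := translate_eq_intVec h hD z (p + q * d 0) q
  rw [show p + q * (d 0 : ℤ) - q * d 0 = p by ring] at key
  obtain ⟨k1, k2⟩ := coord_unique hD hz (((p + q * d 0 : ℤ) : ℝ) + q * c)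
    (-((p + q * d 0 : ℤ) : ℝ) + q * (lam M - b - 1))
  have hx : future (lam M) e' 0 = future (lam M) e 0 + (((p + q * d 0 : ℤ) : ℝ) + q * c) := by
    rw [← c1', ← c1, ← k1, key, ← map_add]
    exact congrArg _ hw
  have hy : past (conjLam M) e' 0
      = past (conjLam M) e 0 + (-((p + q * d 0 : ℤ) : ℝ) + q * (lam M - b - 1)) := by
    rw [← c2', ← c2, ← k2, key, ← map_add]
    exact congrArg _ hw
  have gx : future (lam M) e 0 ∉ eigenField M := by rw [← c1]; exact hg.1
  have gy : past (conjLam M) e 0 ∉ eigenField M := by rw [← c2]; exact hg.2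
  have t := h.inTile_future_past he 0
  have t' := h.inTile_future_past he' 0
  rw [hx, hy] at t'
  obtain ⟨j0, k0⟩ := h.tile_translate_unique t t' lam_mem gx gy
  rw [j0, k0] at hx hy
  simp only [Int.cast_zero, zero_mul, add_zero, neg_zero] at hx hy
  exact h.admissible_unique he he' lam_mem hx.symm hy.symm gx gy

/-- A generic point has exactly `|det (z, M z)|` admissible preimages. -/
lemma encard_preimages (h : UnitCase (lam M) (conjLam M) r c b d) (hD : 0 < disc M)
    (hl : 0 < lam M) {z : Fin 2 → ℤ} (hz : orbitDet M z ≠ 0) {v : Fin 2 → ℝ}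
    (hv : IsGeneric M z v) :
    {e | e ∈ admissibleSet (lam M) d ∧ codingMap hD hl z e = toTorus v}.encard
      = (orbitDet M z).natAbs := by
  set S := {e | e ∈ admissibleSet (lam M) d ∧ codingMap hD hl z e = toTorus v} with hS
  have hk : ∀ e : S, ∃ k, planePoint M z e.1.digit = v + intVec k := fun e =>
    toTorus_eq_iff.1 e.2.2
  choose k hk using hk
  -- A preimage is recorded by the integer translation of its plane point modulo the orbit lattice.
  -- Uniqueness in the tile gives injectivity, covering gives surjectivity, and the count is the
  -- index of the lattice.
  let Φ : S → (Fin 2 → ℤ) ⧸ orbitLattice M z := fun e => QuotientAddGroup.mk (k e)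
  have hinj : Function.Injective Φ := by
    intro e e' hee
    have hmem : -(k e) + k e' ∈ orbitLattice M z := QuotientAddGroup.eq.1 hee
    have := planePoint_injective h hD hz e.2.1 e'.2.1 (by rw [hk]; exact hv.add_intVec _)
      ⟨_, hmem, by
        rw [hk, hk, add_assoc, ← intVec_add, add_neg_cancel_left]⟩
    exact Subtype.ext (SymSeq.ext this)
  have hsurj : Function.Surjective Φ := by
    intro w
    obtain ⟨w, rfl⟩ := QuotientAddGroup.mk_surjective w
    obtain ⟨e, he, u, hu, heu⟩ := exists_planePoint h hD hz (v + intVec w)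
    have e1 : planePoint M z e = v + intVec (w + u) := by
      rw [heu, add_assoc, intVec_add]
    refine ⟨⟨SymSeq.ofBounded h.one_lt e he.le, he, ?_⟩, ?_⟩
    · rw [codingMap_apply, toTorus_eq_iff]; exact ⟨_, e1⟩
    · have e2 := hk ⟨SymSeq.ofBounded h.one_lt e he.le, he, by
        rw [codingMap_apply, toTorus_eq_iff]; exact ⟨_, e1⟩⟩
      have e3 := intVec_injective (add_left_cancel (e1.symm.trans e2))
      simp only [Φ]
      rw [← e3, eq_comm, QuotientAddGroup.eq]
      simpa using hu
  rw [← index_orbitLattice hz, Set.encard, ENat.card_congr (Equiv.ofBijective Φ ⟨hinj, hsurj⟩)]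
  have hfin : (orbitLattice M z).index ≠ 0 := by
    rw [index_orbitLattice hz]; exact Int.natAbs_ne_zero.2 hz
  have : (orbitLattice M z).FiniteIndex := ⟨hfin⟩
  have : Finite ((Fin 2 → ℤ) ⧸ orbitLattice M z) := inferInstance
  rw [ENat.card_eq_coe_natCard]
  rfl

/-! ### Finite sequences -/

lemma hasCodingSum_finite {l : ℝ} {t : Fin 2 → ℝ} {e : ℤ → ℕ} {K : ℕ}
    {x : UnitAddTorus (Fin 2)} (hK : ∀ n, e n ≠ 0 → |n| ≤ K) (hx : HasCodingSum l t e x) :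
    x = toTorus ((∑ n ∈ Finset.Icc (-(K : ℤ)) K, (e n : ℝ) * l ^ (-n)) • t) := by
  refine tendsto_nhds_unique hx ?_
  refine tendsto_const_nhds.congr' ?_
  filter_upwards [eventually_ge_atTop K] with N hN
  congr 2
  refine Finset.sum_subset (Finset.Icc_subset_Icc (by omega) (by omega)) fun n hn hn' => ?_
  have : e n = 0 := by
    by_contra h0
    have := abs_le.1 (hK n h0)
    simp at hn'
    omega
  simp [this]

/-- The expanding line contains no nonzero integer vector, since such a vector would be parallel to
its image under `M`. -/
lemma intVec_eq_smul_uPart (hyp : IsHyperbolic M) (htr : 0 < tr M) {z w : Fin 2 → ℤ}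
    (hz : orbitDet M z ≠ 0) {x : ℝ} (hw : intVec w = x • uPart M (intVec z)) : x = 0 := by
  have hD := disc_pos hyp htr
  by_cases h0 : w = 0
  · have := (coord_unique hD hz x 0).1
    rw [zero_smul, sub_zero, ← hw, h0] at this
    rw [← this]
    rw [intVec_zero, map_zero]
  · have h1 := orbitDet_ne_zero hyp htr h0
    have h2 : (realMat M).mulVec (intVec w) = lam M • intVec w := by
      rw [hw, Matrix.mulVec_smul, mulVec_uPart hD, smul_comm]
    exfalso
    apply h1
    rw [mulVec_intVec] at h2
    have a0 := congrFun h2 0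
    have a1 := congrFun h2 1
    simp only [intVec, Pi.smul_apply, smul_eq_mul] at a0 a1
    have : (orbitDet M w : ℝ) = 0 := by
      unfold orbitDet; push_cast; rw [a0, a1]; ring
    exact_mod_cast this

/-- Finite admissible sequences with the same real value coincide. -/
lemma finite_admissible_unique (h : UnitCase (lam M) (conjLam M) r c b d) {e e' : ℤ → ℕ}
    (he : Admissible d e) (he' : Admissible d e') {K : ℕ} (hK : ∀ n, e n ≠ 0 → |n| ≤ K)
    (hK' : ∀ n, e' n ≠ 0 → |n| ≤ K)
    (heq : ∑ n ∈ Finset.Icc (-(K : ℤ)) K, (e n : ℝ) * lam M ^ (-n)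
      = ∑ n ∈ Finset.Icc (-(K : ℤ)) K, (e' n : ℝ) * lam M ^ (-n)) : e = e' := by
  have hl := h.one_lt
  have hl0 : lam M ≠ 0 := by positivity
  have zero : ∀ {e : ℤ → ℕ}, (∀ n, e n ≠ 0 → |n| ≤ K) → ∀ n : ℤ, (n < -K ∨ K < n) → e n = 0 := by
    intro e hK n hn
    by_contra h0
    have := abs_le.1 (hK n h0)
    omega
  -- Seen from position `-K - 1`, left of all nonzero digits, the whole value is a `future` up to a
  -- power of λ, and the greedy uniqueness of digits applies.
  have val : ∀ {e : ℤ → ℕ}, (∀ n, e n ≠ 0 → |n| ≤ K) → future (lam M) e (-K - 1)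
      = (∑ n ∈ Finset.Icc (-(K : ℤ)) K, (e n : ℝ) * lam M ^ (-n)) * lam M ^ (-(K : ℤ) - 1) := by
    intro e hK
    unfold future
    rw [tsum_eq_sum (s := Finset.range (2 * K + 1)), Finset.sum_mul]
    · symm
      refine Finset.sum_nbij' (fun n => (n + K).toNat) (fun k => (k : ℤ) - K) ?_ ?_ ?_ ?_ ?_
      · intro n hn; simp at hn ⊢; omega
      · intro n hn; simp at hn ⊢; omega
      · intro n hn; simp at hn ⊢; omega
      · intro n hn; simp
      · intro n hn
        simp at hn
        have hn' : (((n + K).toNat : ℕ) : ℤ) = n + K := by omega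
        rw [hn', show -(K : ℤ) - 1 + 1 + (n + K) = n by ring, mul_assoc, ← zpow_add₀ hl0,
          div_eq_mul_inv, ← zpow_natCast, ← zpow_neg]
        congr 2
        push_cast
        rw [← Int.natCast_add_one] at *
        omega
    · intro k hk
      rw [zero hK _ (by simp at hk; omega)]; simp
  have hfut : future (lam M) e (-K - 1) = future (lam M) e' (-K - 1) := by
    rw [val hK, val hK', heq]
  have key := h.digit_eq_of_future_eq he he' hfut
    (fun k _ => h.future_lt_one he (K := K) (fun n hn => zero hK n (Or.inr hn)) k)
    (fun k _ => h.future_lt_one he' (K := K) (fun n hn => zero hK' n (Or.inr hn)) k)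
  funext n
  rcases lt_or_ge n (-K) with hn | hn
  · rw [zero hK n (Or.inl hn), zero hK' n (Or.inl hn)]
  · have := (key (n + K).toNat).2
    rwa [Int.toNat_of_nonneg (by omega), show -(K : ℤ) - 1 + 1 + (n + K) = n by ring] at this

lemma SymSeq.IsFinite.exists_bound {l : ℝ} {e : SymSeq l} (he : e.IsFinite) :
    ∃ K : ℕ, ∀ n, e.digit n ≠ 0 → |n| ≤ K := by
  obtain ⟨K, hK⟩ := (he.image fun n => n.natAbs).bddAbove
  refine ⟨K, fun n hn => ?_⟩
  have : n.natAbs ≤ K := hK ⟨n, hn, rfl⟩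
  exact abs_le.2 ⟨by omega, by omega⟩

/-- Equal images make the difference of the two finite sums times u(z) an integer vector on the
expanding line, hence zero. -/
lemma codingMap_injOn_finite (hyp : IsHyperbolic M) (htr : 0 < tr M) (hD : 0 < disc M)
    (hl : 0 < lam M)
    (h : UnitCase (lam M) (conjLam M) r c b d) {z : Fin 2 → ℤ} (hz : orbitDet M z ≠ 0) :
    Set.InjOn (codingMap hD hl z) {e | e ∈ admissibleSet (lam M) d ∧ e.IsFinite} := by
  rintro e ⟨he, hf⟩ e' ⟨he', hf'⟩ heq
  obtain ⟨K₁, h1⟩ := hf.exists_bound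
  obtain ⟨K₂, h2⟩ := hf'.exists_bound
  have h1' : ∀ n, e.digit n ≠ 0 → |n| ≤ (max K₁ K₂ : ℕ) := fun n hn =>
    (h1 n hn).trans (by exact_mod_cast le_max_left _ _)
  have h2' : ∀ n, e'.digit n ≠ 0 → |n| ≤ (max K₁ K₂ : ℕ) := fun n hn =>
    (h2 n hn).trans (by exact_mod_cast le_max_right _ _)
  rw [codingMap_apply, codingMap_apply,
    hasCodingSum_finite h1' (hasCodingSum_planePoint hD hl z e),
    hasCodingSum_finite h2' (hasCodingSum_planePoint hD hl z e'), toTorus_eq_iff] at heq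
  obtain ⟨k, hk⟩ := heq
  refine SymSeq.ext (finite_admissible_unique h he he' h1' h2' ?_)
  rw [← sub_eq_zero]
  refine intVec_eq_smul_uPart hyp htr hz (w := k) ?_
  rw [sub_smul, hk, add_sub_cancel_left]

lemma isArithmeticCoding_codingMap (hyp : IsHyperbolic M) (htr : 0 < tr M) (hD : 0 < disc M)
    (hl : 0 < lam M)
    (h : UnitCase (lam M) (conjLam M) r c b d) {z : Fin 2 → ℤ} (hz : orbitDet M z ≠ 0) :
    IsArithmeticCoding M (codingMap hD hl z) (admissibleSet (lam M) d) where
  continuous := continuous_codingMap hD hl z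
  equivariant := codingMap_shift hD h.one_lt z
  closed := isClosed_admissibleSet _ _
  shift_invariant := shift_mem_admissibleSet
  total := isTotal_admissibleSet _ _
  surjective x := by
    obtain ⟨v, rfl⟩ := toTorus_surjective x
    obtain ⟨e, he, w, -, hw⟩ := exists_planePoint h hD hz v
    exact ⟨SymSeq.ofBounded h.one_lt e he.le, he, toTorus_eq_iff.2 ⟨w, hw⟩⟩
  injective_finite := codingMap_injOn_finite hyp htr hD hl h hz

lemma isToOneAE_codingMap (hD : 0 < disc M) (hl : 0 < lam M)
    (h : UnitCase (lam M) (conjLam M) r c b d) {z : Fin 2 → ℤ} (hz : orbitDet M z ≠ 0) :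
    IsToOneAE (codingMap hD hl z) (admissibleSet (lam M) d) (orbitDet M z).natAbs := by
  filter_upwards [ae_isGeneric hD hz] with x hx
  obtain ⟨v, rfl, hv⟩ := hx
  exact encard_preimages h hD hl hz hv

end Standard

/-! ### Every coding map comes from an integer vector -/

lemma tendsto_zpow_neg_atTop {l : ℝ} (hl : 1 < l) :
    Tendsto (fun n : ℤ => l ^ (-n)) atTop (𝓝 0) := by
  have h1 := tendsto_pow_atTop_nhds_zero_of_lt_one (inv_nonneg.2 (by linarith : (0 : ℝ) ≤ l))
    (inv_lt_one_of_one_lt₀ hl)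
  have h2 : Tendsto Int.toNat atTop atTop :=
    tendsto_atTop.2 fun b => by
      filter_upwards [eventually_ge_atTop (b : ℤ)] with n hn
      omega
  refine (h1.comp h2).congr' ?_
  filter_upwards [eventually_ge_atTop 0] with n hn
  obtain ⟨k, rfl⟩ := Int.eq_ofNat_of_zero_le hn
  simp [zpow_neg]

lemma tendsto_zpow_atBot_zero {l : ℝ} (hl : 1 < l) :
    Tendsto (fun n : ℤ => l ^ n) atBot (𝓝 0) := by
  simpa [Function.comp_def] using (tendsto_zpow_neg_atTop hl).comp tendsto_neg_atBot_atTop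

namespace SymSeq

variable {l : ℝ}

/-- The sequence `e` restricted to a finite set of positions. -/
noncomputable def restrict (hl : 1 < l) (s : Finset ℤ) (e : ℤ → ℕ) : SymSeq l :=
  ofBounded hl (C := ∑ n ∈ s, e n) (fun n => if n ∈ s then e n else 0) fun n => by
    split_ifs with h
    · exact Finset.single_le_sum (f := e) (fun _ _ => Nat.zero_le _) h
    · exact Nat.zero_le _

lemma restrict_digit (hl : 1 < l) (s : Finset ℤ) (e : ℤ → ℕ) (n : ℤ) :
    (restrict hl s e).digit n = if n ∈ s then e n else 0 := rfl

lemma isFinite_restrict (hl : 1 < l) (s : Finset ℤ) (e : ℤ → ℕ) : (restrict hl s e).IsFinite := by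
  refine s.finite_toSet.subset fun n hn => ?_
  by_contra h
  exact hn (by rw [restrict_digit, if_neg (by simpa using h)])

lemma rightSum_restrict_single (hl : 1 < l) (n : ℤ) :
    (restrict hl {n} 1).rightSum = if 0 < n then l ^ (-n) else 0 := by
  unfold rightSum
  simp only [restrict_digit, Finset.mem_singleton]
  split_ifs with h
  · rw [tsum_eq_single (n - 1).toNat]
    · rw [if_pos (by omega), Pi.one_apply, Nat.cast_one, zpow_neg, one_div, ← zpow_natCast]
      congr 2; push_cast; omega
    · intro k hk
      rw [if_neg (by omega)]; simp
  · exact (tsum_congr fun k => by rw [if_neg (by omega)]; simp).trans tsum_zero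

lemma leftSum_restrict_single (hl : 1 < l) (n : ℤ) :
    (restrict hl {n} 1).leftSum = if n < 0 then l ^ n else 0 := by
  unfold leftSum
  simp only [restrict_digit, Finset.mem_singleton]
  split_ifs with h
  · rw [tsum_eq_single (-n - 1).toNat]
    · rw [if_pos (by omega), Pi.one_apply, Nat.cast_one, one_div, ← zpow_natCast, ← zpow_neg]
      congr 1; push_cast; omega
    · intro k hk
      rw [if_neg (by omega)]; simp
  · exact (tsum_congr fun k => by rw [if_neg (by omega)]; simp).trans tsum_zero

lemma sums_restrict_empty (hl : 1 < l) (e : ℤ → ℕ) :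
    (restrict hl ∅ e).rightSum = 0 ∧ (restrict hl ∅ e).leftSum = 0 := by
  constructor
  · unfold rightSum; simp [restrict_digit]
  · unfold leftSum; simp [restrict_digit]

lemma tendsto_single_atTop (hl : 1 < l) :
    Tendsto (fun n : ℤ => restrict hl {n} 1) atTop (𝓝 (restrict hl ∅ 0)) := by
  rw [tendsto_iff, (sums_restrict_empty hl 0).1, (sums_restrict_empty hl 0).2]
  refine ⟨fun k => ?_, ?_, ?_⟩
  · filter_upwards [eventually_gt_atTop k] with n hn
    simp [restrict_digit, hn.ne]
  · refine (tendsto_zpow_neg_atTop hl).congr' ?_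
    filter_upwards [eventually_gt_atTop 0] with n hn
    rw [rightSum_restrict_single, if_pos hn]
  · refine tendsto_const_nhds.congr' ?_
    filter_upwards [eventually_gt_atTop 0] with n hn
    rw [leftSum_restrict_single, if_neg (by omega)]

lemma tendsto_single_atBot (hl : 1 < l) :
    Tendsto (fun n : ℤ => restrict hl {n} 1) atBot (𝓝 (restrict hl ∅ 0)) := by
  rw [tendsto_iff, (sums_restrict_empty hl 0).1, (sums_restrict_empty hl 0).2]
  refine ⟨fun k => ?_, ?_, ?_⟩
  · filter_upwards [eventually_lt_atBot k] with n hn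
    simp [restrict_digit, hn.ne']
  · refine tendsto_const_nhds.congr' ?_
    filter_upwards [eventually_lt_atBot 0] with n hn
    rw [rightSum_restrict_single, if_neg (by omega)]
  · refine (tendsto_zpow_atBot_zero hl).congr' ?_
    filter_upwards [eventually_lt_atBot 0] with n hn
    rw [leftSum_restrict_single, if_pos hn]

lemma tendsto_restrict (hl : 1 < l) (e : SymSeq l) :
    Tendsto (fun N : ℕ => restrict hl (Finset.Icc (-(N : ℤ)) N) e.digit) atTop (𝓝 e) := by
  rw [tendsto_iff]
  refine ⟨fun k => ?_, ?_, ?_⟩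
  · filter_upwards [eventually_ge_atTop k.natAbs] with N hN
    rw [restrict_digit, if_pos (by rw [Finset.mem_Icc]; omega)]
  · refine e.right_summable.hasSum.tendsto_sum_nat.congr fun N => ?_
    unfold rightSum
    rw [tsum_eq_sum (s := Finset.range N)]
    · refine Finset.sum_congr rfl fun k hk => ?_
      rw [Finset.mem_range] at hk
      rw [restrict_digit, if_pos (by rw [Finset.mem_Icc]; omega)]
    · intro k hk
      rw [Finset.mem_range] at hk
      rw [restrict_digit, if_neg (by rw [Finset.mem_Icc]; omega)]; simp
  · refine e.left_summable.hasSum.tendsto_sum_nat.congr fun N => ?_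
    unfold leftSum
    rw [tsum_eq_sum (s := Finset.range N)]
    · refine Finset.sum_congr rfl fun k hk => ?_
      rw [Finset.mem_range] at hk
      rw [restrict_digit, if_pos (by rw [Finset.mem_Icc]; omega)]
    · intro k hk
      rw [Finset.mem_range] at hk
      rw [restrict_digit, if_neg (by rw [Finset.mem_Icc]; omega)]; simp

end SymSeq

/-! ### Homoclinic points -/

section Homoclinic

variable {M : GL (Fin 2) ℤ}

/-- A forward asymptotic point of the torus lifts to a forward asymptotic point of the plane. -/
lemma exists_lift_tendsto (K : GL (Fin 2) ℤ) (v : Fin 2 → ℝ)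
    (h : Tendsto (fun n : ℕ => toralMap (K ^ n) (toTorus v)) atTop (𝓝 0)) :
    ∃ k, Tendsto (fun n : ℕ => (realMat (K ^ n)).mulVec (v - intVec k)) atTop (𝓝 0) := by
  set V : ℕ → Fin 2 → ℝ := fun n => (realMat (K ^ n)).mulVec v with hV
  -- The nearest integer vectors to the orbit of the lift; convergence on the torus says that the
  -- remainders `w` tend to `0`.
  set k : ℕ → Fin 2 → ℤ := fun n i => round (V n i) with hk
  set w : ℕ → Fin 2 → ℝ := fun n => V n - intVec (k n) with hw
  have hw0 : Tendsto w atTop (𝓝 0) := by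
    rw [tendsto_pi_nhds] at h ⊢
    intro i
    have := (h i).norm
    rw [Pi.zero_apply, norm_zero] at this
    rw [Pi.zero_apply, tendsto_zero_iff_norm_tendsto_zero]
    refine this.congr fun n => ?_
    simp only [toralMap_toTorus]
    exact UnitAddCircle.norm_eq
  have hVs : ∀ n, V (n + 1) = (realMat K).mulVec (V n) := fun n => by
    simp only [hV, pow_succ', realMat_mul, Matrix.mulVec_mulVec]
  have hdiff : ∀ n, intVec (k (n + 1) - K.1.mulVec (k n)) = (realMat K).mulVec (w n) - w (n + 1) := by
    intro n
    simp only [hw, intVec_sub, Matrix.mulVec_sub, mulVec_intVec, hVs]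
    abel
  have hcont : Continuous fun x : Fin 2 → ℝ => (realMat K).mulVec x :=
    Continuous.matrix_mulVec continuous_const continuous_id
  have hd0 : Tendsto (fun n => intVec (k (n + 1) - K.1.mulVec (k n))) atTop (𝓝 0) := by
    simp only [hdiff]
    have h1 := (hcont.tendsto 0).comp hw0
    rw [Matrix.mulVec_zero] at h1
    simpa using h1.sub (hw0.comp (tendsto_add_atTop_nat 1))
  -- Integer vectors tending to `0` are eventually `0`, so the rounding vectors eventually follow
  -- the matrix exactly.
  have hev : ∀ᶠ n in atTop, k (n + 1) = K.1.mulVec (k n) := by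
    have h2 : ∀ i, ∀ᶠ n in atTop, (k (n + 1) - K.1.mulVec (k n)) i = 0 := by
      intro i
      have := (tendsto_pi_nhds.1 hd0 i).norm
      rw [Pi.zero_apply, norm_zero] at this
      filter_upwards [this.eventually (gt_mem_nhds one_pos)] with n hn
      simp only [intVec, Real.norm_eq_abs] at hn
      have : |(k (n + 1) - K.1.mulVec (k n)) i| < 1 := by exact_mod_cast hn
      exact Int.abs_lt_one_iff.1 this
    filter_upwards [eventually_all.2 h2] with n hn
    exact sub_eq_zero.1 (funext hn)
  obtain ⟨n₀, hn₀⟩ := eventually_atTop.1 hev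
  have hkn : ∀ j, k (n₀ + j) = (K ^ j).1.mulVec (k n₀) := by
    intro j
    induction j with
    | zero => simp
    | succ j ih =>
      rw [← add_assoc, hn₀ _ (by omega), ih, Matrix.mulVec_mulVec, pow_succ', Units.val_mul]
  -- Pulling the rounding vector back from time `n₀` gives one integer translation that is correct
  -- for all later times.
  refine ⟨(K ^ n₀)⁻¹.1.mulVec (k n₀), ?_⟩
  refine hw0.congr' ?_
  filter_upwards [eventually_ge_atTop n₀] with n hn
  obtain ⟨j, rfl⟩ := Nat.exists_eq_add_of_le hn
  rw [Matrix.mulVec_sub, mulVec_intVec, Matrix.mulVec_mulVec, ← Units.val_mul]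
  have e : K ^ (n₀ + j) * (K ^ n₀)⁻¹ = K ^ j := by
    rw [add_comm, pow_add, mul_inv_cancel_right]
  rw [e, ← hkn]

lemma eq_zero_of_tendsto_smul {a : ℝ} (ha : 1 ≤ |a|) {v : Fin 2 → ℝ}
    (h : Tendsto (fun n : ℕ => a ^ n • v) atTop (𝓝 0)) : v = 0 := by
  have h1 := h.norm
  rw [norm_zero] at h1
  have h2 : ‖v‖ ≤ 0 := ge_of_tendsto' h1 fun n => by
    rw [norm_smul, norm_pow, Real.norm_eq_abs]
    exact le_mul_of_one_le_left (norm_nonneg _) (one_le_pow₀ ha)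
  exact norm_le_zero_iff.1 h2

lemma continuous_uPart : Continuous (uPart M) := by
  have : Continuous fun x : Fin 2 → ℝ => (realMat M).mulVec x :=
    Continuous.matrix_mulVec continuous_const continuous_id
  unfold uPart
  fun_prop

lemma continuous_sPart : Continuous (sPart M) := by
  have : Continuous fun x : Fin 2 → ℝ => (realMat M).mulVec x :=
    Continuous.matrix_mulVec continuous_const continuous_id
  unfold sPart
  fun_prop

lemma zpow_mulVec_uPart (hD : 0 < disc M) (hl : lam M ≠ 0) (v : Fin 2 → ℝ) (n : ℤ) :
    (realMat (M ^ n)).mulVec (uPart M v) = lam M ^ n • uPart M v :=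
  zpow_mulVec_of_eigen hl (mulVec_uPart hD v) n

lemma zpow_mulVec_sPart (hD : 0 < disc M) (v : Fin 2 → ℝ) (n : ℤ) :
    (realMat (M ^ n)).mulVec (sPart M v) = conjLam M ^ n • sPart M v :=
  zpow_mulVec_of_eigen (conjLam_ne_zero hD) (mulVec_sPart hD v) n

lemma parts_unique (hD : 0 < disc M) {p q : ℝ} {x y : Fin 2 → ℝ} :
    uPart M (p • uPart M x + q • sPart M y) = p • uPart M x ∧
    sPart M (p • uPart M x + q • sPart M y) = q • sPart M y := by
  have e1 := mulVec_uPart hD x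
  have e2 := mulVec_sPart hD y
  have hs := sqrt_disc_ne hD
  have hsub := lam_sub_conjLam (M := M)
  constructor
  · rw [uPart, Matrix.mulVec_add, Matrix.mulVec_smul, Matrix.mulVec_smul, e1, e2, inv_smul_eq_iff₀ hs,
      ← hsub]
    module
  · rw [sPart, Matrix.mulVec_add, Matrix.mulVec_smul, Matrix.mulVec_smul, e1, e2, inv_smul_eq_iff₀ hs,
      ← hsub]
    module

lemma parts_zpow (hD : 0 < disc M) (hl : lam M ≠ 0) (v : Fin 2 → ℝ) (n : ℤ) :
    uPart M ((realMat (M ^ n)).mulVec v) = lam M ^ n • uPart M v ∧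
    sPart M ((realMat (M ^ n)).mulVec v) = conjLam M ^ n • sPart M v := by
  have : (realMat (M ^ n)).mulVec v = lam M ^ n • uPart M v + conjLam M ^ n • sPart M v := by
    conv_lhs => rw [← uPart_add_sPart hD v, Matrix.mulVec_add, zpow_mulVec_uPart hD hl,
      zpow_mulVec_sPart hD]
  rw [this]
  exact parts_unique hD

/-- Homoclinic points are the projections of integer points to the expanding line. -/
lemma IsHomoclinic.exists_intVec (hD : 0 < disc M) (hl : 1 < lam M) {x : UnitAddTorus (Fin 2)}
    (hx : IsHomoclinic M x) : ∃ z, x = toTorus (uPart M (intVec z)) := by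
  obtain ⟨v, rfl⟩ := toTorus_surjective x
  have hl0 : lam M ≠ 0 := by positivity
  have hprod := norm_lam_mul_conjLam hD
  have h1 : Tendsto (fun n : ℕ => toralMap (M ^ n) (toTorus v)) atTop (𝓝 0) := by
    simpa [Function.comp_def] using hx.1.comp tendsto_natCast_atTop_atTop
  have h2 : Tendsto (fun n : ℕ => toralMap (M⁻¹ ^ n) (toTorus v)) atTop (𝓝 0) := by
    simpa [Function.comp_def] using
      hx.2.comp (tendsto_neg_atTop_atBot.comp tendsto_natCast_atTop_atTop)
  obtain ⟨k, hk⟩ := exists_lift_tendsto M v h1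
  obtain ⟨k', hk'⟩ := exists_lift_tendsto M⁻¹ v h2
  -- A lift converging forwards has no expanding part, and one converging backwards has no
  -- contracting part. The difference of the two integer translations is the vector sought.
  have u0 : uPart M (v - intVec k) = 0 := by
    refine eq_zero_of_tendsto_smul (a := lam M) (by rw [abs_of_pos] <;> linarith) ?_
    have := ((continuous_uPart (M := M)).tendsto 0).comp hk
    have h0 : uPart M (0 : Fin 2 → ℝ) = 0 := by simp [uPart]
    rw [h0] at this
    refine this.congr fun n => ?_
    have := (parts_zpow hD hl0 (v - intVec k) n).1
    simpa using this
  have s0 : sPart M (v - intVec k') = 0 := by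
    refine eq_zero_of_tendsto_smul (a := (conjLam M)⁻¹) ?_ ?_
    · rw [abs_mul] at hprod
      rw [abs_inv]
      refine (one_le_inv₀ (abs_pos.2 (conjLam_ne_zero hD))).2 ?_
      have : 1 < |lam M| := by rw [abs_of_pos] <;> linarith
      nlinarith [abs_nonneg (conjLam M)]
    · have := ((continuous_sPart (M := M)).tendsto 0).comp hk'
      have h0 : sPart M (0 : Fin 2 → ℝ) = 0 := by simp [sPart]
      rw [h0] at this
      refine this.congr fun n => ?_
      have := (parts_zpow hD hl0 (v - intVec k') (-n)).2
      simpa using this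
  refine ⟨k - k', ?_⟩
  rw [toTorus_eq_iff]
  refine ⟨k', ?_⟩
  have e1 := uPart_add_sPart hD (v - intVec k')
  rw [s0, add_zero] at e1
  have e2 : uPart M (v - intVec k') = uPart M (v - intVec k) + uPart M (intVec (k - k')) := by
    rw [← uPart_add, intVec_sub]; congr 1; abel
  rw [e2, u0, zero_add] at e1
  rw [e1]; abel

/-- Backwards u(z) contracts; forwards use that u(z) ≡ -s(z) modulo ℤ². -/
lemma isHomoclinic_uPart (hD : 0 < disc M) (hl : 1 < lam M) (z : Fin 2 → ℤ) :
    IsHomoclinic M (toTorus (uPart M (intVec z))) := by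
  have hl0 : lam M ≠ 0 := by positivity
  have hprod := norm_lam_mul_conjLam hD
  constructor
  · have e : ∀ n : ℤ, toralMap (M ^ n) (toTorus (uPart M (intVec z)))
        = toTorus (-(conjLam M ^ n • sPart M (intVec z))) := by
      intro n
      rw [toralMap_toTorus, toTorus_eq_iff]
      refine ⟨(M ^ n).1.mulVec z, ?_⟩
      rw [← mulVec_intVec]
      nth_rewrite 3 [← uPart_add_sPart hD (intVec z)]
      rw [Matrix.mulVec_add, zpow_mulVec_sPart hD]
      abel
    simp only [e]
    rw [← toTorus_zero]
    refine (continuous_toTorus.tendsto _).comp ?_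
    have hc : Tendsto (fun n : ℤ => conjLam M ^ n) atTop (𝓝 0) := by
      rw [tendsto_zero_iff_norm_tendsto_zero]
      refine (tendsto_zpow_neg_atTop hl).congr fun n => ?_
      rw [norm_zpow, Real.norm_eq_abs]
      rw [abs_mul, abs_of_pos (by linarith : (0 : ℝ) < lam M)] at hprod
      rw [zpow_neg, ← inv_zpow, eq_inv_of_mul_eq_one_right hprod]
    simpa using (hc.smul_const (sPart M (intVec z))).neg
  · have e : ∀ n : ℤ, toralMap (M ^ n) (toTorus (uPart M (intVec z)))
        = toTorus (lam M ^ n • uPart M (intVec z)) := by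
      intro n
      rw [toralMap_toTorus, zpow_mulVec_uPart hD hl0]
    simp only [e]
    rw [← toTorus_zero]
    refine (continuous_toTorus.tendsto _).comp ?_
    simpa using (tendsto_zpow_atBot_zero hl).smul_const (uPart M (intVec z))

end Homoclinic

/-! ### Classification of the equivariant homomorphisms -/

section Classification

variable {M : GL (Fin 2) ℤ} {φ : SymSeq (lam M) →ₙ+ UnitAddTorus (Fin 2)}

lemma map_restrict_empty (hl : 1 < lam M) (e : ℤ → ℕ) : φ (SymSeq.restrict hl ∅ e) = 0 := by
  have h : SymSeq.restrict hl ∅ e + SymSeq.restrict hl ∅ e = SymSeq.restrict hl ∅ e := by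
    ext n; simp [SymSeq.add_digit, SymSeq.restrict_digit]
  have := map_add φ (SymSeq.restrict hl ∅ e) (SymSeq.restrict hl ∅ e)
  rw [h] at this
  exact left_eq_add.1 this

lemma map_single (hl : 1 < lam M) (heq : ∀ e, φ e.shift = toralMap M (φ e)) (n : ℤ) :
    φ (SymSeq.restrict hl {n} 1) = toralMap (M ^ (-n)) (φ (SymSeq.restrict hl {0} 1)) := by
  have step : ∀ n : ℤ, φ (SymSeq.restrict hl {n} 1)
      = toralMap M (φ (SymSeq.restrict hl {n + 1} 1)) := by
    intro n
    rw [← heq]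
    congr 1
    ext k
    simp [SymSeq.shift_digit, SymSeq.restrict_digit]
  induction n using Int.induction_on with
  | zero => simp [toralMap_one]
  | succ n ih =>
    rw [step] at ih
    have := congrArg (toralMap M⁻¹) ih
    rw [← toralMap_mul, inv_mul_cancel, toralMap_one, ← toralMap_mul] at this
    rw [this]
    congr 1
    rw [neg_add, ← sub_eq_add_neg, zpow_sub_one, ← zpow_neg_one, ← zpow_add, ← zpow_add, add_comm]
  | pred n ih =>
    rw [step, sub_add_cancel, ih, ← toralMap_mul]
    congr 1
    rw [← zpow_one_add]; congr 1; ring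

lemma map_restrict (hl : 1 < lam M) (heq : ∀ e, φ e.shift = toralMap M (φ e)) {t : Fin 2 → ℝ}
    (ht : φ (SymSeq.restrict hl {0} 1) = toTorus t) (hMt : (realMat M).mulVec t = lam M • t)
    (s : Finset ℤ) (e : ℤ → ℕ) :
    φ (SymSeq.restrict hl s e) = toTorus ((∑ n ∈ s, (e n : ℝ) * lam M ^ (-n)) • t) := by
  have hl0 : lam M ≠ 0 := by positivity
  have one : ∀ n : ℤ, φ (SymSeq.restrict hl {n} 1) = toTorus (lam M ^ (-n) • t) := by
    intro n
    rw [map_single hl heq, ht, toralMap_toTorus, zpow_mulVec_of_eigen hl0 hMt]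
  have mono : ∀ (n : ℤ) (a : ℕ), φ (SymSeq.restrict hl {n} (fun _ => a))
      = toTorus (((a : ℝ) * lam M ^ (-n)) • t) := by
    intro n a
    induction a with
    | zero =>
      have : SymSeq.restrict hl {n} (fun _ => 0) = SymSeq.restrict hl ∅ 0 := by
        ext k; simp [SymSeq.restrict_digit]
      rw [this, map_restrict_empty]; simp [toTorus_zero]
    | succ a ih =>
      have : SymSeq.restrict hl {n} (fun _ => a + 1)
          = SymSeq.restrict hl {n} (fun _ => a) + SymSeq.restrict hl {n} 1 := by
        ext k; simp only [SymSeq.restrict_digit, SymSeq.add_digit]; split_ifs <;> simp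
      rw [this, map_add, ih, one, ← toTorus_add, ← add_smul]
      congr 2; push_cast; ring
  induction s using Finset.induction_on with
  | empty => rw [map_restrict_empty]; simp [toTorus_zero]
  | insert a s ha ih =>
    have : SymSeq.restrict hl (insert a s) e
        = SymSeq.restrict hl {a} (fun _ => e a) + SymSeq.restrict hl s e := by
      ext k
      simp only [SymSeq.restrict_digit, SymSeq.add_digit, Finset.mem_insert, Finset.mem_singleton]
      by_cases hk : k = a
      · subst hk; simp [ha]
      · simp [hk]
    rw [this, map_add, ih, mono, ← toTorus_add, ← add_smul, Finset.sum_insert ha]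

/-- A single 1 moved to ±∞ tends to the zero sequence, so by equivariance and continuity its image
is homoclinic. Additivity fixes φ on finite sequences, and these are dense by
`SymSeq.tendsto_restrict`. -/
lemma exists_hasCodingSum (hD : 0 < disc M) (hl : 1 < lam M) (hc : Continuous φ)
    (heq : ∀ e, φ e.shift = toralMap M (φ e)) :
    ∃ z : Fin 2 → ℤ, ∀ e, HasCodingSum (lam M) (uPart M (intVec z)) e.digit (φ e) := by
  have hom : IsHomoclinic M (φ (SymSeq.restrict hl {0} 1)) := by
    have h0 := map_restrict_empty (φ := φ) hl 0
    have hneg : ∀ n : ℤ, toralMap (M ^ n) (φ (SymSeq.restrict hl {0} 1))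
        = φ (SymSeq.restrict hl {-n} 1) := fun n => by rw [map_single hl heq (-n), neg_neg]
    unfold IsHomoclinic
    simp only [hneg]
    rw [← h0]
    exact ⟨(hc.tendsto _).comp ((SymSeq.tendsto_single_atBot hl).comp tendsto_neg_atTop_atBot),
      (hc.tendsto _).comp ((SymSeq.tendsto_single_atTop hl).comp tendsto_neg_atBot_atTop)⟩
  obtain ⟨z, hz⟩ := hom.exists_intVec hD hl
  refine ⟨z, fun e => ?_⟩
  unfold HasCodingSum
  simp only [← map_restrict hl heq hz (mulVec_uPart hD _)]
  exact (hc.tendsto _).comp (SymSeq.tendsto_restrict hl e)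

/-- Every coding map is attached to a nonzero integer vector. -/
lemma IsArithmeticCoding.exists_vector {X : Set (SymSeq (lam M))} (hD : 0 < disc M)
    (hl : 1 < lam M) (h : IsArithmeticCoding M φ X) :
    ∃ z : Fin 2 → ℤ, z ≠ 0 ∧ (∀ e, φ e = toTorus (planePoint M z e.digit)) ∧
      ∀ e, HasCodingSum (lam M) (uPart M (intVec z)) e.digit (φ e) := by
  obtain ⟨z, hz⟩ := exists_hasCodingSum hD hl h.continuous h.equivariant
  have key : ∀ e, φ e = toTorus (planePoint M z e.digit) := fun e =>
    tendsto_nhds_unique (hz e) (hasCodingSum_planePoint hD (by linarith) z e)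
  refine ⟨z, ?_, key, hz⟩
  rintro rfl
  -- For z = 0 the map would be identically zero and would miss the point (1/2, 1/2).
  obtain ⟨e, -, he⟩ := h.surjective (toTorus fun _ => 1 / 2)
  rw [key] at he
  have : planePoint M 0 e.digit = 0 := by
    simp [planePoint, intVec_zero, uPart, sPart]
  rw [this, toTorus_eq_iff] at he
  obtain ⟨k, hk⟩ := he
  have := congrFun hk 0
  simp [intVec] at this
  have h2 : (2 * k 0 : ℝ) = -1 := by linarith
  have h3 : 2 * k 0 = -1 := by exact_mod_cast h2
  omega

end Classification

/-! ### The structure of an arbitrary arithmetic coding -/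

lemma hasCodingSum_restrict {l : ℝ} (hl : 1 < l) {t : Fin 2 → ℝ} {e : ℤ → ℕ} {s : Finset ℤ}
    {x : UnitAddTorus (Fin 2)} (hx : HasCodingSum l t (SymSeq.restrict hl s e).digit x) :
    x = toTorus ((∑ n ∈ s, (e n : ℝ) * l ^ (-n)) • t) := by
  refine tendsto_nhds_unique hx (tendsto_const_nhds.congr' ?_)
  filter_upwards [eventually_ge_atTop (∑ n ∈ s, n.natAbs)] with N hN
  congr 2
  have hsub : s ⊆ Finset.Icc (-(N : ℤ)) N := fun n hn => by
    have := Finset.single_le_sum (f := fun n : ℤ => n.natAbs) (fun _ _ => Nat.zero_le _) hn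
    rw [Finset.mem_Icc]; omega
  rw [← Finset.sum_subset hsub fun n _ hn => by simp [SymSeq.restrict_digit, hn]]
  exact Finset.sum_congr rfl fun n hn => by simp [SymSeq.restrict_digit, hn]

/-- A finite sequence that agrees with `c` up to the position `n`, where it is at most `c n`, and
vanishes afterwards, is lexicographically smaller than `c` unless `c` vanishes after `n`. -/
lemma lexLT_or_zero {w c : ℕ → ℕ} {n : ℕ} (h1 : ∀ i < n, w i = c i) (h2 : w n ≤ c n)
    (h3 : ∀ i, n < i → w i = 0) : LexLT w c ∨ ∀ i, n < i → c i = 0 := by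
  by_cases h : ∃ i, n ≤ i ∧ w i < c i
  · left
    classical
    refine ⟨Nat.find h, fun i hi => ?_, (Nat.find_spec h).2⟩
    rcases lt_or_ge i n with hin | hin
    · exact h1 i hin
    · have := Nat.find_min h hi
      rcases hin.lt_or_eq with hin' | rfl
      · have := h3 i hin'
        omega
      · omega
  · right
    push Not at h
    intro i hi
    have := h i hi.le
    have := h3 i hi
    omega

section Structure

variable {M : GL (Fin 2) ℤ} {φ : SymSeq (lam M) →ₙ+ UnitAddTorus (Fin 2)}
  {X : Set (SymSeq (lam M))} {r : ℕ} {c b : ℝ} {d : ℕ → ℕ}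

/-- Two different finite sequences with the same value cannot both lie below a tail of a member
of the coding. -/
lemma IsArithmeticCoding.restrict_eq (hl : 1 < lam M) (hX : IsArithmeticCoding M φ X)
    {t : Fin 2 → ℝ} (ht : ∀ e, HasCodingSum (lam M) t e.digit (φ e)) {e : SymSeq (lam M)}
    (he : e ∈ X) {N : ℤ} {s s' : Finset ℤ} {w w' : ℤ → ℕ}
    (hw : ∀ k, LexLT ((SymSeq.restrict hl s w).tail k) (e.tail N))
    (hw' : ∀ k, LexLT ((SymSeq.restrict hl s' w').tail k) (e.tail N))
    (hsum : ∑ n ∈ s, (w n : ℝ) * lam M ^ (-n) = ∑ n ∈ s', (w' n : ℝ) * lam M ^ (-n)) :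
    SymSeq.restrict hl s w = SymSeq.restrict hl s' w' := by
  refine hX.injective_finite ⟨hX.total e he N _ hw, SymSeq.isFinite_restrict _ _ _⟩
    ⟨hX.total e he N _ hw', SymSeq.isFinite_restrict _ _ _⟩ ?_
  rw [hasCodingSum_restrict hl (ht _), hasCodingSum_restrict hl (ht _), hsum]

lemma SymSeq.tail_apply {l : ℝ} (e : SymSeq l) (N : ℤ) (i : ℕ) : e.tail N i = e.digit (N + i) := rfl

/-- The relation 1 = rλ⁻¹ + λ⁻² gives two finite sequences of equal value. If the word (r, 1, 0, …)
lay below a tail of a member, totality would put both into `X`, against injectivity on finite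
sequences. -/
lemma not_lexLT_neg (hl : 1 < lam M) (hsq : lam M ^ 2 = r * lam M + 1) (hr : 1 ≤ r)
    (hX : IsArithmeticCoding M φ X) {t : Fin 2 → ℝ}
    (ht : ∀ e, HasCodingSum (lam M) t e.digit (φ e)) {e : SymSeq (lam M)} (he : e ∈ X) (N : ℤ) :
    ¬ LexLT (fun i => if i = 0 then r else if i = 1 then 1 else 0) (e.tail N) := by
  intro hlt
  have hl0 : lam M ≠ 0 := by positivity
  set W : ℕ → ℕ := fun i => if i = 0 then r else if i = 1 then 1 else 0 with hW
  have tail1 : ∀ u : ℕ → ℕ, u 0 < r → LexLT u (e.tail N) := fun u hu =>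
    LexLT.trans ⟨0, by simp, by simpa [hW] using hu⟩ hlt
  have tail2 : ∀ u : ℕ → ℕ, u 0 = 1 → u 1 = 0 → LexLT u (e.tail N) := fun u h0 h1 => by
    -- For `r = 1` the sequence 1, 0, … begins with the same digit as the word, and the second digit
    -- decides.
    rcases hr.lt_or_eq with hr | rfl
    · exact tail1 u (by omega)
    · refine LexLT.trans ⟨1, fun i hi => ?_, by simp [hW, h1]⟩ hlt
      have : i = 0 := by omega
      subst this
      simp [hW, h0]
  have key := hX.restrict_eq hl ht he (N := N) (s := {1, 2}) (s' := {0})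
    (w := fun n => if n = 1 then r else 1) (w' := fun _ => 1) ?_ ?_ ?_
  · have := congrArg (fun e => e.digit 0) key
    simp [SymSeq.restrict_digit] at this
  · intro k
    by_cases h1 : k = 1
    · have : (SymSeq.restrict hl {1, 2} (fun n => if n = 1 then r else 1)).tail k = W := by
        funext i
        subst h1
        simp only [SymSeq.tail_apply, SymSeq.restrict_digit, hW, Finset.mem_insert,
          Finset.mem_singleton]
        rcases i with _ | _ | i
        · simp
        · simp
        · simp; omega
      rw [this]; exact hlt
    · by_cases h2 : k = 2
      · subst h2
        exact tail2 _ (by simp [SymSeq.tail_apply, SymSeq.restrict_digit])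
          (by simp [SymSeq.tail_apply, SymSeq.restrict_digit])
      · refine tail1 _ ?_
        simp [SymSeq.tail_apply, SymSeq.restrict_digit, h1, h2]; omega
  · intro k
    by_cases h1 : k = 0
    · subst h1
      exact tail2 _ (by simp [SymSeq.tail_apply, SymSeq.restrict_digit])
        (by simp [SymSeq.tail_apply, SymSeq.restrict_digit])
    · refine tail1 _ ?_
      simp [SymSeq.tail_apply, SymSeq.restrict_digit, h1]; omega
  · rw [Finset.sum_pair (by norm_num)]
    simp
    field_simp
    norm_cast
    linarith

/-- The word is r-1, r-2, …, r-2, r-1, or the single digit r when `n = 0`. It telescopes by λ⁻¹ = r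
- λ to two units placed just before and just after it. -/
lemma sum_word_pos {l : ℝ} (hl : l ≠ 0) (hsq : l ^ 2 + 1 = r * l) (hr : 3 ≤ r) (n : ℕ) :
    ∑ i ∈ Finset.range (n + 1), (((r - 2 : ℕ) + (if i = 0 then 1 else 0)
      + (if i = n then 1 else 0) : ℕ) : ℝ) * l ^ (-(i : ℤ)) = l + l ^ (-(n + 1 : ℤ)) := by
  have h1 : ∀ n : ℕ, ∑ i ∈ Finset.range (n + 1), (r - 2 : ℝ) * l ^ (-(i : ℤ))
      = l - 1 - l ^ (-(n : ℤ)) + l ^ (-(n + 1 : ℤ)) := by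
    intro n
    induction n with
    | zero =>
      simp
      field_simp
      linarith
    | succ n ih =>
      rw [Finset.sum_range_succ, ih]
      push_cast
      have e1 : l ^ (-(n : ℤ)) = l ^ (-((n : ℤ) + 1)) * l := by
        rw [← zpow_add_one₀ hl]; congr 1; ring
      have e2 : l ^ (-((n : ℤ) + 1 + 1)) = l ^ (-((n : ℤ) + 1)) * l⁻¹ := by
        rw [← zpow_sub_one₀ hl]; congr 1
      have e3 : l⁻¹ = r - l := by field_simp; linarith
      rw [e1, e2, e3]; ring
  push_cast [Nat.cast_sub (show 2 ≤ r by omega)]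
  simp only [add_mul, Finset.sum_add_distrib, h1]
  simp [Finset.sum_ite_eq']
  ring

/-- As in `not_lexLT_neg`, with the coincidence of values supplied by `sum_word_pos`. -/
lemma not_lexLT_pos (hl : 1 < lam M) (hsq : lam M ^ 2 + 1 = r * lam M) (hr : 3 ≤ r)
    (hX : IsArithmeticCoding M φ X) {t : Fin 2 → ℝ}
    (ht : ∀ e, HasCodingSum (lam M) t e.digit (φ e)) {e : SymSeq (lam M)} (he : e ∈ X) (N : ℤ)
    (n : ℕ) :
    ¬ LexLT (fun i => if i ≤ n then r - 2 + (if i = 0 then 1 else 0) + (if i = n then 1 else 0)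
      else 0) (e.tail N) := by
  intro hlt
  have hl0 : lam M ≠ 0 := by positivity
  set W : ℕ → ℕ := fun i => if i ≤ n then r - 2 + (if i = 0 then 1 else 0)
    + (if i = n then 1 else 0) else 0 with hW
  have W0 : r - 1 ≤ W 0 := by simp [hW]; omega
  have tail1 : ∀ u : ℕ → ℕ, u 0 < W 0 → LexLT u (e.tail N) := fun u hu =>
    LexLT.trans ⟨0, by simp, hu⟩ hlt
  set s : Finset ℤ := (Finset.range (n + 1)).map Nat.castEmbedding with hs
  have mem_s : ∀ k : ℤ, k ∈ s ↔ 0 ≤ k ∧ k ≤ n := by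
    intro k
    simp only [hs, Finset.mem_map, Finset.mem_range, Nat.castEmbedding_apply]
    constructor
    · rintro ⟨a, ha, rfl⟩; omega
    · intro hk; exact ⟨k.toNat, by omega, by omega⟩
  have dig : ∀ k : ℤ, (SymSeq.restrict hl s (fun k => W k.toNat)).digit k
      = if 0 ≤ k ∧ k ≤ n then W k.toNat else 0 := fun k => by
    rw [SymSeq.restrict_digit]; simp only [mem_s]
  have key := hX.restrict_eq hl ht he (N := N) (s := s) (s' := {-1, (n : ℤ) + 1})
    (w := fun k => W k.toNat) (w' := fun _ => 1) ?_ ?_ ?_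
  · have := congrArg (fun e => e.digit (-1)) key
    simp only [dig] at this
    simp [SymSeq.restrict_digit] at this
  · intro k
    by_cases hk0 : k = 0
    · have : (SymSeq.restrict hl s (fun k => W k.toNat)).tail k = W := by
        funext i
        subst hk0
        rw [SymSeq.tail_apply, dig, zero_add, Int.toNat_natCast]
        split_ifs with hi
        · rfl
        · simp only [hW]; rw [if_neg (by omega)]
      rw [this]; exact hlt
    · by_cases hkn : k = n
      · have hn : n ≠ 0 := by rintro rfl; exact hk0 (by simpa using hkn)
        -- The tail starting at the last letter also begins with `r - 1`, but continues with `0 < r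
        -- - 2`; this uses `r ≥ 3`.
        refine LexLT.trans ⟨1, fun i hi => ?_, ?_⟩ hlt
        · have : i = 0 := by omega
          subst this
          rw [SymSeq.tail_apply, dig, if_pos (by omega)]
          have : (k + ((0 : ℕ) : ℤ)).toNat = n := by omega
          rw [this]
          simp [hW, hn, Ne.symm hn]
        · rw [SymSeq.tail_apply, dig, if_neg (by omega)]
          simp only [hW]
          rw [if_pos (by omega)]
          omega
      · refine tail1 _ ?_
        rw [SymSeq.tail_apply, dig]
        split_ifs with hk
        · have h1 : (k + ((0 : ℕ) : ℤ)).toNat ≠ 0 := by omega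
          have h2 : (k + ((0 : ℕ) : ℤ)).toNat ≠ n := by omega
          have : W (k + ((0 : ℕ) : ℤ)).toNat = r - 2 := by
            simp only [hW, h1, h2, if_false]
            rw [if_pos (by omega)]; omega
          omega
        · omega
  · intro k
    refine tail1 _ ?_
    rw [SymSeq.tail_apply, SymSeq.restrict_digit]
    split_ifs <;> omega
  · rw [Finset.sum_pair (by omega)]
    have := sum_word_pos hl0 hsq hr n
    simp only [hs, Finset.sum_map, Nat.castEmbedding_apply, Int.toNat_natCast]
    rw [Finset.sum_congr rfl fun i hi => by
      simp only [hW]; rw [if_pos (by rw [Finset.mem_range] at hi; omega)], this]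
    simp

/-- A member of an arithmetic coding is admissible or vanishes from some position on. -/
lemma IsArithmeticCoding.admissible_or_zero (h : UnitCase (lam M) (conjLam M) r c b d)
    (hX : IsArithmeticCoding M φ X) {t : Fin 2 → ℝ}
    (ht : ∀ e, HasCodingSum (lam M) t e.digit (φ e)) {e : SymSeq (lam M)} (he : e ∈ X) :
    Admissible d e.digit ∨ ∃ K, ∀ n, K < n → e.digit n = 0 := by
  by_contra hcon
  push Not at hcon
  obtain ⟨hna, hnz⟩ := hcon
  unfold Admissible at hna
  push Not at hna
  obtain ⟨N, n, hpre, hgt⟩ := hna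
  have nz : ∀ (N : ℤ) (n : ℕ), ¬ ∀ i, n < i → e.tail N i = 0 := by
    intro N n hz
    obtain ⟨k, hk, hk'⟩ := hnz (N + n)
    apply hk'
    have := hz (k - N).toNat (by omega)
    rwa [SymSeq.tail_apply, Int.toNat_of_nonneg (by omega), add_sub_cancel] at this
  cases h with
  | neg h1 h2 h3 h4 =>
    -- A violation at an even place is a digit above `r`; at an odd place it is a positive digit
    -- preceded by `r`. Either one puts the forbidden word below the tail unless zeros follow.
    rcases Nat.even_or_odd n with hn | hn
    · refine not_lexLT_neg h1 h2 h3 hX ht he (N + n) ⟨0, by simp, ?_⟩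
      simp [hn] at hgt
      simpa [SymSeq.tail_apply] using hgt
    · obtain ⟨m, rfl⟩ := hn
      have hp := hpre (2 * m) (by omega)
      simp at hp hgt
      have hor := lexLT_or_zero (w := fun i => if i = 0 then r else if i = 1 then 1 else 0)
        (c := e.tail (N + 2 * m)) (n := 1) (fun i hi => by
          have : i = 0 := by omega
          subst this
          simpa [SymSeq.tail_apply] using hp.symm) (by
          simp only [SymSeq.tail_apply, Nat.cast_one, add_assoc, one_ne_zero, if_false, if_true]
          omega) (fun i hi => by
          split_ifs <;> omega)
      rcases hor with hlt | hz
      · exact not_lexLT_neg h1 h2 h3 hX ht he _ hlt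
      · exact nz _ _ hz
  | pos h1 h2 h3 h4 =>
    beta_reduce at hpre hgt
    have hor := lexLT_or_zero (w := fun i => if i ≤ n then r - 2 + (if i = 0 then 1 else 0)
      + (if i = n then 1 else 0) else 0) (c := e.tail N) (n := n) (fun i hi => by
        rw [SymSeq.tail_apply, hpre i hi, if_pos hi.le, if_neg hi.ne]
        split_ifs <;> omega) (by
        rw [SymSeq.tail_apply]
        simp only [le_refl, if_true]
        split_ifs at hgt ⊢ <;> omega) (fun i hi => by
        simp; omega)
    rcases hor with hlt | hz
    · exact not_lexLT_pos h1 h2 h3 hX ht he _ n hlt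
    · exact nz _ _ hz

end Structure

/-! ### Expansions containing long prefixes of the critical sequence -/

/-- The admissible sequences whose expansion to the right avoids the first `j` critical digits. -/
def avoidingValues (l : ℝ) (d : ℕ → ℕ) (j : ℕ) : Set ℝ :=
  {a | ∃ e, Admissible d e ∧ future l e 0 = a ∧ ¬ ∃ N : ℤ, ∀ i < j, e (N + i) = d i}

/-- The digits of `e` at `1, …, n`, two zeros, and `j` critical digits. -/
def splice (d : ℕ → ℕ) (e : ℤ → ℕ) (n j : ℕ) (k : ℤ) : ℕ :=
  if 1 ≤ k ∧ k ≤ n then e k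
  else if n + 3 ≤ k ∧ k < n + 3 + j then d (k - (n + 3)).toNat else 0

namespace UnitCase

variable {l l' : ℝ} {r : ℕ} {c b : ℝ} {d : ℕ → ℕ} {e : ℤ → ℕ}

/-- A match with `d` starts at a nonzero digit and cannot cross the two separating zeros. Within one
block the bound is the admissibility of `e` or of `d` itself. -/
lemma admissible_splice (h : UnitCase l l' r c b d) (he : Admissible d e) (n j : ℕ) :
    Admissible d (splice d e n j) := by
  have hd0 := h.crit_zero_pos
  intro N m hpre
  have first : 0 < m → splice d e n j N ≠ 0 := fun hm h0 => by
    have := hpre 0 hm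
    simp at this; omega
  by_cases hA : 1 ≤ N + m ∧ N + m ≤ n
  · have hN : 1 ≤ N := by
      by_contra hN
      exact first (by omega) (by rw [splice, if_neg (by omega), if_neg (by omega)])
    rw [splice, if_pos hA]
    refine he N m fun i hi => ?_
    rw [← hpre i hi, splice, if_pos (by omega)]
  · by_cases hB : n + 3 ≤ N + m ∧ N + m < n + 3 + j
    · rw [splice, if_neg hA, if_pos hB]
      rcases lt_or_ge N (n + 3) with hN | hN
      · exfalso
        rcases lt_or_ge N (n + 1) with hN' | hN'
        · have h1 := hpre (n + 1 - N).toNat (by omega)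
          have h2 := hpre ((n + 1 - N).toNat + 1) (by omega)
          rw [splice, if_neg (by omega), if_neg (by omega)] at h1 h2
          rcases h.crit_two (n + 1 - N).toNat with h3 | h3 <;> omega
        · exact first (by omega) (by rw [splice, if_neg (by omega), if_neg (by omega)])
      · have := h.crit_admissible (N - (n + 3)).toNat m fun i hi => by
          have := hpre i hi
          rw [splice, if_neg (by omega), if_pos (by omega)] at this
          rw [← this]; congr 1; omega
        convert this using 2
        omega
    · rw [splice, if_neg hA, if_neg hB]
      exact Nat.zero_le _

lemma splice_eq_zero (n j : ℕ) (k : ℤ) (hk : ((n + 3 + j : ℕ) : ℤ) < k) : splice d e n j k = 0 := by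
  rw [splice, if_neg (by omega), if_neg (by omega)]

lemma future_sub_future (h : UnitCase l l' r c b d) {e' : ℤ → ℕ} (he : Admissible d e)
    (he' : Admissible d e') {n : ℕ} (hee : ∀ k : ℤ, 1 ≤ k → k ≤ n → e k = e' k) :
    future l e n - future l e' n = (future l e 0 - future l e' 0) * l ^ n := by
  induction n with
  | zero => simp
  | succ n ih =>
    push_cast
    rw [h.future_step he, h.future_step he', hee _ (by omega) (by push_cast; omega), pow_succ]
    linear_combination l * ih fun k hk hk' => hee k hk (by push_cast; omega)

/-- Every interval contains a subinterval free of avoiding values. -/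
lemma exists_Ioo_disjoint_avoidingValues (h : UnitCase l l' r c b d) (j : ℕ) {p q : ℝ}
    (hpq : p < q) : ∃ p' q', p ≤ p' ∧ p' < q' ∧ q' ≤ q ∧
      Disjoint (Set.Ioo p' q') (avoidingValues l d j) := by
  by_cases hne : Disjoint (Set.Ioo p q) (avoidingValues l d j)
  · exact ⟨p, q, le_rfl, hpq, le_rfl, hne⟩
  obtain ⟨_, ⟨hp, hq⟩, e, he, rfl, -⟩ := Set.not_disjoint_iff.1 hne
  have hl := h.one_lt
  have hl0 : 0 < l := by linarith
  obtain ⟨n, hn⟩ := pow_unbounded_of_one_lt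
    (1 / min (future l e 0 - p) (q - future l e 0)) hl
  have hmin : 0 < min (future l e 0 - p) (q - future l e 0) :=
    lt_min (by linarith) (by linarith)
  rw [div_lt_iff₀ hmin] at hn
  -- `g` shares `n` digits with `e`, so its value stays inside the interval, and it already contains
  -- the required critical block.
  set g := splice d e n j with hg
  have hga : Admissible d g := h.admissible_splice he n j
  have hdiff := h.future_sub_future he hga (n := n) fun k hk hk' => by
    rw [hg, splice, if_pos ⟨hk, hk'⟩]
  have hpow : 0 < l ^ n := by positivity
  have hclose : |future l e 0 - future l g 0| < min (future l e 0 - p) (q - future l e 0) := by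
    have h1 : |future l e n - future l g n| ≤ 1 := by
      have := h.future_mem he n
      have := h.future_mem hga n
      rw [abs_le]; constructor <;> linarith
    rw [hdiff, abs_mul, abs_of_pos hpow] at h1
    by_contra hcon
    push Not at hcon
    nlinarith
  obtain ⟨hc1, hc2⟩ := lt_min_iff.1 hclose
  have hgp : p < future l g 0 := by have := (abs_lt.1 hc1).2; linarith
  have hgq : future l g 0 < q := by have := (abs_lt.1 hc2).1; linarith
  have hlt := h.future_lt_one hga (splice_eq_zero n j)
  -- A right neighbourhood so small that an error `η`, expanded through all positions of the block,
  -- never carries the orbit up to `1`. Hence values there have the same digits as `g` through the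
  -- block, as `key` shows.
  have hη : ∀ᶠ η : ℝ in 𝓝[>] 0, (∀ i ∈ Finset.range (n + 3 + j + 1),
      future l g i + l ^ i * η < 1) ∧ future l g 0 + η < q := by
    refine nhdsWithin_le_nhds (Filter.Eventually.and ?_ ?_)
    · rw [Filter.eventually_all_finset]
      intro i _
      have : ContinuousAt (fun η : ℝ => future l g i + l ^ i * η) 0 := by fun_prop
      exact this.eventually_lt continuousAt_const (by simpa using hlt i)
    · have : ContinuousAt (fun η : ℝ => future l g 0 + η) 0 := by fun_prop
      exact this.eventually_lt continuousAt_const (by simpa using hgq)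
  obtain ⟨η, ⟨h1, h2⟩, h0⟩ := (hη.and self_mem_nhdsWithin).exists
  refine ⟨future l g 0, future l g 0 + η, hgp.le, by linarith, h2.le, ?_⟩
  rw [Set.disjoint_left]
  rintro _ ⟨ha, hb⟩ ⟨e', he', rfl, hno⟩
  have key : ∀ i : ℕ, i ≤ n + 3 + j → ∀ k : ℤ, 1 ≤ k → k ≤ i → e' k = g k := by
    intro i
    induction i with
    | zero => intro _ k hk hk'; push_cast at hk'; omega
    | succ i ih =>
      intro hi k hk hk'
      have ih' := ih (by omega)
      rcases (show k ≤ i ∨ k = i + 1 by push_cast at hk'; omega) with hki | rfl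
      · exact ih' k hk hki
      · have d1 := h.future_sub_future he' hga ih'
        have s1 := h.future_step he' i
        have s2 := h.future_step hga i
        have m1 := h.future_mem he' (i + 1)
        have m2 := h.future_mem hga (i + 1)
        have l1 := h1 (i + 1) (Finset.mem_range.2 (by omega))
        push_cast at l1
        rw [pow_succ] at l1
        have hpi : 0 < l ^ i := by positivity
        have b1 : 0 < (future l e' 0 - future l g 0) * l ^ i := mul_pos (by linarith) hpi
        have b2 : (future l e' 0 - future l g 0) * l ^ i * l < l ^ i * l * η := by
          have : future l e' 0 - future l g 0 < η := by linarith
          have hpl : 0 < l ^ i * l := by positivity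
          nlinarith
        have c1 : (e' (i + 1) : ℝ) < g (i + 1) + 1 := by nlinarith
        have c2 : (g (i + 1) : ℝ) < e' (i + 1) + 1 := by nlinarith
        have c1' : e' (i + 1) < g (i + 1) + 1 := by exact_mod_cast c1
        have c2' : g (i + 1) < e' (i + 1) + 1 := by exact_mod_cast c2
        omega
  refine hno ⟨n + 3, fun i hi => ?_⟩
  rw [key (n + 3 + j) le_rfl _ (by omega) (by push_cast; omega), hg, splice, if_neg (by omega),
    if_pos (by omega)]
  congr 1; omega

/-- Some real number has all its translates by a countable set outside the avoiding values. -/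
lemma exists_not_mem_avoidingValues (h : UnitCase l l' r c b d) {F : Set ℝ} (hF : F.Countable) :
    ∃ x : ℝ, ∀ q ∈ F, x + q ≠ 0 ∧ ∀ j, x + q ∉ avoidingValues l d j := by
  have hdense : ∀ j, Dense (interior (avoidingValues l d j)ᶜ) := by
    intro j
    rw [dense_iff_exists_between]
    intro p q hpq
    obtain ⟨p', q', h1, h2, h3, h4⟩ := h.exists_Ioo_disjoint_avoidingValues j hpq
    obtain ⟨x, hx⟩ := exists_between h2
    refine ⟨x, ?_, by linarith [hx.1], by linarith [hx.2]⟩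
    exact mem_interior.2 ⟨Set.Ioo p' q', h4.subset_compl_right, isOpen_Ioo, hx⟩
  -- Baire category: every avoiding set is nowhere dense, and only countably many translates and
  -- lengths occur.
  have hres : ∀ᶠ x in residual ℝ, ∀ q ∈ F, ∀ j : ℕ, x + q ≠ 0 ∧ x + q ∉ avoidingValues l d j := by
    rw [eventually_countable_ball hF]
    intro q _
    rw [eventually_countable_forall]
    intro j
    have h1 : IsOpen ((fun x : ℝ => x + q) ⁻¹' (interior (avoidingValues l d j)ᶜ ∩ {0}ᶜ)) :=
      (isOpen_interior.inter isOpen_compl_singleton).preimage (by fun_prop)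
    have h2 : Dense ((fun x : ℝ => x + q) ⁻¹' (interior (avoidingValues l d j)ᶜ ∩ {0}ᶜ)) := by
      refine Dense.preimage ?_ (Homeomorph.addRight q).isOpenMap
      exact (hdense j).inter_of_isOpen_left (dense_compl_singleton 0) isOpen_interior
    filter_upwards [residual_of_dense_open h1 h2] with x hx
    exact ⟨hx.2, interior_subset hx.1⟩
  obtain ⟨x, hx⟩ := (dense_of_mem_residual hres).nonempty
  exact ⟨x, fun q hq => ⟨(hx q hq 0).1, fun j => (hx q hq j).2⟩⟩

end UnitCase

/-! ### Every coding contains the admissible sequences -/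

section Structure

variable {M : GL (Fin 2) ℤ} {φ : SymSeq (lam M) →ₙ+ UnitAddTorus (Fin 2)}
  {X : Set (SymSeq (lam M))} {r : ℕ} {c b : ℝ} {d : ℕ → ℕ}

lemma future_mem_eigenField {e : ℤ → ℕ} {K : ℤ} (hK : ∀ n, K < n → e n = 0) :
    future (lam M) e 0 ∈ eigenField M := by
  have : future (lam M) e 0
      = ∑ k ∈ Finset.range K.toNat, (e (0 + 1 + k) : ℝ) / lam M ^ (k + 1) := by
    refine tsum_eq_sum fun k hk => ?_
    rw [hK _ (by simp at hk; omega)]; simp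
  rw [this]
  exact sum_mem fun k _ => div_mem (natCast_mem _ _) (pow_mem lam_mem _)

lemma future_sub_xCoord_mem (hD : 0 < disc M) {z : Fin 2 → ℤ} (hz : orbitDet M z ≠ 0)
    {e : ℤ → ℕ} {v : Fin 2 → ℝ} (hv : toTorus (planePoint M z e) = toTorus v) :
    ∃ q ∈ eigenField M, future (lam M) e 0 = xCoord M z v + q := by
  obtain ⟨k, hk⟩ := toTorus_eq_iff.1 hv
  refine ⟨_, (coord_intVec_mem z k).1, ?_⟩
  rw [← map_add, ← hk]
  exact (coord_unique hD hz _ _).1.symm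

/-- Cutting off only creates zeros, and as `d 0` is positive no match with `d` can begin at one. -/
lemma admissible_restrict (h : UnitCase (lam M) (conjLam M) r c b d) {e : ℤ → ℕ}
    (he : Admissible d e) (N : ℕ) :
    SymSeq.restrict h.one_lt (Finset.Icc (-(N : ℤ)) N) e ∈ admissibleSet (lam M) d := by
  have hd0 := h.crit_zero_pos
  intro k m hpre
  simp only [SymSeq.restrict_digit] at hpre ⊢
  split_ifs with hP
  · rw [Finset.mem_Icc] at hP
    have hk : -(N : ℤ) ≤ k := by
      by_contra hk
      have := hpre 0 (by omega)
      rw [if_neg (by rw [Finset.mem_Icc]; omega)] at this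
      omega
    refine he k m fun i hi => ?_
    have := hpre i hi
    rwa [if_pos (by rw [Finset.mem_Icc]; omega)] at this
  · exact Nat.zero_le _

/-- Every arithmetic coding contains all admissible sequences. -/
lemma IsArithmeticCoding.admissibleSet_subset (hD : 0 < disc M)
    (h : UnitCase (lam M) (conjLam M) r c b d) (hX : IsArithmeticCoding M φ X)
    {z : Fin 2 → ℤ} (hz : orbitDet M z ≠ 0) (hφ : ∀ e, φ e = toTorus (planePoint M z e.digit))
    (ht : ∀ e, HasCodingSum (lam M) (uPart M (intVec z)) e.digit (φ e)) :
    admissibleSet (lam M) d ⊆ X := by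
  have hd0 := h.crit_zero_pos
  -- Any preimage of this point has its real value in `x` plus the eigenvalue field. It therefore
  -- cannot end in zeros, and it contains arbitrarily long prefixes of `d`.
  obtain ⟨x, hx⟩ := h.exists_not_mem_avoidingValues (countable_eigenField (M := M))
  obtain ⟨e, he, hev⟩ := hX.surjective (toTorus (x • uPart M (intVec z)))
  rw [hφ] at hev
  obtain ⟨q, hq, hfq⟩ := future_sub_xCoord_mem hD hz hev
  have hxc : xCoord M z (x • uPart M (intVec z)) = x := by
    have := (coord_unique hD hz x 0).1
    rwa [zero_smul, sub_zero] at this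
  rw [hxc] at hfq
  have hadm : Admissible d e.digit := by
    rcases hX.admissible_or_zero h ht he with hadm | ⟨K, hK⟩
    · exact hadm
    · exfalso
      have h1 := future_mem_eigenField (M := M) hK
      have h2 := (hx _ (sub_mem hq h1)).1
      rw [hfq] at h2
      exact h2 (by ring)
  have hlong : ∀ j : ℕ, ∃ N : ℤ, ∀ i < j, e.digit (N + i) = d i := by
    intro j
    by_contra hno
    exact (hx q hq).2 j ⟨e.digit, hadm, hfq, hno⟩
  have hfin : ∀ g ∈ admissibleSet (lam M) d, g.IsFinite → g ∈ X := by
    intro g hg hgf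
    obtain ⟨K, hK⟩ := hgf.exists_bound
    have hK' : ∀ n : ℤ, (n < -K ∨ K < n) → g.digit n = 0 := by
      intro n hn
      by_contra h0
      have := abs_le.1 (hK n h0)
      omega
    obtain ⟨N, hN⟩ := hlong (2 * K + 3)
    refine hX.total e he N g fun k => ?_
    -- Within `2 * K + 3` places each tail of `g` leaves `d`: it starts with a zero, or it meets the
    -- two zeros beyond `K`. At the first departure admissibility makes it smaller, so it lies below
    -- a tail of `e` with a long critical prefix.
    have hex : ∃ i, i < 2 * K + 3 ∧ g.digit (k + i) ≠ d i := by
      by_contra hcon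
      push Not at hcon
      rcases lt_or_ge k (-K) with hk | hk
      · have := hcon 0 (by omega)
        rw [hK' _ (by omega)] at this
        omega
      · have h1 := hcon (2 * K + 1) (by omega)
        have h2 := hcon (2 * K + 1 + 1) (by omega)
        rw [hK' _ (by push_cast; omega)] at h1 h2
        rcases h.crit_two (2 * K + 1) with h3 | h3 <;> omega
    classical
    obtain ⟨hlt, hne⟩ := Nat.find_spec hex
    have hpre : ∀ i < Nat.find hex, g.digit (k + i) = d i := fun i hi => by
      have := Nat.find_min hex hi
      push Not at this
      exact this (by omega)
    refine ⟨Nat.find hex, fun i hi => ?_, ?_⟩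
    · rw [SymSeq.tail_apply, SymSeq.tail_apply, hpre i hi, hN i (by omega)]
    · rw [SymSeq.tail_apply, SymSeq.tail_apply, hN _ hlt]
      exact lt_of_le_of_ne (hg k _ hpre) hne
  intro g hg
  refine hX.closed.mem_of_tendsto (SymSeq.tendsto_restrict h.one_lt g)
    (Eventually.of_forall fun N => ?_)
  exact hfin _ (admissible_restrict h hg N) (SymSeq.isFinite_restrict _ _ _)

/-- The number of preimages of an arithmetic coding is `|det (z, M z)|`. -/
lemma IsArithmeticCoding.eq_natAbs (hD : 0 < disc M)
    (h : UnitCase (lam M) (conjLam M) r c b d) (hX : IsArithmeticCoding M φ X)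
    {z : Fin 2 → ℤ} (hz : orbitDet M z ≠ 0) (hφ : ∀ e, φ e = toTorus (planePoint M z e.digit))
    (ht : ∀ e, HasCodingSum (lam M) (uPart M (intVec z)) e.digit (φ e)) {K : ℕ}
    (hK : IsToOneAE φ X K) : K = (orbitDet M z).natAbs := by
  have hsub := hX.admissibleSet_subset hD h hz hφ ht
  have hl : 0 < lam M := by linarith [h.one_lt]
  obtain ⟨x, hx1, v, rfl, hv⟩ := (hK.and (ae_isGeneric hD hz)).exists
  -- Over a generic point the members ending in zeros do not occur, so the fibre in `X` is the
  -- admissible fibre.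
  have heq : {e | e ∈ X ∧ φ e = toTorus v}
      = {e | e ∈ admissibleSet (lam M) d ∧ codingMap hD hl z e = toTorus v} := by
    ext e
    simp only [Set.mem_ofPred_eq, hφ, codingMap_apply]
    refine ⟨fun he => ⟨?_, he.2⟩, fun he => ⟨hsub he.1, he.2⟩⟩
    rcases hX.admissible_or_zero h ht he.1 with hadm | ⟨L, hL⟩
    · exact hadm
    · exfalso
      obtain ⟨q, hq, hfq⟩ := future_sub_xCoord_mem hD hz he.2
      have := future_mem_eigenField (M := M) hL
      rw [hfq] at this
      exact hv.1 ((add_mem_cancel_right hq).1 this)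
  rw [heq, encard_preimages h hD hl hz hv] at hx1
  exact_mod_cast hx1.symm

end Structure

/-! ### The minimum as a minimum of the form -/

section Minimum

variable {M : GL (Fin 2) ℤ}

/-- The possible numbers of preimages are the nonzero values of `|f_T|`. -/
lemma codingDegrees_eq (hyp : IsHyperbolic M) (htr : 0 < tr M) :
    {K : ℕ | ∃ φ X, IsArithmeticCoding M φ X ∧ IsToOneAE φ X K}
      = {K | ∃ z : Fin 2 → ℤ, z ≠ 0 ∧ K = (orbitDet M z).natAbs} := by
  have hD := disc_pos hyp htr
  obtain ⟨r, c, b, d, h, -⟩ := exists_unitCase hyp htr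
  have hl : 0 < lam M := by linarith [h.one_lt]
  ext K
  constructor
  · rintro ⟨φ, X, hX, hK⟩
    obtain ⟨z, hz, hφ, ht⟩ := hX.exists_vector hD h.one_lt
    exact ⟨z, hz, hX.eq_natAbs hD h (orbitDet_ne_zero hyp htr hz) hφ ht hK⟩
  · rintro ⟨z, hz, rfl⟩
    have hz' := orbitDet_ne_zero hyp htr hz
    exact ⟨_, _, isArithmeticCoding_codingMap hyp htr hD hl h hz', isToOneAE_codingMap hD hl h hz'⟩

lemma minPreimages_mem (hyp : IsHyperbolic M) (htr : 0 < tr M) :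
    ∃ z : Fin 2 → ℤ, z ≠ 0 ∧ minPreimages M = (orbitDet M z).natAbs := by
  have : minPreimages M ∈ {K : ℕ | ∃ φ X, IsArithmeticCoding M φ X ∧ IsToOneAE φ X K} := by
    refine Nat.sInf_mem ?_
    rw [codingDegrees_eq hyp htr]
    exact ⟨_, ![1, 0], by simp, rfl⟩
  rwa [codingDegrees_eq hyp htr] at this

lemma minPreimages_le (hyp : IsHyperbolic M) (htr : 0 < tr M) {z : Fin 2 → ℤ} (hz : z ≠ 0) :
    minPreimages M ≤ (orbitDet M z).natAbs := by
  refine Nat.sInf_le ?_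
  rw [codingDegrees_eq hyp htr]
  exact ⟨z, hz, rfl⟩

lemma minPreimages_pos (hyp : IsHyperbolic M) (htr : 0 < tr M) : 0 < minPreimages M := by
  obtain ⟨z, hz, hm⟩ := minPreimages_mem hyp htr
  rw [hm]
  exact Int.natAbs_pos.2 (orbitDet_ne_zero hyp htr hz)

end Minimum

/-! ### The units commuting with a primitive matrix -/

section Commutant

variable {M : GL (Fin 2) ℤ}

lemma intVec_eq_zero_of_eigen (hyp : IsHyperbolic M) (htr : 0 < tr M) {w : Fin 2 → ℤ} {a : ℝ}
    (hw : (realMat M).mulVec (intVec w) = a • intVec w) : w = 0 := by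
  by_contra h0
  apply orbitDet_ne_zero hyp htr h0
  rw [mulVec_intVec] at hw
  have a0 := congrFun hw 0
  have a1 := congrFun hw 1
  simp only [intVec, Pi.smul_apply, smul_eq_mul] at a0 a1
  have : (orbitDet M w : ℝ) = 0 := by
    unfold orbitDet; push_cast; rw [a0, a1]; ring
  exact_mod_cast this

variable (M) in
/-- The image of the first basis vector on the expanding line. -/
noncomputable def expandingVec : Fin 2 → ℝ := uPart M (intVec ![1, 0])

lemma orbitDet_basis_ne_zero (hyp : IsHyperbolic M) (htr : 0 < tr M) :
    orbitDet M ![1, 0] ≠ 0 := orbitDet_ne_zero hyp htr (by simp)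

lemma expandingVec_ne_zero (hyp : IsHyperbolic M) (htr : 0 < tr M) : expandingVec M ≠ 0 := by
  intro h
  have := (coord_unique (disc_pos hyp htr) (orbitDet_basis_ne_zero hyp htr) 1 0).1
  rw [one_smul, zero_smul, sub_zero, ← expandingVec, h, map_zero] at this
  exact zero_ne_one this

lemma mulVec_expandingVec (hD : 0 < disc M) :
    (realMat M).mulVec (expandingVec M) = lam M • expandingVec M := mulVec_uPart hD _

lemma exists_smul_expandingVec (hyp : IsHyperbolic M) (htr : 0 < tr M) (v : Fin 2 → ℝ) :
    ∃ a : ℝ, uPart M v = a • expandingVec M := by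
  have hD := disc_pos hyp htr
  refine ⟨xCoord M ![1, 0] v, ?_⟩
  conv_lhs => rw [coord_expansion hD (orbitDet_basis_ne_zero hyp htr) v, sub_eq_add_neg, ← neg_smul]
  exact (parts_unique hD).1

lemma realMat_comm {V : GL (Fin 2) ℤ} (hV : Commute V M) (v : Fin 2 → ℝ) :
    (realMat M).mulVec ((realMat V).mulVec v) = (realMat V).mulVec ((realMat M).mulVec v) := by
  rw [Matrix.mulVec_mulVec, Matrix.mulVec_mulVec, ← realMat_mul, ← realMat_mul, hV.eq]

lemma exists_eigenvalue (hyp : IsHyperbolic M) (htr : 0 < tr M) {V : GL (Fin 2) ℤ}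
    (hV : Commute V M) :
    ∃ a : ℝ, a ≠ 0 ∧ (realMat V).mulVec (expandingVec M) = a • expandingVec M := by
  have hD := disc_pos hyp htr
  have h1 : uPart M ((realMat V).mulVec (expandingVec M))
      = (realMat V).mulVec (expandingVec M) := by
    rw [uPart, realMat_comm hV, mulVec_expandingVec hD, Matrix.mulVec_smul, ← sub_smul,
      lam_sub_conjLam, inv_smul_smul₀ (sqrt_disc_ne hD)]
  obtain ⟨a, ha⟩ := exists_smul_expandingVec hyp htr ((realMat V).mulVec (expandingVec M))
  rw [h1] at ha
  refine ⟨a, ?_, ha⟩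
  rintro rfl
  apply expandingVec_ne_zero hyp htr
  rw [zero_smul] at ha
  have := congrArg (realMat V⁻¹).mulVec ha
  rwa [Matrix.mulVec_mulVec, ← realMat_mul, inv_mul_cancel, realMat_one, Matrix.one_mulVec,
    Matrix.mulVec_zero] at this

/-- A matrix commuting with `M` is determined by its eigenvalue on the expanding line. -/
lemma eq_of_eigenvalue_eq (hyp : IsHyperbolic M) (htr : 0 < tr M) {V W : GL (Fin 2) ℤ}
    (hV : Commute V M) (hW : Commute W M) {a : ℝ}
    (eV : (realMat V).mulVec (expandingVec M) = a • expandingVec M)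
    (eW : (realMat W).mulVec (expandingVec M) = a • expandingVec M) : V = W := by
  have hD := disc_pos hyp htr
  have key : ∀ w : Fin 2 → ℤ, V.1.mulVec w = W.1.mulVec w := by
    intro w
    rw [← sub_eq_zero]
    -- The difference of the two images has no expanding part, and the contracting line contains no
    -- nonzero integer vector.
    refine intVec_eq_zero_of_eigen hyp htr (a := conjLam M) ?_
    obtain ⟨x, hx⟩ := exists_smul_expandingVec hyp htr (intVec w)
    have h1 : intVec (V.1.mulVec w - W.1.mulVec w)
        = (realMat V).mulVec (sPart M (intVec w)) - (realMat W).mulVec (sPart M (intVec w)) := by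
      rw [intVec_sub, ← mulVec_intVec, ← mulVec_intVec, ← uPart_add_sPart hD (intVec w),
        Matrix.mulVec_add, Matrix.mulVec_add, uPart_add_sPart hD, hx, Matrix.mulVec_smul,
        Matrix.mulVec_smul, eV, eW]
      abel
    rw [h1, Matrix.mulVec_sub, realMat_comm hV, realMat_comm hW, mulVec_sPart hD,
      Matrix.mulVec_smul, Matrix.mulVec_smul, smul_sub]
  apply Units.ext
  exact Matrix.ext_of_mulVec_single fun i => key _

/-- On (1, 3/2) neither a + 1/a, which lies strictly between 2 and 3, nor a - 1/a, strictly between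
0 and 1, is an integer. This gap makes `logEigenvalues` discrete. -/
lemma eigenvalue_not_mem_Ioo (hyp : IsHyperbolic M) (htr : 0 < tr M) {V : GL (Fin 2) ℤ} {a : ℝ}
    (eV : (realMat V).mulVec (expandingVec M) = a • expandingVec M) (h1 : 1 < a)
    (h2 : a < 3 / 2) : False := by
  have hq : a ^ 2 - tr V * a + dt V = 0 := by
    have h := mulVec_mulVec_self (M := V) (expandingVec M)
    rw [eV, Matrix.mulVec_smul, eV] at h
    have h3 : (a ^ 2 - tr V * a + dt V) • expandingVec M = 0 := by
      have : (a ^ 2 - tr V * a + dt V) • expandingVec M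
          = a • a • expandingVec M - ((tr V : ℝ) • a • expandingVec M - (dt V : ℝ) • expandingVec M) := by
        module
      rw [this, h, sub_self]
    exact (smul_eq_zero.1 h3).resolve_right (expandingVec_ne_zero hyp htr)
  rcases dt_cases V with h | h
  · rw [h] at hq
    push_cast at hq
    have l1 : (2 : ℝ) < tr V := by nlinarith
    have l2 : (tr V : ℝ) < 3 := by nlinarith
    have l1' : 2 < tr V := by exact_mod_cast l1
    have l2' : tr V < 3 := by exact_mod_cast l2
    omega
  · rw [h] at hq
    push_cast at hq
    have l1 : (0 : ℝ) < tr V := by nlinarith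
    have l2 : (tr V : ℝ) < 1 := by nlinarith
    have l1' : 0 < tr V := by exact_mod_cast l1
    have l2' : tr V < 1 := by exact_mod_cast l2
    omega

variable (M) in
/-- The logarithms of the positive eigenvalues of the matrices commuting with `M`. -/
noncomputable def logEigenvalues : AddSubgroup ℝ where
  carrier := {x | ∃ (V : GL (Fin 2) ℤ) (a : ℝ), Commute V M ∧ 0 < a ∧
    (realMat V).mulVec (expandingVec M) = a • expandingVec M ∧ x = Real.log a}
  zero_mem' := ⟨1, 1, Commute.one_left M, one_pos, by simp [realMat_one], by simp⟩
  add_mem' := by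
    rintro _ _ ⟨V, a, hV, ha, eV, rfl⟩ ⟨W, b, hW, hb, eW, rfl⟩
    refine ⟨V * W, a * b, hV.mul_left hW, by positivity, ?_, (Real.log_mul ha.ne' hb.ne').symm⟩
    rw [realMat_mul, ← Matrix.mulVec_mulVec, eW, Matrix.mulVec_smul, eV, smul_smul, mul_comm]
  neg_mem' := by
    rintro _ ⟨V, a, hV, ha, eV, rfl⟩
    refine ⟨V⁻¹, a⁻¹, hV.inv_left, by positivity, ?_, (Real.log_inv a).symm⟩
    have := zpow_mulVec_of_eigen ha.ne' eV (-1)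
    simpa using this

/-- If `M` is primitive, the units commuting with `M` are `± M ^ n`. -/
lemma commutant_of_isPrimitive (hyp : IsHyperbolic M) (htr : 0 < tr M) (hprim : IsPrimitive M)
    {V : GL (Fin 2) ℤ} (hV : Commute V M) : ∃ n : ℤ, V = M ^ n ∨ V = -M ^ n := by
  have hD := disc_pos hyp htr
  obtain ⟨r, c, b, d, h, -⟩ := exists_unitCase hyp htr
  have hl := h.one_lt
  have hl0 : 0 < lam M := by linarith
  have hdisj : Disjoint (logEigenvalues M : Set ℝ) (Set.Ioo 0 (Real.log (3 / 2))) := by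
    rw [Set.disjoint_left]
    rintro _ ⟨W, a, hW, ha, eW, rfl⟩ ⟨h0, h1⟩
    exact eigenvalue_not_mem_Ioo hyp htr eW ((Real.log_pos_iff ha.le).1 h0)
      ((Real.log_lt_log_iff ha (by norm_num)).1 h1)
  obtain ⟨g, hg⟩ := AddSubgroup.cyclic_of_isolated_zero (Real.log_pos (by norm_num)) hdisj
  have hgmem : g ∈ logEigenvalues M := by rw [hg]; exact AddSubgroup.mem_closure_singleton_self g
  obtain ⟨W, a, hW, ha, eW, rfl⟩ := hgmem
  have hMmem : Real.log (lam M) ∈ logEigenvalues M :=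
    ⟨M, lam M, Commute.refl M, hl0, mulVec_expandingVec hD, rfl⟩
  rw [hg, AddSubgroup.mem_closure_singleton] at hMmem
  obtain ⟨k, hk⟩ := hMmem
  rw [zsmul_eq_mul, ← Real.log_zpow] at hk
  have hk' : a ^ k = lam M := Real.log_injOn_pos (zpow_pos ha k) hl0 hk
  have hMW : M = W ^ k := eq_of_eigenvalue_eq hyp htr (Commute.refl M) (hW.zpow_left k)
    (mulVec_expandingVec hD) (by rw [zpow_mulVec_of_eigen ha.ne' eW, hk'])
  -- A discrete group of logarithms is cyclic, so `M` is a power of the matrix realising the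
  -- generator; primitivity leaves only the exponents ±1.
  have hk1 : k = 1 ∨ k = -1 := by
    by_contra hcon
    push Not at hcon
    have hk0 : k ≠ 0 := by rintro rfl; simp at hk'; linarith
    rcases lt_or_ge k 0 with hneg | hpos
    · refine hprim ⟨W⁻¹, k.natAbs, by omega, ?_⟩
      rw [hMW, ← zpow_natCast, inv_zpow']
      congr 1; omega
    · refine hprim ⟨W, k.natAbs, by omega, ?_⟩
      rw [hMW, ← zpow_natCast]
      congr 1; omega
  have hWM : ∃ j : ℤ, W = M ^ j := by
    rcases hk1 with rfl | rfl
    · exact ⟨1, by rw [hMW]; simp⟩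
    · exact ⟨-1, by rw [hMW]; simp⟩
  obtain ⟨j, hj⟩ := hWM
  have pos : ∀ (V : GL (Fin 2) ℤ) (x : ℝ), Commute V M → 0 < x →
      (realMat V).mulVec (expandingVec M) = x • expandingVec M → ∃ n : ℤ, V = M ^ n := by
    intro V x hV hx eV
    have hmem : Real.log x ∈ logEigenvalues M := ⟨V, x, hV, hx, eV, rfl⟩
    rw [hg, AddSubgroup.mem_closure_singleton] at hmem
    obtain ⟨i, hi⟩ := hmem
    rw [zsmul_eq_mul, ← Real.log_zpow] at hi
    have hi' : a ^ i = x := Real.log_injOn_pos (zpow_pos ha i) hx hi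
    refine ⟨j * i, ?_⟩
    rw [zpow_mul, ← hj]
    exact eq_of_eigenvalue_eq hyp htr hV (hW.zpow_left i) eV
      (by rw [zpow_mulVec_of_eigen ha.ne' eW, hi'])
  obtain ⟨x, hx0, hx⟩ := exists_eigenvalue hyp htr hV
  -- A negative eigenvalue is made positive by passing to `-V`; this is the source of the sign.
  rcases hx0.lt_or_gt with hx0 | hx0
  · obtain ⟨n, hn⟩ := pos (-V) (-x) hV.neg_left (by linarith) (by
      have : realMat (-V) = -realMat V := by ext i j; simp [realMat]
      rw [this, Matrix.neg_mulVec, hx, neg_smul])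
    exact ⟨n, Or.inr (by rw [← hn, neg_neg])⟩
  · obtain ⟨n, hn⟩ := pos V x hV hx0 hx
    exact ⟨n, Or.inl hn⟩

end Commutant

/-! ### The associated form and the classes of its minimal vectors -/

section Forms

variable {M : GL (Fin 2) ℤ}

lemma exists_transpose (V : GL (Fin 2) ℤ) : ∃ W : GL (Fin 2) ℤ, W.1 = V.1.transpose :=
  ⟨Matrix.GeneralLinearGroup.mk'' V.1.transpose (by
    rw [Matrix.det_transpose]; exact V.isUnit.map Matrix.detMonoidHom), rfl⟩

lemma exists_of_det {a b c d : ℤ} (h : a * d - b * c = 1 ∨ a * d - b * c = -1) :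
    ∃ B : GL (Fin 2) ℤ, B.1 = !![a, b; c, d] :=
  ⟨Matrix.GeneralLinearGroup.mk'' !![a, b; c, d] (by
    rw [Matrix.det_fin_two_of]; exact Int.isUnit_iff.2 h), rfl⟩

lemma dt_mul (K L : GL (Fin 2) ℤ) : dt (K * L) = dt K * dt L := Matrix.det_mul _ _

lemma disc_eq : disc M = (M.1 0 0 - M.1 1 1) ^ 2 + 4 * (M.1 0 1 * M.1 1 0) := by
  rw [disc, tr_eq, dt_eq]; ring

/-- The matrices commuting with `M` act on the associated form through their determinants. -/
lemma assocForm_of_commute {V : GL (Fin 2) ℤ} (hV : Commute V M) (x y : ℤ) :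
    assocForm M (V.1 0 0 * x + V.1 1 0 * y) (V.1 0 1 * x + V.1 1 1 * y)
      = dt V * assocForm M x y := by
  have h := congrArg Units.val hV.eq
  rw [Units.val_mul, Units.val_mul] at h
  have e00 := congrFun (congrFun h 0) 0
  have e01 := congrFun (congrFun h 0) 1
  have e10 := congrFun (congrFun h 1) 0
  simp only [Matrix.mul_apply, Fin.sum_univ_two] at e00 e01 e10
  rw [dt_eq, assocForm, assocForm]
  linear_combination (V.1 0 0 * x ^ 2 + 2 * V.1 1 0 * x * y) * e01
    - (V.1 0 1 * x ^ 2 + 2 * V.1 1 1 * x * y + V.1 1 0 * y ^ 2) * e00 - V.1 1 1 * y ^ 2 * e10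

/-- Conversely, a change of variables which multiplies the associated form by its determinant is
the transpose of a matrix commuting with `M`. -/
lemma commute_of_assocForm {V : GL (Fin 2) ℤ}
    (h : ∀ x y, assocForm M (V.1 0 0 * x + V.1 1 0 * y) (V.1 0 1 * x + V.1 1 1 * y)
      = dt V * assocForm M x y) : Commute V M := by
  have E1 := h 1 0
  have E3 := h 0 1
  have E2 := h 1 1
  have hδ : V.1 0 0 * V.1 1 1 - V.1 0 1 * V.1 1 0 ≠ 0 := by
    rw [← dt_eq]; rcases dt_cases V with h | h <;> rw [h] <;> norm_num
  rw [dt_eq, assocForm, assocForm] at E1 E2 E3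
  -- Eliminating with the entries of `V` from the three coefficient identities leaves relations with
  -- the factor `2 * det V`. After cancellation these are the entries of the commutator.
  have F11 : M.1 0 1 * (V.1 0 0 - V.1 1 1) - (M.1 0 0 - M.1 1 1) * V.1 0 1 = 0 := by
    have : (V.1 0 0 * V.1 1 1 - V.1 0 1 * V.1 1 0) * 2 *
        (M.1 0 1 * (V.1 0 0 - V.1 1 1) - (M.1 0 0 - M.1 1 1) * V.1 0 1) = 0 := by
      linear_combination 2 * V.1 1 1 * E1 - V.1 0 1 * (E2 - E1 - E3)
    exact (mul_eq_zero.1 this).resolve_left (mul_ne_zero hδ two_ne_zero)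
  have F12 : M.1 0 1 * V.1 1 0 - M.1 1 0 * V.1 0 1 = 0 := by
    have : (V.1 0 0 * V.1 1 1 - V.1 0 1 * V.1 1 0) * 2 *
        (M.1 0 1 * V.1 1 0 - M.1 1 0 * V.1 0 1) = 0 := by
      linear_combination -2 * V.1 1 0 * E1 + V.1 0 0 * (E2 - E1 - E3)
    exact (mul_eq_zero.1 this).resolve_left (mul_ne_zero hδ two_ne_zero)
  have F22 : (M.1 0 0 - M.1 1 1) * V.1 1 0 + M.1 1 0 * (V.1 1 1 - V.1 0 0) = 0 := by
    have : (V.1 0 0 * V.1 1 1 - V.1 0 1 * V.1 1 0) * 2 *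
        ((M.1 0 0 - M.1 1 1) * V.1 1 0 + M.1 1 0 * (V.1 1 1 - V.1 0 0)) = 0 := by
      linear_combination V.1 1 0 * (E2 - E1 - E3) - 2 * V.1 0 0 * E3
    exact (mul_eq_zero.1 this).resolve_left (mul_ne_zero hδ two_ne_zero)
  apply Units.ext
  rw [Units.val_mul, Units.val_mul]
  ext i j
  fin_cases i <;> fin_cases j <;>
    simp only [Matrix.mul_apply, Fin.sum_univ_two, Fin.zero_eta, Fin.mk_one, Fin.isValue]
  · linear_combination -F12
  · linear_combination F11
  · linear_combination F22
  · linear_combination F12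

/-! ### Minimal vectors -/

/-- The integral vector orthogonal to the row vector `p`. -/
def perp (p : Fin 2 → ℤ) : Fin 2 → ℤ := ![-(p 1), p 0]

lemma orbitDet_perp (p : Fin 2 → ℤ) : orbitDet M (perp p) = -assocForm M (p 0) (p 1) := by
  rw [orbitDet_eq_assocForm]; simp [perp]

lemma minPreimages_le_assocForm (hyp : IsHyperbolic M) (htr : 0 < tr M) {x y : ℤ}
    (h : x ≠ 0 ∨ y ≠ 0) : (minPreimages M : ℤ) ≤ |assocForm M x y| := by
  have hz : perp ![x, y] ≠ 0 := by
    intro h0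
    have h1 := congrFun h0 0
    have h2 := congrFun h0 1
    simp [perp] at h1 h2
    tauto
  have := minPreimages_le hyp htr hz
  rw [orbitDet_perp, Int.natAbs_neg] at this
  simp only [Matrix.cons_val_zero, Matrix.cons_val_one] at this
  rw [Int.abs_eq_natAbs]
  exact_mod_cast this

lemma IsSolution.abs_eq {p : Fin 2 → ℤ} (h : IsSolution M p) :
    |assocForm M (p 0) (p 1)| = minPreimages M := by
  rcases h with h | h <;> rw [h] <;> simp

lemma isSolution_of_abs_eq {p : Fin 2 → ℤ} (h : |assocForm M (p 0) (p 1)| = minPreimages M) :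
    IsSolution M p := by
  rcases abs_choice (assocForm M (p 0) (p 1)) with h' | h' <;> rw [h'] at h
  · exact Or.inl h
  · exact Or.inr (by omega)

/-- Dividing out a common factor g divides the value by g², which minimality of m forbids unless g =
1. -/
lemma IsSolution.isCoprime (hyp : IsHyperbolic M) (htr : 0 < tr M) {p : Fin 2 → ℤ}
    (h : IsSolution M p) : IsCoprime (p 0) (p 1) := by
  have hm : (0 : ℤ) < minPreimages M := by exact_mod_cast minPreimages_pos hyp htr
  obtain ⟨x, hx⟩ := Int.gcd_dvd_left (p 0) (p 1)
  obtain ⟨y, hy⟩ := Int.gcd_dvd_right (p 0) (p 1)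
  set g : ℤ := ((p 0).gcd (p 1) : ℤ) with hg
  have hQ : assocForm M (p 0) (p 1) = g ^ 2 * assocForm M x y := by
    rw [hx, hy]; unfold assocForm; ring
  have habs := h.abs_eq
  rw [hQ, abs_mul, abs_of_nonneg (sq_nonneg g)] at habs
  have hg0 : g ≠ 0 := by
    intro h0; rw [h0] at habs; simp at habs; omega
  have hxy : x ≠ 0 ∨ y ≠ 0 := by
    by_contra! h0
    rw [h0.1, h0.2] at habs; simp [assocForm] at habs; omega
  have hle := minPreimages_le_assocForm hyp htr hxy
  have hg1 : g = 1 := by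
    have h0 : 0 ≤ g := by positivity
    by_contra h1
    have h2 : 2 ≤ g := by omega
    have h3 : 2 ≤ g ^ 2 := by nlinarith
    nlinarith
  rw [Int.isCoprime_iff_gcd_eq_one]
  rw [hg] at hg1
  exact Int.ofNat_inj.1 hg1

/-! ### The form `[m, n, l]` of a minimal vector -/

variable (M) in
/-- The vector `p` is completed by a second column to a change of variables taking `± f_T` to a
form with first coefficients `m`, `n`, the sign being the determinant. -/
def HasRoot (p : Fin 2 → ℤ) (n : ℤ) : Prop :=
  ∃ (B : GL (Fin 2) ℤ) (l : ℤ), B.1 0 0 = p 0 ∧ B.1 1 0 = p 1 ∧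
    ∀ x y, bqf (minPreimages M) n l x y
      = dt B * assocForm M (B.1 0 0 * x + B.1 0 1 * y) (B.1 1 0 * x + B.1 1 1 * y)

lemma disc_of_bqf_eq {B : GL (Fin 2) ℤ} {m n l : ℤ} (h : ∀ x y, bqf m n l x y
      = dt B * assocForm M (B.1 0 0 * x + B.1 0 1 * y) (B.1 1 0 * x + B.1 1 1 * y)) :
    n ^ 2 - disc M = 4 * m * l := by
  have h1 := h 1 0
  have h2 := h 0 1
  have h3 := h 1 1
  have hd : dt B ^ 2 = 1 := by rcases dt_cases B with h | h <;> rw [h] <;> norm_num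
  have hd' := dt_eq (M := B)
  simp only [bqf, assocForm] at h1 h2 h3
  set δ := dt B
  set α := M.1 0 1
  set β := M.1 0 0 - M.1 1 1 with hβ
  set γ := M.1 1 0
  set a := B.1 0 0
  set b := B.1 0 1
  set c := B.1 1 0
  set d := B.1 1 1
  have hm : m = δ * (α * a ^ 2 - β * a * c - γ * c ^ 2) := by linear_combination h1
  have hl : l = δ * (α * b ^ 2 - β * b * d - γ * d ^ 2) := by linear_combination h2
  have hn : n = δ * (2 * α * a * b - β * (a * d + b * c) - 2 * γ * c * d) := by
    linear_combination h3 - h1 - h2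
  have hD : disc M = β ^ 2 + 4 * (α * γ) := disc_eq
  have key : n ^ 2 - 4 * m * l = δ ^ 2 * (β ^ 2 + 4 * (α * γ)) * (a * d - b * c) ^ 2 := by
    rw [hm, hl, hn]; ring
  rw [← hd', hd] at key
  rw [hD]
  linear_combination key

lemma HasRoot.isSolution {p : Fin 2 → ℤ} {n : ℤ} (h : HasRoot M p n) : IsSolution M p := by
  obtain ⟨B, l, h0, h1, h⟩ := h
  have e := h 1 0
  rw [mul_one, mul_one, mul_zero, mul_zero, add_zero, add_zero, h0, h1] at e
  simp only [bqf] at e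
  rcases dt_cases B with hB | hB <;> rw [hB] at e
  · exact Or.inl (by linear_combination -e)
  · exact Or.inr (by linear_combination e)

/-- A Bézout relation completes `p` to a basis with determinant equal to the sign of its value.
Adding `t` times `p` to the second column moves the middle coefficient by `2 * m * t`, hence into
the required range. -/
lemma IsSolution.exists_hasRoot (hyp : IsHyperbolic M) (htr : 0 < tr M) {p : Fin 2 → ℤ}
    (h : IsSolution M p) : ∃ n, 0 ≤ n ∧ n < 2 * (minPreimages M : ℤ) ∧ HasRoot M p n := by
  have hm : (0 : ℤ) < minPreimages M := by exact_mod_cast minPreimages_pos hyp htr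
  obtain ⟨u, v, huv⟩ := h.isCoprime hyp htr
  obtain ⟨s, hs, hsm⟩ : ∃ s : ℤ, (s = 1 ∨ s = -1) ∧
      s * assocForm M (p 0) (p 1) = minPreimages M := by
    rcases h with h | h
    · exact ⟨1, Or.inl rfl, by rw [h, one_mul]⟩
    · exact ⟨-1, Or.inr rfl, by rw [h]; ring⟩
  have hs2 : s * s = 1 := by rcases hs with rfl | rfl <;> norm_num
  set m : ℤ := (minPreimages M : ℤ)
  -- The signed polar form of f_T at `p`; its value at the second column is the middle coefficient.
  let polar : ℤ → ℤ → ℤ := fun x y => s * (2 * M.1 0 1 * p 0 * x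
    - (M.1 0 0 - M.1 1 1) * (p 0 * y + x * p 1) - 2 * M.1 1 0 * p 1 * y)
  set n₀ := polar (-s * v) (s * u) with hn₀
  set t := -(n₀ / (2 * m)) with ht
  have hn : n₀ % (2 * m) = n₀ + 2 * m * t := by
    rw [ht, Int.emod_def]; ring
  refine ⟨n₀ % (2 * m), Int.emod_nonneg _ (by omega), Int.emod_lt_of_pos _ (by omega), ?_⟩
  have hdet : p 0 * (s * u + t * p 1) - (-s * v + t * p 0) * p 1 = s := by
    linear_combination s * huv
  obtain ⟨B, hB⟩ := exists_of_det (a := p 0) (b := -s * v + t * p 0) (c := p 1)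
    (d := s * u + t * p 1) (by rwa [hdet])
  have b00 : B.1 0 0 = p 0 := by rw [hB]; rfl
  have b01 : B.1 0 1 = -s * v + t * p 0 := by rw [hB]; rfl
  have b10 : B.1 1 0 = p 1 := by rw [hB]; rfl
  have b11 : B.1 1 1 = s * u + t * p 1 := by rw [hB]; rfl
  have hdB : dt B = s := by rw [dt_eq, b00, b01, b10, b11, hdet]
  refine ⟨B, s * assocForm M (-s * v + t * p 0) (s * u + t * p 1), b00, b10, fun x y => ?_⟩
  rw [hdB, b00, b01, b10, b11, hn, bqf]
  have hsm' : m = s * assocForm M (p 0) (p 1) := hsm.symm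
  change m * x ^ 2 + _ + _ = _
  rw [hsm', hn₀]
  simp only [polar, assocForm]
  ring

lemma mulVec_fin_two (K : GL (Fin 2) ℤ) (x y : ℤ) :
    K.1.mulVec ![x, y] = ![K.1 0 0 * x + K.1 0 1 * y, K.1 1 0 * x + K.1 1 1 * y] := by
  ext i; fin_cases i <;> simp [Matrix.mulVec, dotProduct, Fin.sum_univ_two]

lemma vecMul_fin_two (p : Fin 2 → ℤ) (V : GL (Fin 2) ℤ) :
    Matrix.vecMul p V.1
      = ![V.1 0 0 * p 0 + V.1 1 0 * p 1, V.1 0 1 * p 0 + V.1 1 1 * p 1] := by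
  ext i; fin_cases i <;> simp [Matrix.vecMul, dotProduct, Fin.sum_univ_two, mul_comm]

/-- Vectors with the same root differ by a matrix commuting with `M`. -/
lemma HasRoot.exists_commute (hyp : IsHyperbolic M) (htr : 0 < tr M) {p q : Fin 2 → ℤ} {n : ℤ}
    (hp : HasRoot M p n) (hq : HasRoot M q n) :
    ∃ V : GL (Fin 2) ℤ, Commute V M ∧ p = Matrix.vecMul q V.1 := by
  have hm : (0 : ℤ) < minPreimages M := by exact_mod_cast minPreimages_pos hyp htr
  obtain ⟨B, l, b0, b1, hB⟩ := hp
  obtain ⟨C, l', c0, c1, hC⟩ := hq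
  -- Both forms have discriminant D, so `m` and `n` determine the last coefficient.
  obtain rfl : l = l' := by
    have := (disc_of_bqf_eq hB).symm.trans (disc_of_bqf_eq hC)
    exact mul_left_cancel₀ (by omega : 4 * (minPreimages M : ℤ) ≠ 0) this
  -- The change of variables `B * C⁻¹` acts on columns while solutions are rows, hence the
  -- transpose.
  obtain ⟨V, hV⟩ := exists_transpose (B * C⁻¹)
  have hVe : ∀ i j, V.1 i j = (B * C⁻¹).1 j i := fun i j => by rw [hV]; rfl
  have hdV : dt V * dt C = dt B := by
    have : dt V = dt (B * C⁻¹) := by rw [dt, hV, Matrix.det_transpose]; rfl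
    rw [this, ← dt_mul, inv_mul_cancel_right]
  have hmul : ∀ w, (B * C⁻¹).1.mulVec (C.1.mulVec w) = B.1.mulVec w := by
    intro w
    rw [Matrix.mulVec_mulVec, ← Units.val_mul, inv_mul_cancel_right]
  refine ⟨V, commute_of_assocForm fun x y => ?_, ?_⟩
  · simp only [hVe]
    set w := C⁻¹.1.mulVec ![x, y] with hw
    have hCw : C.1.mulVec w = ![x, y] := by
      rw [hw, Matrix.mulVec_mulVec, ← Units.val_mul, mul_inv_cancel, Units.val_one,
        Matrix.one_mulVec]
    have hw' : w = ![w 0, w 1] := by ext i; fin_cases i <;> rfl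
    have hBw := hmul w
    rw [hCw, mulVec_fin_two, hw', mulVec_fin_two] at hBw
    rw [hw', mulVec_fin_two] at hCw
    have e := (hB (w 0) (w 1)).symm.trans (hC (w 0) (w 1))
    have x0 := congrFun hCw 0
    have x1 := congrFun hCw 1
    have y0 := congrFun hBw 0
    have y1 := congrFun hBw 1
    simp only [Matrix.cons_val_zero, Matrix.cons_val_one] at x0 x1 y0 y1
    rw [← y0, ← y1, x0, x1] at e
    rcases dt_cases B with h1 | h1 <;> rcases dt_cases C with h2 | h2 <;>
      rw [h1, h2] at hdV <;> rw [h1, h2] at e <;>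
      (have h3 : dt V = 1 ∨ dt V = -1 := dt_cases V) <;> rcases h3 with h3 | h3 <;>
      rw [h3] at hdV ⊢ <;> first | linear_combination e | linear_combination -e | omega
  · have h := hmul ![1, 0]
    rw [mulVec_fin_two, mulVec_fin_two, mulVec_fin_two] at h
    simp only [mul_one, mul_zero, add_zero, b0, b1, c0, c1] at h
    rw [vecMul_fin_two]
    simp only [hVe]
    rw [h]
    ext i; fin_cases i <;> rfl

/-- Replacing `B` by the transpose of `V` times `B` introduces `det V` twice, once through the form
and once through the sign, and the two cancel. -/
lemma HasRoot.vecMul {p : Fin 2 → ℤ} {n : ℤ} (h : HasRoot M p n) {V : GL (Fin 2) ℤ}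
    (hV : Commute V M) : HasRoot M (Matrix.vecMul p V.1) n := by
  obtain ⟨B, l, b0, b1, hB⟩ := h
  obtain ⟨W, hW⟩ := exists_transpose V
  have e : ∀ i j, (W * B).1 i j = V.1 0 i * B.1 0 j + V.1 1 i * B.1 1 j := by
    intro i j
    rw [Units.val_mul, hW, Matrix.mul_apply, Fin.sum_univ_two]
    rfl
  have hd : dt (W * B) = dt V * dt B := by
    rw [dt_mul, dt, hW, Matrix.det_transpose]; rfl
  have hV2 : dt V * dt V = 1 := by rcases dt_cases V with h | h <;> rw [h] <;> norm_num
  refine ⟨W * B, l, ?_, ?_, fun x y => ?_⟩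
  · rw [e, vecMul_fin_two, b0, b1]; rfl
  · rw [e, vecMul_fin_two, b0, b1]; rfl
  · rw [hB, hd]
    simp only [e]
    have := assocForm_of_commute hV (B.1 0 0 * x + B.1 0 1 * y) (B.1 1 0 * x + B.1 1 1 * y)
    have e0 : (V.1 0 0 * B.1 0 0 + V.1 1 0 * B.1 1 0) * x + (V.1 0 0 * B.1 0 1 + V.1 1 0 * B.1 1 1) * y
        = V.1 0 0 * (B.1 0 0 * x + B.1 0 1 * y) + V.1 1 0 * (B.1 1 0 * x + B.1 1 1 * y) := by ring
    have e1 : (V.1 0 1 * B.1 0 0 + V.1 1 1 * B.1 1 0) * x + (V.1 0 1 * B.1 0 1 + V.1 1 1 * B.1 1 1) * y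
        = V.1 0 1 * (B.1 0 0 * x + B.1 0 1 * y) + V.1 1 1 * (B.1 1 0 * x + B.1 1 1 * y) := by ring
    rw [e0, e1, this]
    linear_combination -(dt B * assocForm M (B.1 0 0 * x + B.1 0 1 * y)
      (B.1 1 0 * x + B.1 1 1 * y)) * hV2

lemma SameSeries.exists_commute {p q : Fin 2 → ℤ} (h : SameSeries M p q) :
    ∃ V : GL (Fin 2) ℤ, Commute V M ∧ p = Matrix.vecMul q V.1 := by
  obtain ⟨n, h | h⟩ := h
  · exact ⟨M ^ n, (Commute.refl M).zpow_left n, h⟩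
  · refine ⟨-M ^ n, ((Commute.refl M).zpow_left n).neg_left, ?_⟩
    rw [h, Units.val_neg, Matrix.vecMul_neg]

lemma HasRoot.sameSeries (hyp : IsHyperbolic M) (htr : 0 < tr M) (hprim : IsPrimitive M)
    {p q : Fin 2 → ℤ} {n : ℤ} (hp : HasRoot M p n) (hq : HasRoot M q n) : SameSeries M p q := by
  obtain ⟨V, hV, h⟩ := hp.exists_commute hyp htr hq
  obtain ⟨k, rfl | rfl⟩ := commutant_of_isPrimitive hyp htr hprim hV
  · exact ⟨k, Or.inl h⟩
  · refine ⟨k, Or.inr ?_⟩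
    rw [h, Units.val_neg, Matrix.vecMul_neg]

/-- The roots of one vector are congruent modulo `2 m`. -/
lemma HasRoot.dvd_sub (hyp : IsHyperbolic M) (htr : 0 < tr M) {p : Fin 2 → ℤ} {n n' : ℤ}
    (h : HasRoot M p n) (h' : HasRoot M p n') : 2 * (minPreimages M : ℤ) ∣ n' - n := by
  have hm : (0 : ℤ) < minPreimages M := by exact_mod_cast minPreimages_pos hyp htr
  obtain ⟨B, l, b0, b1, hB⟩ := h
  obtain ⟨C, l', c0, c1, hC⟩ := h'
  have hB1 := hB 1 0
  have hB2 := hB 0 1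
  have hB3 := hB 1 1
  have hC1 := hC 1 0
  have hC2 := hC 0 1
  have hC3 := hC 1 1
  have dB := dt_eq (M := B)
  have dC := dt_eq (M := C)
  rw [b0, b1] at hB1 hB2 hB3 dB
  rw [c0, c1] at hC1 hC2 hC3 dC
  have hd : dt B = dt C := by
    have h1 : dt B * assocForm M (p 0) (p 1) = minPreimages M := by
      have := hB1; simp [bqf] at this; exact this.symm
    have h2 : dt C * assocForm M (p 0) (p 1) = minPreimages M := by
      have := hC1; simp [bqf] at this; exact this.symm
    have h3 : assocForm M (p 0) (p 1) ≠ 0 := by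
      intro h0; rw [h0, mul_zero] at h1; omega
    exact mul_right_cancel₀ h3 (h1.trans h2.symm)
  rw [← hd] at hC1 hC2 hC3 dC
  have hδ : dt B ^ 2 = 1 := by rcases dt_cases B with h | h <;> rw [h] <;> norm_num
  simp only [bqf, assocForm] at hB1 hB2 hB3 hC1 hC2 hC3
  set δ := dt B
  set x := C.1 0 1 - B.1 0 1 with hx
  set y := C.1 1 1 - B.1 1 1 with hy
  have hC01 : C.1 0 1 = B.1 0 1 + x := by rw [hx]; ring
  have hC11 : C.1 1 1 = B.1 1 1 + y := by rw [hy]; ring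
  rw [hC01, hC11] at hC1 hC2 hC3 dC
  have hxy : p 0 * y - x * p 1 = 0 := by linear_combination dB - dC
  -- Two completions of `p` with the same determinant differ in the second column by a multiple of
  -- `p`; `t` is that multiple by Cramer's rule, and the roots differ by `2 * m * t`.
  set t := δ * (x * B.1 1 1 - y * B.1 0 1) with ht
  have tx : t * p 0 = x := by
    rw [ht]; linear_combination -δ * x * dB + x * hδ - δ * B.1 0 1 * hxy
  have ty : t * p 1 = y := by
    rw [ht]; linear_combination -δ * y * dB + y * hδ - δ * B.1 1 1 * hxy
  refine ⟨t, ?_⟩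
  rw [← tx, ← ty] at hC1 hC2 hC3
  linear_combination (hC3 - hC1 - hC2) - (hB3 - hB1 - hB2) - 2 * t * hB1

variable (M) in
/-- The minimum roots attached to the solutions. -/
def rootSet : Set ℤ := {n | 0 ≤ n ∧ n < 2 * (minPreimages M : ℤ) ∧ ∃ p, HasRoot M p n}

/-- The two kinds of equivalence are the two values of `dt B`, and the congruence for `n` is
automatic by invariance of the discriminant. -/
lemma numSeries_eq_ncard : numSeries M = (rootSet M).ncard := by
  unfold numSeries rootSet
  congr 1
  ext n
  refine and_congr_right fun _ => and_congr_right fun _ => ⟨?_, ?_⟩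
  · rintro ⟨l, -, ⟨B, hB, h⟩ | ⟨B, hB, h⟩⟩
    · exact ⟨![B.1 0 0, B.1 1 0], B, l, rfl, rfl, fun x y => by rw [h, hB, one_mul]⟩
    · exact ⟨![B.1 0 0, B.1 1 0], B, l, rfl, rfl, fun x y => by rw [h, hB, neg_one_mul]⟩
  · rintro ⟨p, B, l, -, -, h⟩
    refine ⟨l, disc_of_bqf_eq h, ?_⟩
    rcases dt_cases B with hB | hB
    · exact Or.inl ⟨B, hB, fun x y => by rw [h, hB, one_mul]⟩
    · exact Or.inr ⟨B, hB, fun x y => by rw [h, hB, neg_one_mul]⟩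

lemma finite_rootSet : (rootSet M).Finite :=
  (Set.finite_Ico 0 (2 * (minPreimages M : ℤ))).subset fun _ h => ⟨h.1, h.2.1⟩

/-- Choose one vector for each root. Every solution has a root in the range, and equal roots put
vectors in one series. Conversely, the root is constant along a series and unique in the range. -/
theorem exists_isBasisSystem (hyp : IsHyperbolic M) (htr : 0 < tr M) (hprim : IsPrimitive M) :
    ∃ b : Fin (numSeries M) → Fin 2 → ℤ, IsBasisSystem M b := by
  have : Finite (rootSet M) := finite_rootSet
  have hcard : Nat.card (rootSet M) = numSeries M := by
    rw [numSeries_eq_ncard]; rfl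
  let e : Fin (numSeries M) ≃ rootSet M := (Finite.equivFinOfCardEq hcard).symm
  choose b hb using fun j => (e j).2.2.2
  refine ⟨b, fun j => (hb j).isSolution, fun p hp => ?_, fun i j hij hs => hij ?_⟩
  · obtain ⟨n, h0, h1, hn⟩ := hp.exists_hasRoot hyp htr
    refine ⟨e.symm ⟨n, h0, h1, p, hn⟩, hn.sameSeries hyp htr hprim ?_⟩
    simpa using hb (e.symm ⟨n, h0, h1, p, hn⟩)
  · obtain ⟨V, hV, h⟩ := hs.exists_commute
    have h1 := (hb j).vecMul hV
    rw [← h] at h1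
    have h2 := (hb i).dvd_sub hyp htr h1
    obtain ⟨i0, i1, -⟩ := (e i).2
    obtain ⟨j0, j1, -⟩ := (e j).2
    have h3 : ((e j : ℤ) - e i) = 0 := by
      apply Int.eq_zero_of_abs_lt_dvd h2
      rw [abs_lt]; constructor <;> linarith
    exact e.injective (Subtype.ext (by linarith))

/-! ### The points attached to the solutions -/

/-- For w = -σMv with v = `perp p`, Cayley–Hamilton and σ² = 1 give √D·u(w) = v + λw, which is the
defining expression of the point; and u(Mv) = λu(v). -/
lemma solutionPoint_eq (hD : 0 < disc M) (p : Fin 2 → ℤ) :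
    solutionPoint M p = (-(dt M : ℝ) * lam M) • uPart M (intVec (perp p)) := by
  have hσ : (dt M : ℝ) * dt M = 1 := by
    rcases dt_cases M with h | h <;> rw [h] <;> norm_num
  have h0 : ∀ v, uPart M (-(dt M : ℝ) • (realMat M).mulVec v)
      = (√(disc M : ℝ))⁻¹ • (v + lam M • (-(dt M : ℝ) • (realMat M).mulVec v)) := by
    intro v
    rw [uPart, Matrix.mulVec_smul, mulVec_mulVec_self, ← lam_add_conjLam]
    congr 1
    have : (-(dt M : ℝ)) • ((lam M + conjLam M) • (realMat M).mulVec v - (dt M : ℝ) • v)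
        = ((dt M : ℝ) * dt M) • v
          + (-(dt M : ℝ) * (lam M + conjLam M)) • (realMat M).mulVec v := by module
    rw [this, hσ]
    module
  rw [mul_smul, ← uPart_mulVec hD, ← uPart_smul, h0, mulVec_intVec]
  ext i
  fin_cases i <;> simp [solutionPoint, intVec, perp] <;> ring

/-- The quarter turn `perp` conjugates the transpose of `V` into its adjugate, that is, det V times
the inverse. -/
lemma perp_vecMul (p : Fin 2 → ℤ) (V : GL (Fin 2) ℤ) :
    perp (Matrix.vecMul p V.1) = dt V • V⁻¹.1.mulVec (perp p) := by
  have h : V.1.mulVec (perp (Matrix.vecMul p V.1)) = dt V • perp p := by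
    rw [vecMul_fin_two, perp, mulVec_fin_two, dt_eq]
    ext i; fin_cases i <;> simp [perp] <;> ring
  rw [← Matrix.mulVec_smul, ← h, Matrix.mulVec_mulVec, ← Units.val_mul, inv_mul_cancel,
    Units.val_one, Matrix.one_mulVec]

lemma perp_neg (p : Fin 2 → ℤ) : perp (-p) = -perp p := by
  ext i; fin_cases i <;> simp [perp]

/-- Along a series the images on the expanding line change by a sign and a power of `λ`. -/
lemma SameSeries.uPart_perp (hD : 0 < disc M) (hl : lam M ≠ 0) {p q : Fin 2 → ℤ}
    (h : SameSeries M p q) : ∃ (δ : ℝ) (k : ℤ), (δ = 1 ∨ δ = -1) ∧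
      uPart M (intVec (perp p)) = (δ * lam M ^ k) • uPart M (intVec (perp q)) := by
  obtain ⟨n, h⟩ := h
  have key : uPart M (intVec (perp (Matrix.vecMul q (M ^ n : GL (Fin 2) ℤ).1)))
      = ((dt (M ^ n) : ℝ) * lam M ^ (-n)) • uPart M (intVec (perp q)) := by
    rw [perp_vecMul, intVec_smul, uPart_smul, ← zpow_neg, ← mulVec_intVec,
      (parts_zpow hD hl _ _).1, mul_smul]
  have hd : (dt (M ^ n) : ℝ) = 1 ∨ (dt (M ^ n) : ℝ) = -1 := by
    rcases dt_cases (M ^ n) with h | h <;> rw [h] <;> simp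
  rcases h with h | h
  · exact ⟨dt (M ^ n), -n, hd, by rw [h, key]⟩
  · refine ⟨-dt (M ^ n), -n, hd.symm.imp (fun h => by rw [h, neg_neg]) (fun h => by rw [h]), ?_⟩
    rw [h, perp_neg, intVec_neg, ← neg_one_smul ℝ (intVec _), uPart_smul, key, smul_smul]
    congr 1
    ring

/-- The factor is absorbed into the integer vector through λ^k u(z) = u(M^k z). -/
lemma isHomoclinic_solutionPoint (hD : 0 < disc M) (hl : 1 < lam M) (p : Fin 2 → ℤ) (κ : ℤ)
    {δ : ℝ} (hδ : δ = 1 ∨ δ = -1) :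
    IsHomoclinic M (toTorus ((δ * lam M ^ κ) • solutionPoint M p)) := by
  have hl0 : lam M ≠ 0 := by linarith
  obtain ⟨a, ha⟩ : ∃ a : ℤ, δ = a := by
    rcases hδ with rfl | rfl
    exacts [⟨1, by norm_num⟩, ⟨-1, by norm_num⟩]
  have : (δ * lam M ^ κ) • solutionPoint M p
      = uPart M (intVec ((a * -dt M) • (M ^ (κ + 1)).1.mulVec (perp p))) := by
    rw [intVec_smul, uPart_smul, ← mulVec_intVec, (parts_zpow hD hl0 _ _).1,
      solutionPoint_eq hD, smul_smul, smul_smul, ha, zpow_add_one₀ hl0]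
    push_cast
    congr 1
    ring
  rw [this]
  exact isHomoclinic_uPart hD hl _

end Forms

end ArithCoding

theorem theorem3p5 (M : GL (Fin 2) ℤ) (hyp : ArithCoding.IsHyperbolic M)
    (htr : 0 < ArithCoding.tr M) (hprim : ArithCoding.IsPrimitive M) :
    (∃ b : Fin (ArithCoding.numSeries M) → Fin 2 → ℤ, ArithCoding.IsBasisSystem M b) ∧
    ∀ b : Fin (ArithCoding.numSeries M) → Fin 2 → ℤ, ArithCoding.IsBasisSystem M b →
      (∀ j, ∀ κ : ℤ, ∀ δ : ℝ, δ = 1 ∨ δ = -1 →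
        ArithCoding.IsHomoclinic M (ArithCoding.toTorus
          ((δ * ArithCoding.lam M ^ κ) • ArithCoding.solutionPoint M (b j)))) ∧
      ∀ φ X, ArithCoding.IsMinimalCoding M φ X →
        ∃ (κ : ℤ) (j : Fin (ArithCoding.numSeries M)) (δ : ℝ), (δ = 1 ∨ δ = -1) ∧
          ∀ e : ArithCoding.SymSeq (ArithCoding.lam M),
            ArithCoding.HasCodingSum (ArithCoding.lam M)
              ((δ * ArithCoding.lam M ^ κ) • ArithCoding.solutionPoint M (b j)) e.digit (φ e) := by
  open ArithCoding in
  have hD := disc_pos hyp htr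
  obtain ⟨r, c, b', d, hU, -⟩ := exists_unitCase hyp htr
  have hl : 1 < lam M := hU.one_lt
  have hl0 : lam M ≠ 0 := by linarith
  refine ⟨exists_isBasisSystem hyp htr hprim, fun b hb =>
    ⟨fun j κ δ hδ => isHomoclinic_solutionPoint hD hl _ κ hδ, fun φ X hφ => ?_⟩⟩
  obtain ⟨z, hz, hpt, hsum⟩ := hφ.1.exists_vector hD hl
  -- The row vector whose `perp` is `z`. The degree formula together with minimality of the coding
  -- says that |f_T| takes the value m there.
  have hp : IsSolution M ![z 1, -z 0] := by
    refine isSolution_of_abs_eq ?_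
    have hK := hφ.1.eq_natAbs hD hU (orbitDet_ne_zero hyp htr hz) hpt hsum hφ.2
    rw [hK, orbitDet_eq_assocForm, Int.natAbs_neg, Int.natCast_natAbs]
    rfl
  have hperp : perp ![z 1, -z 0] = z := by
    ext i; fin_cases i <;> simp [perp]
  obtain ⟨j, hj⟩ := hb.complete _ hp
  obtain ⟨δ, k, hδ, h⟩ := hj.uPart_perp hD hl0
  rw [hperp] at h
  have hσ : (dt M : ℝ) * dt M = 1 := by
    rcases dt_cases M with h | h <;> rw [h] <;> norm_num
  -- The shift of the exponent and the extra sign cancel the factor -σλ of `solutionPoint_eq`.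
  refine ⟨k - 1, j, δ * -dt M, ?_, fun e => ?_⟩
  · rcases dt_cases M with h' | h' <;> rcases hδ with rfl | rfl <;> rw [h'] <;> simp
  · have := hsum e
    rw [h] at this
    convert this using 1
    rw [solutionPoint_eq hD, smul_smul, zpow_sub_one₀ hl0]
    congr 1
    rw [show δ * -(dt M : ℝ) * (lam M ^ k * (lam M)⁻¹) * (-(dt M : ℝ) * lam M)
      = δ * lam M ^ k * ((dt M : ℝ) * dt M) * (lam M * (lam M)⁻¹) by ring, hσ,
      mul_inv_cancel₀ hl0, mul_one, mul_one]
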